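/- Let $\mathfrak g=Q(n)$ be the complex queer Lie superalgebra of block matrices $\begin{pmatrix}A&B\\B&A\end{pmatrix}$ with $A,B\in M_n(\mathbb C)$, where $B=0$ (respectively $A=0$) gives the even part $\mathfrak g_{\bar 0}\cong\mathfrak{gl}_n$ (respectively the odd part $\mathfrak g_{\bar 1}$), with the supercommutator as bracket. Let $\chi\in\mathfrak g_{\bar 0}^*\subset\mathfrak g^*$ be a regular nilpotent even functional: the closure of its coadjoint $GL_n$-orbit contains $0$, and $\dim\mathfrak g^\chi_{\bar 0}$ is minimal among the even nilpotent functionals, where $\mathfrak g^\chi=\{x\in\mathfrak g:\chi([x,\mathfrak g])=0\}$. Let $\mathfrak g=\bigoplus_{j\in\mathbb Z}\mathfrak g_j$ be a good $\mathbb Z$-grading for $\chi$, that is, a grading of the Lie superalgebra $\mathfrak g$ (compatible with parity) with $\chi(\mathfrak g_j)=0$ for $j\ne-2$ and $\mathfrak g^\chi\subset\bigoplus_{j\ge0}\mathfrak g_j$. Let $\mathfrak l\subset\mathfrak g_{-1}$ be a maximal isotropic subspace for the form $\chi([\cdot,\cdot])$, and put $\mathfrak m=\bigoplus_{j\le-2}\mathfrak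 g_j\oplus\mathfrak l$. Let $I_\chi$ be the left ideal of $U(\mathfrak g)$ generated by $a-\chi(a)$, $a\in\mathfrak m$, let $Q_\chi=U(\mathfrak g)/I_\chi$ with projection $\pi:U(\mathfrak g)\to Q_\chi$, and let $W_\chi=\operatorname{End}_{U(\mathfrak g)}(Q_\chi)^{op}$, identified via $w\mapsto w(\pi(1))$ with a subspace of $Q_\chi$. The Kazhdan filtration of $U(\mathfrak g)$ is the $\mathbb Z$-filtration induced from the grading of the tensor algebra in which the elements of $\mathfrak g_j$ have degree $j+2$; it induces filtrations on $Q_\chi$ and on $W_\chi$. Let $\operatorname{Gr}_KW_\chi$ be the associated graded algebra of $W_\chi$, and let $S(\mathfrak g^\chi)$ be the symmetric (supercommutative) algebra of the super vector space $\mathfrak g^\chi$. Then $\dim\mathfrak g^\chi=(n|n)$, the number $\dim(\mathfrak g_{-1})_{\bar1}$ is even, and there is an isomorphism of algebras $$S(\mathfrak g^\chi)\simeq\operatorname{Gr}_KW_\chi$$ preserving the parity and the Kazhdan degree, where the elements of $\mathfrak g^\chi\cap\mathfrak g_j$ have degree $j+2$ in $S(\mathfrak g^\chi)$. (This is the case $\mathfrak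 g=Q(n)$, $\chi$ regular, of the conjecture that $\operatorname{Gr}_KW_\chi$ is isomorphic to $S(\mathfrak g^\chi)$ if $\dim(\mathfrak g_{-1})_{\bar1}$ is even, and to $S(\mathfrak g^\chi)\otimes\mathbb C[\xi]$ with $\xi$ an exterior generator if it is odd.) -/

import Mathlib

open scoped DirectSum

noncomputable section

/-! ### Lie superalgebras -/

/-- The sign `(-1)^{ij}` attached to a pair of parities. -/
def superSign (i j : ZMod 2) : ℂ := if i = 1 ∧ j = 1 then -1 else 1

/-- A complex Lie superalgebra. `part 0` and `part 1` are the even and the odd part. -/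
class LieSuperalgebra (g : Type) [AddCommGroup g] [Module ℂ g] where
  part : ZMod 2 → Submodule ℂ g
  isCompl : IsCompl (part 0) (part 1)
  bracket : g →ₗ[ℂ] g →ₗ[ℂ] g
  bracket_mem : ∀ i j x y, x ∈ part i → y ∈ part j → bracket x y ∈ part (i + j)
  skew : ∀ i j x y, x ∈ part i → y ∈ part j → bracket x y = -(superSign i j • bracket y x)
  jacobi : ∀ i j x y z, x ∈ part i → y ∈ part j →
    bracket x (bracket y z) = bracket (bracket x y) z + superSign i j • bracket y (bracket x z)

/-! ### Gradings spanned by monomials -/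

/-- Given a linear map `ι : V → A` into an algebra and a family of subspaces `P m ⊆ V`, the span
of all products `ι v₁ ⋯ ι v_r` (`r ≥ 0`) with `v_k ∈ P m_k` and `m₁ + ⋯ + m_r = m`; in other words,
the image in `A` of the degree `m` part of the tensor algebra of `V`. -/
def monomialSpan {M V A : Type} [AddMonoid M] [AddCommGroup V] [Module ℂ V] [Ring A] [Algebra ℂ A]
    (ι : V →ₗ[ℂ] A) (P : M → Submodule ℂ V) (m : M) : Submodule ℂ A :=
  Submodule.span ℂ {a | ∃ l : List (M × V), (∀ q ∈ l, q.2 ∈ P q.1) ∧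
    (l.map Prod.fst).sum = m ∧ (l.map fun q => ι q.2).prod = a}

theorem one_mem_monomialSpan {M V A : Type} [AddMonoid M] [AddCommGroup V] [Module ℂ V] [Ring A]
    [Algebra ℂ A] (ι : V →ₗ[ℂ] A) (P : M → Submodule ℂ V) :
    (1 : A) ∈ monomialSpan ι P 0 :=
  Submodule.subset_span ⟨[], by simp, by simp, by simp⟩

theorem mul_mem_monomialSpan {M V A : Type} [AddMonoid M] [AddCommGroup V] [Module ℂ V] [Ring A]
    [Algebra ℂ A] (ι : V →ₗ[ℂ] A) (P : M → Submodule ℂ V) (m m' : M) (a b : A)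
    (ha : a ∈ monomialSpan ι P m) (hb : b ∈ monomialSpan ι P m') :
    a * b ∈ monomialSpan ι P (m + m') := by
  have h : monomialSpan ι P m * monomialSpan ι P m' ≤ monomialSpan ι P (m + m') := by
    unfold monomialSpan
    rw [Submodule.span_mul_span]
    apply Submodule.span_mono
    rintro _ ⟨a, ⟨l, h1, h2, h3⟩, b, ⟨l', h1', h2', h3'⟩, rfl⟩
    refine ⟨l ++ l', ?_, ?_, ?_⟩
    · intro q hq
      rcases List.mem_append.1 hq with hq | hq
      · exact h1 q hq
      · exact h1' q hq
    · simp [h2, h2']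
    · simp [h3, h3']
  exact h (Submodule.mul_mem_mul ha hb)

/-! ### Universal enveloping and symmetric superalgebras -/

section Algebras

variable (g : Type) [AddCommGroup g] [Module ℂ g] [LieSuperalgebra g]

/-- The relations `x y - (-1)^{|x||y|} y x = [x, y]` for homogeneous `x`, `y`. -/
inductive EnvRel : TensorAlgebra ℂ g → TensorAlgebra ℂ g → Prop
  | mk (i j : ZMod 2) (x y : g) (hx : x ∈ LieSuperalgebra.part i)
      (hy : y ∈ LieSuperalgebra.part j) :
      EnvRel (TensorAlgebra.ι ℂ x * TensorAlgebra.ι ℂ y)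
        (superSign i j • (TensorAlgebra.ι ℂ y * TensorAlgebra.ι ℂ x) +
          TensorAlgebra.ι ℂ (LieSuperalgebra.bracket x y))

/-- The universal enveloping algebra `U(g)` of a Lie superalgebra. -/
def Env : Type := RingQuot (EnvRel g)

instance : Ring (Env g) := inferInstanceAs (Ring (RingQuot (EnvRel g)))
instance : Algebra ℂ (Env g) := inferInstanceAs (Algebra ℂ (RingQuot (EnvRel g)))

/-- The canonical map `g → U(g)`. -/
def Env.ι : g →ₗ[ℂ] Env g :=
  (RingQuot.mkAlgHom ℂ (EnvRel g)).toLinearMap ∘ₗ TensorAlgebra.ι ℂ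

/-- The subspace `U(g)_p` of elements of parity `p`. -/
def Env.parity (p : ZMod 2) : Submodule ℂ (Env g) :=
  monomialSpan (Env.ι g) LieSuperalgebra.part p

end Algebras

/-- The relations `x y = (-1)^{|x||y|} y x` for homogeneous `x`, `y`. -/
inductive SymRel {V : Type} [AddCommGroup V] [Module ℂ V] (P : ZMod 2 → Submodule ℂ V) :
    TensorAlgebra ℂ V → TensorAlgebra ℂ V → Prop
  | mk (i j : ZMod 2) (x y : V) (hx : x ∈ P i) (hy : y ∈ P j) :
      SymRel P (TensorAlgebra.ι ℂ x * TensorAlgebra.ι ℂ y)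
        (superSign i j • (TensorAlgebra.ι ℂ y * TensorAlgebra.ι ℂ x))

/-- The symmetric (supercommutative) algebra `S(V)` of a super vector space `V` with even part
`P 0` and odd part `P 1`: polynomial in the even variables and exterior in the odd ones. -/
def SuperSym {V : Type} [AddCommGroup V] [Module ℂ V] (P : ZMod 2 → Submodule ℂ V) : Type :=
  RingQuot (SymRel P)

section SuperSym

variable {V : Type} [AddCommGroup V] [Module ℂ V] (P : ZMod 2 → Submodule ℂ V)

instance : Ring (SuperSym P) := inferInstanceAs (Ring (RingQuot (SymRel P)))
instance : Algebra ℂ (SuperSym P) := inferInstanceAs (Algebra ℂ (RingQuot (SymRel P)))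

/-- The canonical map `V → S(V)`. -/
def SuperSym.ι : V →ₗ[ℂ] SuperSym P :=
  (RingQuot.mkAlgHom ℂ (SymRel P)).toLinearMap ∘ₗ TensorAlgebra.ι ℂ

end SuperSym

/-! ### Filtered algebras and their associated graded algebras -/

/-- An increasing `ℤ`-filtration of a complex algebra, compatible with the multiplication. -/
structure AlgFiltration (A : Type) [Ring A] [Algebra ℂ A] where
  F : ℤ → Submodule ℂ A
  mono : ∀ i j, i ≤ j → F i ≤ F j
  one_mem : (1 : A) ∈ F 0
  mul_mem : ∀ i j a b, a ∈ F i → b ∈ F j → a * b ∈ F (i + j)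

namespace AlgFiltration

variable {A : Type} [Ring A] [Algebra ℂ A] (Φ : AlgFiltration A)

/-- The graded piece `F_k / F_{k-1}`. -/
def Piece (k : ℤ) : Type := Φ.F k ⧸ (Φ.F (k - 1)).submoduleOf (Φ.F k)

instance (k : ℤ) : AddCommGroup (Φ.Piece k) :=
  inferInstanceAs (AddCommGroup (Φ.F k ⧸ (Φ.F (k - 1)).submoduleOf (Φ.F k)))
instance (k : ℤ) : Module ℂ (Φ.Piece k) :=
  inferInstanceAs (Module ℂ (Φ.F k ⧸ (Φ.F (k - 1)).submoduleOf (Φ.F k)))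

/-- The class of an element of `F_k` in `F_k / F_{k-1}`. -/
def symbol (k : ℤ) : Φ.F k →ₗ[ℂ] Φ.Piece k :=
  Submodule.mkQ ((Φ.F (k - 1)).submoduleOf (Φ.F k))

theorem symbol_eq_iff (k : ℤ) (a b : Φ.F k) :
    Φ.symbol k a = Φ.symbol k b ↔ (a : A) - b ∈ Φ.F (k - 1) :=
  Submodule.Quotient.eq ((Φ.F (k - 1)).submoduleOf (Φ.F k))

theorem symbol_surjective (k : ℤ) : Function.Surjective (Φ.symbol k) :=
  Submodule.mkQ_surjective _

/-- The product of classes: `[a] [b] = [a b]`. -/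
def pieceMul {i j : ℤ} (x : Φ.Piece i) (y : Φ.Piece j) : Φ.Piece (i + j) :=
  Quotient.liftOn₂' x y
    (fun a b => Φ.symbol (i + j) ⟨(a : A) * b, Φ.mul_mem i j a b a.2 b.2⟩) (by
      intro a b a' b' ha hb
      have ha' : (a : A) - a' ∈ Φ.F (i - 1) := (Φ.symbol_eq_iff i a a').1 (Quotient.sound' ha)
      have hb' : (b : A) - b' ∈ Φ.F (j - 1) := (Φ.symbol_eq_iff j b b').1 (Quotient.sound' hb)
      rw [symbol_eq_iff]
      have h1 := Φ.mul_mem _ _ _ _ ha' b.2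
      have h2 := Φ.mul_mem _ _ _ _ a'.2 hb'
      rw [show i - 1 + j = i + j - 1 by ring] at h1
      rw [show i + (j - 1) = i + j - 1 by ring] at h2
      have h := add_mem h1 h2
      have e : ((a : A) - a') * b + a' * ((b : A) - b') = (a : A) * b - a' * b' := by noncomm_ring
      rw [e] at h
      exact h)

theorem pieceMul_symbol {i j : ℤ} (a : Φ.F i) (b : Φ.F j) :
    Φ.pieceMul (Φ.symbol i a) (Φ.symbol j b) =
      Φ.symbol (i + j) ⟨(a : A) * b, Φ.mul_mem i j a b a.2 b.2⟩ := rfl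

theorem mk_symbol_eq {i j : ℤ} (hij : i = j) (a : Φ.F i) (b : Φ.F j) (hab : (a : A) = b) :
    GradedMonoid.mk (A := Φ.Piece) i (Φ.symbol i a) = GradedMonoid.mk j (Φ.symbol j b) := by
  subst hij
  rw [Subtype.ext hab]

instance : GradedMonoid.GOne Φ.Piece where
  one := Φ.symbol 0 ⟨1, Φ.one_mem⟩

instance : GradedMonoid.GMul Φ.Piece where
  mul := Φ.pieceMul

instance : GradedMonoid.GMonoid Φ.Piece where
  one_mul := by
    rintro ⟨i, x⟩
    obtain ⟨a, rfl⟩ := Φ.symbol_surjective i x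
    exact Φ.mk_symbol_eq (zero_add i) _ _ (one_mul _)
  mul_one := by
    rintro ⟨i, x⟩
    obtain ⟨a, rfl⟩ := Φ.symbol_surjective i x
    exact Φ.mk_symbol_eq (add_zero i) _ _ (mul_one _)
  mul_assoc := by
    rintro ⟨i, x⟩ ⟨j, y⟩ ⟨k, z⟩
    obtain ⟨a, rfl⟩ := Φ.symbol_surjective i x
    obtain ⟨b, rfl⟩ := Φ.symbol_surjective j y
    obtain ⟨c, rfl⟩ := Φ.symbol_surjective k z
    exact Φ.mk_symbol_eq (add_assoc i j k) _ _ (mul_assoc _ _ _)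

instance : DirectSum.GSemiring Φ.Piece where
  mul_zero := by
    intro i j x
    obtain ⟨a, rfl⟩ := Φ.symbol_surjective i x
    refine (Φ.pieceMul_symbol a (0 : Φ.F j)).trans ?_
    rw [← map_zero (Φ.symbol (i + j))]
    congr 1
    ext
    simp
  zero_mul := by
    intro i j y
    obtain ⟨b, rfl⟩ := Φ.symbol_surjective j y
    refine (Φ.pieceMul_symbol (0 : Φ.F i) b).trans ?_
    rw [← map_zero (Φ.symbol (i + j))]
    congr 1
    ext
    simp
  mul_add := by
    intro i j x y z
    obtain ⟨a, rfl⟩ := Φ.symbol_surjective i x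
    obtain ⟨b, rfl⟩ := Φ.symbol_surjective j y
    obtain ⟨c, rfl⟩ := Φ.symbol_surjective j z
    refine (Φ.pieceMul_symbol a (b + c)).trans ?_
    refine Eq.trans ?_ (map_add (Φ.symbol (i + j)) _ _)
    congr 1
    ext
    simp [mul_add]
  add_mul := by
    intro i j x y z
    obtain ⟨a, rfl⟩ := Φ.symbol_surjective i x
    obtain ⟨b, rfl⟩ := Φ.symbol_surjective i y
    obtain ⟨c, rfl⟩ := Φ.symbol_surjective j z
    refine (Φ.pieceMul_symbol (a + b) c).trans ?_
    refine Eq.trans ?_ (map_add (Φ.symbol (i + j)) _ _)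
    congr 1
    ext
    simp [add_mul]
  natCast n := n • Φ.symbol 0 ⟨1, Φ.one_mem⟩
  natCast_zero := zero_smul _ _
  natCast_succ n := succ_nsmul _ _

instance : DirectSum.GAlgebra ℂ Φ.Piece where
  toFun := ((LinearMap.toSpanSingleton ℂ (Φ.Piece 0)
    (Φ.symbol 0 ⟨1, Φ.one_mem⟩)).toAddMonoidHom : ℂ →+ Φ.Piece 0)
  map_one := one_smul ℂ (Φ.symbol 0 ⟨1, Φ.one_mem⟩)
  map_mul := by
    intro r s
    exact Φ.mk_symbol_eq (zero_add 0).symm ((r * s) • ⟨1, Φ.one_mem⟩)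
      ⟨(r • (1 : A)) * (s • 1), _⟩ (by
        simp [mul_smul, smul_comm r s])
  commutes := by
    rintro r ⟨i, x⟩
    obtain ⟨a, rfl⟩ := Φ.symbol_surjective i x
    exact Φ.mk_symbol_eq ((zero_add i).trans (add_zero i).symm) ⟨(r • (1 : A)) * a, _⟩
      ⟨(a : A) * (r • 1), _⟩ (by simp)
  smul_def := by
    rintro r ⟨i, x⟩
    obtain ⟨a, rfl⟩ := Φ.symbol_surjective i x
    exact Φ.mk_symbol_eq (zero_add i).symm (r • a) ⟨(r • (1 : A)) * a, _⟩ (by simp)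

/-- The associated graded algebra `Gr A = ⨁ₖ F_k / F_{k-1}`, with the product `[a] [b] = [a b]`. -/
abbrev Gr : Type := ⨁ k : ℤ, Φ.Piece k

end AlgFiltration

/-! ### Finite W-algebras -/

section W

variable {g : Type} [AddCommGroup g] [Module ℂ g] [LieSuperalgebra g]

/-- The functional `χ` on `g` is even, i.e. it vanishes on the odd part. -/
def IsEvenFunctional (χ : g →ₗ[ℂ] ℂ) : Prop :=
  ∀ x ∈ LieSuperalgebra.part (g := g) 1, χ x = 0

/-- The annihilator `g^χ = {x | χ([x, g]) = 0}`. -/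
def annihilator (χ : g →ₗ[ℂ] ℂ) : Submodule ℂ g where
  carrier := {x | ∀ y, χ (LieSuperalgebra.bracket x y) = 0}
  add_mem' := by
    intro a b ha hb y
    simp [ha y, hb y]
  zero_mem' := by
    intro y
    simp
  smul_mem' := by
    intro c a ha y
    simp [ha y]

/-- A subspace of `g` is a super subspace: it is the sum of its even and its odd part. -/
def IsSuperSubspace (N : Submodule ℂ g) : Prop :=
  N = (N ⊓ LieSuperalgebra.part 0) ⊔ (N ⊓ LieSuperalgebra.part 1)

/-- A good `ℤ`-grading `g = ⨁ⱼ g_j` of the Lie superalgebra `g` for `χ`. -/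
structure IsGoodGrading (χ : g →ₗ[ℂ] ℂ) (gr : ℤ → Submodule ℂ g) : Prop where
  isInternal : DirectSum.IsInternal gr
  isSuper : ∀ j, IsSuperSubspace (gr j)
  bracket_mem : ∀ i j x y, x ∈ gr i → y ∈ gr j → LieSuperalgebra.bracket x y ∈ gr (i + j)
  apply_eq_zero : ∀ j, j ≠ -2 → ∀ x ∈ gr j, χ x = 0
  annihilator_le : annihilator χ ≤ ⨆ j : ℤ, ⨆ _ : 0 ≤ j, gr j

/-- `l` is a super subspace of `g_{-1}` that is isotropic for the form `χ([·, ·])`. -/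
structure IsIsotropic (χ : g →ₗ[ℂ] ℂ) (gr : ℤ → Submodule ℂ g) (l : Submodule ℂ g) : Prop where
  le : l ≤ gr (-1)
  isSuper : IsSuperSubspace l
  apply_eq_zero : ∀ x ∈ l, ∀ y ∈ l, χ (LieSuperalgebra.bracket x y) = 0

/-- `l` is a maximal isotropic subspace of `g_{-1}` for the form `χ([·, ·])`. -/
def IsMaxIsotropic (χ : g →ₗ[ℂ] ℂ) (gr : ℤ → Submodule ℂ g) (l : Submodule ℂ g) : Prop :=
  IsIsotropic χ gr l ∧ ∀ l', IsIsotropic χ gr l' → l ≤ l' → l' = l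

/-- The subalgebra `m = (⨁_{j ≤ -2} g_j) ⊕ l`. -/
def mSub (gr : ℤ → Submodule ℂ g) (l : Submodule ℂ g) : Submodule ℂ g :=
  (⨆ j : ℤ, ⨆ _ : j ≤ -2, gr j) ⊔ l

variable (χ : g →ₗ[ℂ] ℂ) (gr : ℤ → Submodule ℂ g) (l : Submodule ℂ g)

/-- The left ideal `I_χ` of `U(g)` generated by `a - χ(a)`, `a ∈ m`. -/
def whittakerIdeal : Submodule (Env g) (Env g) :=
  Submodule.span (Env g)
    {u | ∃ a ∈ mSub gr l, u = Env.ι g a - algebraMap ℂ (Env g) (χ a)}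

/-- The generalized Whittaker module `Q_χ = U(g) / I_χ`. -/
abbrev WhittakerModule : Type := Env g ⧸ whittakerIdeal χ gr l

/-- The projection `π : U(g) → U(g) / I_χ`, as a complex linear map. -/
def whittakerProj : Env g →ₗ[ℂ] WhittakerModule χ gr l :=
  (whittakerIdeal χ gr l).mkQ.restrictScalars ℂ

/-- The finite W-algebra `W_χ = End_{U(g)}(Q_χ)^{op}`. -/
abbrev FiniteW : Type := (Module.End (Env g) (WhittakerModule χ gr l))ᵐᵒᵖ

/-- The embedding `W_χ → Q_χ = U(g) / I_χ` given by evaluation at the cyclic vector `π(1)`. It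
identifies `W_χ` with the set of all `π(y)` with `(a - χ(a)) y ∈ I_χ` for all `a ∈ m`. -/
def FiniteW.eval : FiniteW χ gr l →ₗ[ℂ] WhittakerModule χ gr l where
  toFun w := w.unop (whittakerProj χ gr l 1)
  map_add' _ _ := rfl
  map_smul' _ _ := rfl

/-- The elements of `W_χ` of parity `p`. -/
def FiniteW.parity (p : ZMod 2) : Submodule ℂ (FiniteW χ gr l) :=
  ((Env.parity g p).map (whittakerProj χ gr l)).comap (FiniteW.eval χ gr l)

/-- The `k`-th term of the Kazhdan filtration of `U(g)`: the image of the part of degree `≤ k` of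
the tensor algebra, where elements of `g_j` have degree `j + 2`. -/
def kazhdanEnv (k : ℤ) : Submodule ℂ (Env g) :=
  ⨆ d : ℤ, ⨆ _ : d ≤ k, monomialSpan (Env.ι g) (fun d => gr (d - 2)) d

theorem one_mem_kazhdanEnv : (1 : Env g) ∈ kazhdanEnv gr 0 :=
  Submodule.mem_iSup_of_mem 0 (Submodule.mem_iSup_of_mem le_rfl (one_mem_monomialSpan _ _))

theorem kazhdanEnv_mono (i j : ℤ) (hij : i ≤ j) : kazhdanEnv gr i ≤ kazhdanEnv gr j :=
  iSup_le fun d => iSup_le fun hd =>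
    le_iSup_of_le d (le_iSup_of_le (hd.trans hij) le_rfl)

theorem mul_mem_kazhdanEnv (i j : ℤ) (a b : Env g) (ha : a ∈ kazhdanEnv gr i)
    (hb : b ∈ kazhdanEnv gr j) : a * b ∈ kazhdanEnv gr (i + j) := by
  have h : kazhdanEnv gr i * kazhdanEnv gr j ≤ kazhdanEnv gr (i + j) := by
    unfold kazhdanEnv
    simp only [Submodule.iSup_mul, Submodule.mul_iSup]
    refine iSup_le fun e => iSup_le fun he => iSup_le fun d => iSup_le fun hd => ?_
    refine le_iSup_of_le (d + e) (le_iSup_of_le (add_le_add hd he) ?_)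
    exact Submodule.mul_le.2 fun x hx y hy => mul_mem_monomialSpan _ _ _ _ _ _ hx hy
  exact h (Submodule.mul_mem_mul ha hb)

/-- The Kazhdan filtration of `W_χ`, induced from the image in `U(g) / I_χ` of the Kazhdan
filtration of `U(g)`. -/
def kazhdan : AlgFiltration (FiniteW χ gr l) where
  F k := ((kazhdanEnv gr k).map (whittakerProj χ gr l)).comap (FiniteW.eval χ gr l)
  mono i j hij := Submodule.comap_mono (Submodule.map_mono (kazhdanEnv_mono gr i j hij))
  one_mem := ⟨1, one_mem_kazhdanEnv gr, rfl⟩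
  mul_mem := by
    rintro i j a b ⟨y, hy, hya⟩ ⟨z, hz, hzb⟩
    refine ⟨y * z, mul_mem_kazhdanEnv gr i j y z hy hz, ?_⟩
    change _ = b.unop (FiniteW.eval χ gr l a)
    rw [← hya]
    have h1 : whittakerProj χ gr l y = y • whittakerProj χ gr l 1 := by
      change (whittakerIdeal χ gr l).mkQ y = y • (whittakerIdeal χ gr l).mkQ 1
      rw [← map_smul, smul_eq_mul, mul_one]
    rw [h1, map_smul]
    change _ = y • FiniteW.eval χ gr l b
    rw [← hzb]
    change (whittakerIdeal χ gr l).mkQ (y * z) = y • (whittakerIdeal χ gr l).mkQ z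
    rw [← map_smul, smul_eq_mul]

/-- The associated graded algebra `Gr_K W_χ`. -/
abbrev GrW : Type := (kazhdan χ gr l).Gr

/-- The part of `Gr_K W_χ` of parity `p` and Kazhdan degree `k`: the classes in `F_k / F_{k-1}` of
the elements of `F_k` of parity `p`. -/
def GrW.bidegree (p : ZMod 2) (k : ℤ) : Submodule ℂ (GrW χ gr l) :=
  ((FiniteW.parity χ gr l p).submoduleOf ((kazhdan χ gr l).F k)).map
    (DirectSum.lof ℂ ℤ (kazhdan χ gr l).Piece k ∘ₗ (kazhdan χ gr l).symbol k)

/-- The even and the odd part of `g^χ`. -/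
def annihilatorPart (p : ZMod 2) : Submodule ℂ (annihilator χ) :=
  (LieSuperalgebra.part p).submoduleOf (annihilator χ)

/-- The symmetric algebra `S(g^χ)` of the super vector space `g^χ`. -/
abbrev SymAnn : Type := SuperSym (annihilatorPart χ)

/-- The part of `S(g^χ)` of parity `p` and Kazhdan degree `k`, where the elements of `g^χ ∩ g_j`
have degree `j + 2`. -/
def SymAnn.bidegree (p : ZMod 2) (k : ℤ) : Submodule ℂ (SymAnn χ) :=
  monomialSpan (SuperSym.ι (annihilatorPart χ))
    (fun q : ZMod 2 × ℤ => annihilatorPart χ q.1 ⊓ (gr (q.2 - 2)).submoduleOf (annihilator χ))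
    (p, k)

end W

/-! ### The queer Lie superalgebra -/

/-- The underlying space of `Q(n)`; the pair `(A, B)` stands for the block matrix with diagonal
blocks `A, A` and off-diagonal blocks `B, B`. -/
abbrev Queer (n : ℕ) : Type := Matrix (Fin n) (Fin n) ℂ × Matrix (Fin n) (Fin n) ℂ

/-- `(A, B)` as a block matrix. -/
def Queer.toBlock {n : ℕ} (x : Queer n) : Matrix (Fin n ⊕ Fin n) (Fin n ⊕ Fin n) ℂ :=
  Matrix.fromBlocks x.1 x.2 x.2 x.1

/-- The supercommutator of block matrices, `[x, y] = x y - (-1)^{|x||y|} y x`. -/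
def Queer.bracket (n : ℕ) : Queer n →ₗ[ℂ] Queer n →ₗ[ℂ] Queer n :=
  LinearMap.mk₂ ℂ
    (fun x y => (x.1 * y.1 - y.1 * x.1 + (x.2 * y.2 + y.2 * x.2),
      x.1 * y.2 - y.2 * x.1 + (x.2 * y.1 - y.1 * x.2)))
    (by intros; ext : 1 <;> simp <;> noncomm_ring)
    (by intros; ext : 1 <;> simp [smul_sub, smul_add])
    (by intros; ext : 1 <;> simp <;> noncomm_ring)
    (by intros; ext : 1 <;> simp [smul_sub, smul_add])

/-- The even part consists of the pairs `(A, 0)` and the odd part of the pairs `(0, B)`. -/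
def Queer.part (n : ℕ) (p : ZMod 2) : Submodule ℂ (Queer n) :=
  if p = 0 then LinearMap.ker (LinearMap.snd ℂ _ _) else LinearMap.ker (LinearMap.fst ℂ _ _)

theorem Queer.mem_part_zero {n : ℕ} (x : Queer n) : x ∈ Queer.part n 0 ↔ x.2 = 0 := by
  simp [Queer.part]

theorem Queer.mem_part_one {n : ℕ} (x : Queer n) : x ∈ Queer.part n 1 ↔ x.1 = 0 := by
  simp [Queer.part]

theorem parity_cases (i : ZMod 2) : i = 0 ∨ i = 1 := by
  fin_cases i
  · exact Or.inl rfl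
  · exact Or.inr rfl

/-- On homogeneous elements the bracket of `Q(n)` is the supercommutator of block matrices. -/
theorem Queer.toBlock_bracket {n : ℕ} (i j : ZMod 2) (x y : Queer n) (hx : x ∈ Queer.part n i)
    (hy : y ∈ Queer.part n j) :
    (Queer.bracket n x y).toBlock =
      x.toBlock * y.toBlock - superSign i j • (y.toBlock * x.toBlock) := by
  obtain ⟨a, b⟩ := x
  obtain ⟨c, d⟩ := y
  rcases parity_cases i with rfl | rfl <;> rcases parity_cases j with rfl | rfl <;>
    simp only [Queer.mem_part_zero, Queer.mem_part_one] at hx hy <;> subst hx <;> subst hy <;>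
    simp [superSign, Queer.bracket, Queer.toBlock, Matrix.fromBlocks_multiply,
      Matrix.fromBlocks_add, Matrix.fromBlocks_neg, sub_eq_add_neg]

instance (n : ℕ) : LieSuperalgebra (Queer n) where
  part := Queer.part n
  isCompl := by
    rw [isCompl_iff, disjoint_iff, codisjoint_iff]
    constructor
    · ext x
      simp [Queer.mem_part_zero, Queer.mem_part_one, Prod.ext_iff, and_comm]
    · rw [eq_top_iff]
      rintro ⟨a, b⟩ -
      rw [Submodule.mem_sup]
      exact ⟨(a, 0), by simp [Queer.mem_part_zero], (0, b), by simp [Queer.mem_part_one], by simp⟩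
  bracket := Queer.bracket n
  bracket_mem := by
    rintro i j ⟨a, b⟩ ⟨c, d⟩ hx hy
    rcases parity_cases i with rfl | rfl <;> rcases parity_cases j with rfl | rfl <;>
      simp only [Queer.mem_part_zero, Queer.mem_part_one] at hx hy <;> subst hx <;> subst hy <;>
      simp [Queer.mem_part_zero, Queer.mem_part_one, Queer.bracket, CharTwo.add_self_eq_zero]
  skew := by
    rintro i j ⟨a, b⟩ ⟨c, d⟩ hx hy
    rcases parity_cases i with rfl | rfl <;> rcases parity_cases j with rfl | rfl <;>
      simp only [Queer.mem_part_zero, Queer.mem_part_one] at hx hy <;> subst hx <;> subst hy <;>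
      simp [superSign, Queer.bracket, add_comm]
  jacobi := by
    rintro i j ⟨a, b⟩ ⟨c, d⟩ ⟨e, f⟩ hx hy
    rcases parity_cases i with rfl | rfl <;> rcases parity_cases j with rfl | rfl <;>
      simp only [Queer.mem_part_zero, Queer.mem_part_one] at hx hy <;> subst hx <;> subst hy <;>
      simp [superSign, Queer.bracket] <;> constructor <;> noncomm_ring

/-- `χ` is nilpotent in the coadjoint representation of `Q(n)`: the closure of its orbit under the
group `GL_n` of the even part `gl_n` contains zero. The group acts on `Q(n)` by simultaneous
conjugation of the blocks; the topology is that of pointwise convergence. -/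
def Queer.IsNilpotentFunctional {n : ℕ} (χ : Queer n →ₗ[ℂ] ℂ) : Prop :=
  (0 : Queer n → ℂ) ∈ closure (Set.range fun u : GL (Fin n) ℂ => fun x : Queer n =>
    χ ((u⁻¹).val * x.1 * u.val, (u⁻¹).val * x.2 * u.val))

/-- `χ` is an even regular nilpotent functional on `Q(n)`: the even part of `g^χ` has the smallest
dimension among all even nilpotent functionals. -/
def Queer.IsRegularNilpotent {n : ℕ} (χ : Queer n →ₗ[ℂ] ℂ) : Prop :=
  IsEvenFunctional χ ∧ Queer.IsNilpotentFunctional χ ∧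
    ∀ ψ : Queer n →ₗ[ℂ] ℂ, IsEvenFunctional ψ → Queer.IsNilpotentFunctional ψ →
      Module.finrank ℂ ↥(annihilator χ ⊓ LieSuperalgebra.part 0) ≤
        Module.finrank ℂ ↥(annihilator ψ ⊓ LieSuperalgebra.part 0)

end

/-! ### Signs -/

/-! Let n ≥ 2. An even functional is χ = tr(M ·), and 0 lies in the closure of its orbit only if the
characteristic polynomial of M is X^n. Comparing the centraliser of M with that of a Jordan block
shows that regularity forces M ^ (n - 1) ≠ 0. A good grading is given by a derivation of Q(n); this
derivation comes from one of the matrix algebra, hence is ad h for a matrix h, and χ(g_j) = 0 for j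
≠ -2 gives [h, M] = 2M. A cyclic vector of M that is also an eigenvector of h produces matrix units
e_ij, f_ij of degree 2(j - i) with χ dual to the subdiagonal (`Queer.exists_isPrincipalBasis`). So
the grading is even, g_{-1} = 0, l = 0, and m is strictly lower triangular.

Upper bound for Gr W. The bracket is the supercommutator of a graded associative product, so the
Poincaré-Birkhoff-Witt theorem comes from an explicit action of U(g) on S(g) by affine vector fields
(`IsAssocGraded.mem_wordFil_iff`). Relations between the symbols x - χ(x), x ∈ m, are Koszul
relations, and correcting them in U(g) only costs brackets of elements of m, which lie in m and are
killed by χ. Hence I_χ has no unexpected leading terms (`IsWhittakerDatum.mem_idealFil`), and Gr Q_χ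
is S(p) with p = ⨁_{j ≥ 0} g_j (`exists_sub_mem_ideal_iff`). The symbol of an element of W is an
m-invariant of S(p). Since p is the sum of g^χ and a complement dual to m, an invariant is
determined by its image in S(g^χ): the projection together with the constant part of the action of m
is already injective, and the rest of the action only produces longer words
(`IsSlice.eq_zero_of_rho`).

Lower bound. Sergeev's elements are entries of signed powers of the generic matrix of Q(n). The
lower left corner entries of the powers n + k, 0 ≤ k < n, supercommute with m, so they define
elements of W. Restricted to S(g^χ), the generic matrix has ones below the diagonal and a basis of
g^χ in its first row, whence the linear part of the k-th corner entry is the k-th basis vector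
(`sergeev_dualNumber`). A family of symbols with these linear parts is a unitriangular change of
generators of S(g^χ), so sending basis vectors to the classes of the Sergeev elements is an
isomorphism onto Gr W (`AlgFiltration.exists_algEquiv`).

For n ≤ 1 the functional is zero, m = 0, W is U(g) up to the identification with Q_χ, and the
statement reduces to Poincaré-Birkhoff-Witt.

Monomial bases are avoided throughout. Elements of U(g) and S(g) are matched by working in the
product algebra with letters (X_i, x_i), and independence of weight spaces comes from eigenspaces of
Euler derivations. -/

theorem superSign_comm (i j : ZMod 2) : superSign i j = superSign j i := by
  simp [superSign, and_comm]

@[simp] theorem superSign_zero_left (j : ZMod 2) : superSign 0 j = 1 := by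
  simp [superSign]

@[simp] theorem superSign_zero_right (j : ZMod 2) : superSign j 0 = 1 := by
  simp [superSign]

@[simp] theorem superSign_one_one : superSign 1 1 = -1 := by
  simp [superSign]

@[simp] theorem superSign_mul_self (i j : ZMod 2) : superSign i j * superSign i j = 1 := by
  rcases parity_cases i with rfl | rfl <;> rcases parity_cases j with rfl | rfl <;> simp

theorem superSign_add_left (i j k : ZMod 2) :
    superSign (i + j) k = superSign i k * superSign j k := by
  rcases parity_cases i with rfl | rfl <;> rcases parity_cases j with rfl | rfl <;>
    rcases parity_cases k with rfl | rfl <;> simp [CharTwo.add_self_eq_zero]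

theorem superSign_add_right (i j k : ZMod 2) :
    superSign i (j + k) = superSign i j * superSign i k := by
  rw [superSign_comm, superSign_add_left, superSign_comm j, superSign_comm k]

/-! ### Spans of words -/

section Words

variable {ι M A B : Type} [Ring A] [Algebra ℂ A] [Ring B] [Algebra ℂ B]

/-- The span of the words in the letters `f i` of total weight `m`. -/
def wordSpan [AddMonoid M] (f : ι → A) (w : ι → M) (m : M) : Submodule ℂ A :=
  Submodule.span ℂ {a | ∃ l : List ι, (l.map w).sum = m ∧ (l.map f).prod = a}

section

variable [AddMonoid M] {f : ι → A} {w : ι → M}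

theorem word_mem (l : List ι) : (l.map f).prod ∈ wordSpan f w (l.map w).sum :=
  Submodule.subset_span ⟨l, rfl, rfl⟩

theorem wordSpan_le {m : M} {N : Submodule ℂ A}
    (h : ∀ l : List ι, (l.map w).sum = m → (l.map f).prod ∈ N) : wordSpan f w m ≤ N := by
  refine Submodule.span_le.2 ?_
  rintro _ ⟨l, hl, rfl⟩
  exact h l hl

theorem one_mem_wordSpan : (1 : A) ∈ wordSpan f w 0 :=
  Submodule.subset_span ⟨[], by simp, by simp⟩

theorem letter_mem_wordSpan (i : ι) : f i ∈ wordSpan f w (w i) :=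
  Submodule.subset_span ⟨[i], by simp, by simp⟩

theorem mul_mem_wordSpan {m m' : M} {a b : A} (ha : a ∈ wordSpan f w m)
    (hb : b ∈ wordSpan f w m') : a * b ∈ wordSpan f w (m + m') := by
  have h : wordSpan f w m * wordSpan f w m' ≤ wordSpan f w (m + m') := by
    unfold wordSpan
    rw [Submodule.span_mul_span]
    apply Submodule.span_mono
    rintro _ ⟨a, ⟨l, h1, rfl⟩, b, ⟨l', h1', rfl⟩, rfl⟩
    exact ⟨l ++ l', by simp [h1, h1'], by simp⟩
  exact h (Submodule.mul_mem_mul ha hb)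

theorem map_wordSpan (g : A →ₐ[ℂ] B) (f : ι → A) (w : ι → M) (m : M) :
    (wordSpan f w m).map g.toLinearMap = wordSpan (g ∘ f) w m := by
  unfold wordSpan
  rw [Submodule.map_span]
  congr 1
  ext x
  constructor
  · rintro ⟨_, ⟨l, hl, rfl⟩, rfl⟩
    exact ⟨l, hl, by simp [map_list_prod]⟩
  · rintro ⟨l, hl, rfl⟩
    exact ⟨_, ⟨l, hl, rfl⟩, by simp [map_list_prod]⟩

theorem map_mem_wordSpan (g : A →ₐ[ℂ] B) {f' : ι → B} (hg : ∀ i, g (f i) = f' i) {m : M} {a : A}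
    (ha : a ∈ wordSpan f w m) : g a ∈ wordSpan f' w m := by
  obtain rfl : g ∘ f = f' := funext hg
  rw [← map_wordSpan]
  exact Submodule.mem_map_of_mem ha

/-- Words lift letter by letter. For a projection of `A × B` with letters `(f i, f' i)` this
attaches to an element of one factor a partner in the other, given by the same combination of words;
such pairs replace a choice of ordered monomials. -/
theorem exists_map_mem_wordSpan (g : A →ₐ[ℂ] B) {f' : ι → B} (hg : ∀ i, g (f i) = f' i) {m : M}
    {a : B} (ha : a ∈ wordSpan f' w m) : ∃ a' ∈ wordSpan f w m, g a' = a := by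
  obtain rfl : g ∘ f = f' := funext hg
  rw [← map_wordSpan] at ha
  exact ha

/-- Weights add under products, so homogeneity of an algebra map is a condition on letters only. -/
theorem map_mem_wordSpan_of_letters (g : A →ₐ[ℂ] B) {f' : ι → A} {κ : Type} {h : κ → B}
    {v : κ → M} (hg : ∀ i, g (f' i) ∈ wordSpan h v (w i)) {m : M} {a : A}
    (ha : a ∈ wordSpan f' w m) : g a ∈ wordSpan h v m := by
  have : wordSpan f' w m ≤ (wordSpan h v m).comap g.toLinearMap := by
    clear ha
    refine wordSpan_le ?_
    rintro l rfl
    induction l with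
    | nil => simpa using one_mem_wordSpan
    | cons i l ih =>
      simp only [Submodule.mem_comap, AlgHom.toLinearMap_apply, List.map_cons, List.prod_cons,
        List.sum_cons, map_mul] at ih ⊢
      exact mul_mem_wordSpan (hg i) ih
  exact this ha

theorem iSup_wordSpan (hf : Algebra.adjoin ℂ (Set.range f) = ⊤) :
    ⨆ m, wordSpan f w m = ⊤ := by
  rw [eq_top_iff]
  rintro x -
  have hx : x ∈ Algebra.adjoin ℂ (Set.range f) := by rw [hf]; trivial
  rw [← Subalgebra.mem_toSubmodule, Algebra.adjoin_eq_span] at hx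
  refine Submodule.span_le.2 ?_ hx
  intro y hy
  obtain ⟨l, rfl⟩ : ∃ l : List ι, (l.map f).prod = y := by
    refine Submonoid.closure_induction ?_ ⟨[], by simp⟩ ?_ hy
    · rintro _ ⟨i, rfl⟩
      exact ⟨[i], by simp⟩
    · rintro _ _ _ _ ⟨l, rfl⟩ ⟨l', rfl⟩
      exact ⟨l ++ l', by simp⟩
  exact Submodule.mem_iSup_of_mem _ (word_mem l)

end

/-- Spans of words only depend on the linear spans of the letters of each weight. -/
theorem monomialSpan_eq_wordSpan [AddMonoid M] {V : Type} [AddCommGroup V] [Module ℂ V]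
    (j : V →ₗ[ℂ] A) (v : ι → V) (w : ι → M) (P : M → Submodule ℂ V)
    (hP : ∀ m, P m = Submodule.span ℂ (v '' {i | w i = m})) (m : M) :
    monomialSpan j P m = wordSpan (fun i => j (v i)) w m := by
  apply le_antisymm
  · refine Submodule.span_le.2 ?_
    rintro _ ⟨l, hl, rfl, rfl⟩
    induction l with
    | nil => simpa using one_mem_wordSpan
    | cons q l ih =>
      simp only [List.map_cons, List.prod_cons, List.sum_cons]
      refine mul_mem_wordSpan ?_ (ih fun q hq => hl q (List.mem_cons_of_mem _ hq))
      have h := hl q List.mem_cons_self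
      rw [hP] at h
      have : Submodule.span ℂ (v '' {i | w i = q.1}) ≤
          (wordSpan (fun i => j (v i)) w q.1).comap j := by
        refine Submodule.span_le.2 ?_
        rintro _ ⟨i, hi, rfl⟩
        have := letter_mem_wordSpan (f := fun i => j (v i)) (w := w) i
        rw [hi] at this
        exact this
      exact this h
  · refine wordSpan_le fun l hl => ?_
    refine Submodule.subset_span ⟨l.map fun i => (w i, v i), ?_, ?_, ?_⟩
    · intro q hq
      obtain ⟨i, -, rfl⟩ := List.mem_map.1 hq
      simp only [hP]
      exact Submodule.subset_span ⟨i, rfl, rfl⟩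
    · simpa [Function.comp_def] using hl
    · simp [Function.comp_def]

/-- The increasing filtration by spans of words of bounded weight. -/
def wordFil (f : ι → A) (w : ι → ℤ) (k : ℤ) : Submodule ℂ A :=
  ⨆ d : ℤ, ⨆ _ : d ≤ k, wordSpan f w d

section

variable {f : ι → A} {w : ι → ℤ}

theorem wordSpan_le_wordFil {d k : ℤ} (h : d ≤ k) : wordSpan f w d ≤ wordFil f w k :=
  le_iSup_of_le d (le_iSup_of_le h le_rfl)

theorem wordFil_le {k : ℤ} {N : Submodule ℂ A} (h : ∀ d ≤ k, wordSpan f w d ≤ N) :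
    wordFil f w k ≤ N :=
  iSup_le fun d => iSup_le fun hd => h d hd

theorem wordFil_mono {j k : ℤ} (h : j ≤ k) : wordFil f w j ≤ wordFil f w k :=
  wordFil_le fun _ hd => wordSpan_le_wordFil (hd.trans h)

theorem mul_mem_wordFil {j k : ℤ} {a b : A} (ha : a ∈ wordFil f w j) (hb : b ∈ wordFil f w k) :
    a * b ∈ wordFil f w (j + k) := by
  have h1 : ∀ d ≤ j, ∀ a ∈ wordSpan f w d, ∀ b ∈ wordFil f w k, a * b ∈ wordFil f w (j + k) := by
    intro d hd a ha
    have : wordFil f w k ≤ (wordFil f w (j + k)).comap (LinearMap.mulLeft ℂ a) :=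
      wordFil_le fun e he b hb => wordSpan_le_wordFil (add_le_add hd he) (mul_mem_wordSpan ha hb)
    exact fun b hb => this hb
  have : wordFil f w j ≤ (wordFil f w (j + k)).comap (LinearMap.mulRight ℂ b) :=
    wordFil_le fun d hd a ha => h1 d hd a ha b hb
  exact this ha

theorem mem_wordFil_succ {k : ℤ} {a : A} (ha : a ∈ wordFil f w k) :
    ∃ b ∈ wordSpan f w k, a - b ∈ wordFil f w (k - 1) := by
  have : wordFil f w k ≤ wordSpan f w k ⊔ wordFil f w (k - 1) := by
    refine wordFil_le fun d hd => ?_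
    rcases hd.eq_or_lt with rfl | hd
    · exact le_sup_left
    · exact (wordSpan_le_wordFil (by omega)).trans le_sup_right
  obtain ⟨b, hb, c, hc, rfl⟩ := Submodule.mem_sup.1 (this ha)
  exact ⟨b, hb, by simpa using hc⟩

theorem exists_mem_wordFil (hf : Algebra.adjoin ℂ (Set.range f) = ⊤) (a : A) :
    ∃ k, a ∈ wordFil f w k := by
  have ha : a ∈ ⨆ m, wordSpan f w m := by rw [iSup_wordSpan hf]; trivial
  refine Submodule.iSup_induction _ (motive := fun a => ∃ k, a ∈ wordFil f w k) ha ?_ ?_ ?_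
  · exact fun k a ha => ⟨k, wordSpan_le_wordFil le_rfl ha⟩
  · exact ⟨0, zero_mem _⟩
  · rintro a b ⟨j, ha⟩ ⟨k, hb⟩
    exact ⟨max j k, add_mem (wordFil_mono (le_max_left _ _) ha) (wordFil_mono (le_max_right _ _) hb)⟩

end

end Words

/-! ### Homogeneous bases -/

/-- The basis `b` consists of homogeneous vectors for the family of subspaces `P`, with degrees
given by `w`. -/
def IsHomogeneousBasis {M V ι : Type} [AddCommGroup V] [Module ℂ V] (P : M → Submodule ℂ V)
    (b : Module.Basis ι ℂ V) (w : ι → M) : Prop :=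
  ∀ m, P m = Submodule.span ℂ (b '' {i | w i = m})

namespace IsHomogeneousBasis

variable {M V ι : Type} [AddCommGroup V] [Module ℂ V] {P : M → Submodule ℂ V}
  {b : Module.Basis ι ℂ V} {w : ι → M}

theorem mem (hb : IsHomogeneousBasis P b w) (i : ι) : b i ∈ P (w i) := by
  rw [hb]
  exact Submodule.subset_span ⟨i, rfl, rfl⟩

theorem induction (hb : IsHomogeneousBasis P b w) {m : M} {N : Submodule ℂ V}
    (h : ∀ i, w i = m → b i ∈ N) : P m ≤ N := by
  rw [hb, Submodule.span_le]
  rintro _ ⟨i, hi, rfl⟩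
  exact h i hi

/-- Families of independent subspaces containing the vectors of a basis. -/
theorem of_mem (hP : iSupIndep P) (h : ∀ i, b i ∈ P (w i)) : IsHomogeneousBasis P b w := by
  intro m
  have hle : ∀ m, Submodule.span ℂ (b '' {i | w i = m}) ≤ P m := by
    intro m
    rw [Submodule.span_le]
    rintro _ ⟨i, rfl, rfl⟩
    exact h i
  refine le_antisymm (fun x hx => ?_) (hle m)
  have htop : x ∈ Submodule.span ℂ (b '' {i | w i = m}) ⊔ ⨆ k, ⨆ _ : k ≠ m, P k := by
    have : (⊤ : Submodule ℂ V) ≤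
        Submodule.span ℂ (b '' {i | w i = m}) ⊔ ⨆ k, ⨆ _ : k ≠ m, P k := by
      rw [← b.span_eq, Submodule.span_le]
      rintro _ ⟨i, rfl⟩
      by_cases hi : w i = m
      · exact Submodule.mem_sup_left (Submodule.subset_span ⟨i, hi, rfl⟩)
      · exact Submodule.mem_sup_right
          (Submodule.mem_iSup_of_mem _ (Submodule.mem_iSup_of_mem hi (h i)))
    exact this trivial
  obtain ⟨y, hy, z, hz, rfl⟩ := Submodule.mem_sup.1 htop
  have hz' : z ∈ P m := by simpa using sub_mem hx (hle m hy)
  have := Submodule.disjoint_def.1 (hP m) z hz' hz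
  simpa [this] using hy

theorem repr_eq_zero (hb : IsHomogeneousBasis P b w) {m : M} {x : V} (hx : x ∈ P m) {i : ι}
    (hi : w i ≠ m) : b.repr x i = 0 := by
  have : P m ≤ LinearMap.ker (b.coord i) := by
    refine hb.induction fun j hj => ?_
    have : j ≠ i := by rintro rfl; exact hi hj
    simp [this]
  exact this hx

/-- Coordinates of a vector vanish outside its degree for each grading separately, so one basis
homogeneous for both gradings is homogeneous for the bigrading. -/
theorem inf {M' : Type} {P' : M' → Submodule ℂ V} {w' : ι → M'} (hb : IsHomogeneousBasis P b w)
    (hb' : IsHomogeneousBasis P' b w') :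
    IsHomogeneousBasis (fun q : M × M' => P q.1 ⊓ P' q.2) b (fun i => (w i, w' i)) := by
  rintro ⟨m, m'⟩
  apply le_antisymm
  · rintro x ⟨hx, hx'⟩
    rw [← b.linearCombination_repr x, Finsupp.linearCombination_apply]
    refine Submodule.sum_mem _ fun i hi => Submodule.smul_mem _ _ (Submodule.subset_span ⟨i, ?_, rfl⟩)
    have h0 : b.repr x i ≠ 0 := by simpa using hi
    refine Prod.ext ?_ ?_
    · by_contra h
      exact h0 (hb.repr_eq_zero hx h)
    · by_contra h
      exact h0 (hb'.repr_eq_zero hx' h)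
  · rw [Submodule.span_le]
    rintro _ ⟨i, hi, rfl⟩
    simp only [Set.mem_ofPred_eq, Prod.mk.injEq] at hi
    exact ⟨hi.1 ▸ hb.mem i, hi.2 ▸ hb'.mem i⟩

end IsHomogeneousBasis


/-! ### Universal properties -/

/-- Bilinear identities on homogeneous vectors may be checked on a homogeneous basis. -/
theorem IsHomogeneousBasis.bilinear_ext {V W ι : Type} [AddCommGroup V] [Module ℂ V]
    [AddCommMonoid W] [Module ℂ W] {P : ZMod 2 → Submodule ℂ V} {b : Module.Basis ι ℂ V}
    {par : ι → ZMod 2} (hb : IsHomogeneousBasis P b par) (F G : ZMod 2 → ZMod 2 → V →ₗ[ℂ] V →ₗ[ℂ] W)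
    (h : ∀ i j, F (par i) (par j) (b i) (b j) = G (par i) (par j) (b i) (b j))
    (i j : ZMod 2) (x y : V) (hx : x ∈ P i) (hy : y ∈ P j) : F i j x y = G i j x y := by
  have h1 : P i ≤ LinearMap.eqLocus ((F i j).flip y) ((G i j).flip y) := by
    refine hb.induction fun k hk => ?_
    have h2 : P j ≤ LinearMap.eqLocus ((F i j) (b k)) ((G i j) (b k)) := by
      refine hb.induction fun k' hk' => ?_
      subst hk hk'
      exact h k k'
    exact h2 hy
  exact h1 hx

namespace SuperSym

variable {V I : Type} [AddCommGroup V] [Module ℂ V] {P : ZMod 2 → Submodule ℂ V}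
  {A : Type} [Semiring A] [Algebra ℂ A]

theorem ι_mul_ι {i j : ZMod 2} {x y : V} (hx : x ∈ P i) (hy : y ∈ P j) :
    ι P x * ι P y = superSign i j • (ι P y * ι P x) := by
  have := RingQuot.mkAlgHom_rel ℂ (SymRel.mk i j x y hx hy)
  rw [map_smul, map_mul, map_mul] at this
  exact this

/-- The universal property of the symmetric superalgebra. -/
noncomputable def lift (f : V →ₗ[ℂ] A) (hf : ∀ i j x y, x ∈ P i → y ∈ P j →
    f x * f y = superSign i j • (f y * f x)) : SuperSym P →ₐ[ℂ] A :=
  RingQuot.liftAlgHom ℂ (s := SymRel P) ⟨TensorAlgebra.lift ℂ f, by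
    rintro _ _ ⟨i, j, x, y, hx, hy⟩
    simpa using hf i j x y hx hy⟩

theorem lift_ι (f : V →ₗ[ℂ] A) (hf) (x : V) : lift (P := P) f hf (ι P x) = f x := by
  refine (RingQuot.liftAlgHom_mkAlgHom_apply ℂ _ _ _).trans ?_
  simp

theorem adjoin_ι : Algebra.adjoin ℂ (Set.range (ι P)) = ⊤ := by
  have h : (Algebra.adjoin ℂ (Set.range (TensorAlgebra.ι ℂ (M := V)))).map
      (RingQuot.mkAlgHom ℂ (SymRel P)) = ⊤ := by
    rw [TensorAlgebra.adjoin_range_ι, Algebra.map_top, AlgHom.range_eq_top]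
    exact RingQuot.mkAlgHom_surjective ℂ _
  rw [AlgHom.map_adjoin, ← Set.range_comp] at h
  exact h

variable (b : Module.Basis I ℂ V) {par : I → ZMod 2}

variable (P) in
/-- The generator of `S(V)` attached to a basis vector. -/
noncomputable def X (i : I) : SuperSym P := SuperSym.ι P (b i)

theorem adjoin_X : Algebra.adjoin ℂ (Set.range (X P b)) = ⊤ := by
  rw [eq_top_iff, ← adjoin_ι, Algebra.adjoin_le_iff]
  rintro _ ⟨x, rfl⟩
  have : (⊤ : Submodule ℂ V) ≤
      (Subalgebra.toSubmodule (Algebra.adjoin ℂ (Set.range (X P b)))).comap (SuperSym.ι P) := by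
    rw [← b.span_eq, Submodule.span_le]
    rintro _ ⟨i, rfl⟩
    exact Algebra.subset_adjoin ⟨i, rfl⟩
  exact this trivial

theorem algHom_ext {f g : SuperSym P →ₐ[ℂ] A} (h : ∀ i, f (X P b i) = g (X P b i)) : f = g := by
  refine AlgHom.ext_of_adjoin_eq_top (adjoin_X b) ?_
  rintro _ ⟨i, rfl⟩
  exact h i

/-- Induction on multiplication by generators from the right. -/
theorem induction_right {p : SuperSym P → Prop} (h1 : p 1) (hadd : ∀ y z, p y → p z → p (y + z))
    (hsmul : ∀ (c : ℂ) z, p z → p (c • z)) (hmul : ∀ i z, p z → p (z * X P b i))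
    (z : SuperSym P) : p z := by
  have hz : z ∈ ⨆ m, wordSpan (X P b) (fun _ => (0 : ℤ)) m := by
    rw [iSup_wordSpan (adjoin_X b)]; trivial
  have hp0 : p 0 := by simpa using hsmul 0 1 h1
  refine Submodule.iSup_induction _ (motive := p) hz (fun m z hz => ?_) hp0 hadd
  refine Submodule.span_induction (p := fun z _ => p z) ?_ hp0 (fun y z _ _ => hadd y z)
    (fun c z _ => hsmul c z) hz
  rintro _ ⟨l, -, rfl⟩
  induction l using List.reverseRecOn with
  | nil => simpa using h1
  | append_singleton l i ih => simpa using hmul i _ ih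

/-- Linear maps agreeing on `1` and compatible with right multiplication by generators. -/
theorem linearMap_ext_right {W : Type} [AddCommGroup W] [Module ℂ W] {f g : SuperSym P →ₗ[ℂ] W}
    (h1 : f 1 = g 1) (h : ∀ i z, f z = g z → f (z * X P b i) = g (z * X P b i)) : f = g := by
  ext z
  refine induction_right b (p := fun z => f z = g z) h1 ?_ ?_ h z
  · intro y z hy hz
    simp [hy, hz]
  · intro c z hz
    simp [hz]

variable {b}

theorem X_mul_X (hb : IsHomogeneousBasis P b par) (i j : I) :
    X P b i * X P b j = superSign (par i) (par j) • (X P b j * X P b i) :=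
  ι_mul_ι (hb.mem i) (hb.mem j)

/-- The universal property of `S(V)` in terms of a homogeneous basis. -/
noncomputable def liftBasis (hb : IsHomogeneousBasis P b par) (f : I → A)
    (hf : ∀ i j, f i * f j = superSign (par i) (par j) • (f j * f i)) : SuperSym P →ₐ[ℂ] A :=
  lift (b.constr ℂ f) (hb.bilinear_ext
    (F := fun _ _ => (LinearMap.mul ℂ A).compl₁₂ (b.constr ℂ f) (b.constr ℂ f))
    (G := fun i j => superSign i j •
      ((LinearMap.mul ℂ A).compl₁₂ (b.constr ℂ f) (b.constr ℂ f)).flip)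
    (fun i j => by simpa using hf i j))

@[simp] theorem liftBasis_X (hb : IsHomogeneousBasis P b par) (f : I → A) (hf) (i : I) :
    liftBasis hb f hf (X P b i) = f i := by
  exact (lift_ι _ _ _).trans (by simp)

/-! ### Supercommutativity -/

theorem mul_X_of_mem (hb : IsHomogeneousBasis P b par) {p : ZMod 2} {z : SuperSym P}
    (hz : z ∈ wordSpan (X P b) par p) (i : I) :
    z * X P b i = superSign p (par i) • (X P b i * z) := by
  have : wordSpan (X P b) par p ≤ LinearMap.ker (LinearMap.mulRight ℂ (X P b i) -
      superSign p (par i) • LinearMap.mulLeft ℂ (X P b i)) := by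
    clear hz
    refine wordSpan_le ?_
    rintro l rfl
    induction l with
    | nil => simp
    | cons j l ih =>
      simp only [LinearMap.mem_ker, LinearMap.sub_apply, LinearMap.mulRight_apply,
        LinearMap.smul_apply, LinearMap.mulLeft_apply, sub_eq_zero, List.map_cons, List.prod_cons,
        List.sum_cons] at ih ⊢
      rw [mul_assoc, ih, mul_smul_comm, ← mul_assoc, X_mul_X hb, smul_mul_assoc, smul_smul,
        superSign_add_left, mul_comm, mul_assoc]
  simpa [sub_eq_zero] using this hz

theorem mul_comm_of_mem (hb : IsHomogeneousBasis P b par) {p q : ZMod 2} {y z : SuperSym P}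
    (hy : y ∈ wordSpan (X P b) par p) (hz : z ∈ wordSpan (X P b) par q) :
    y * z = superSign p q • (z * y) := by
  have : wordSpan (X P b) par q ≤ LinearMap.ker (LinearMap.mulLeft ℂ y -
      superSign p q • LinearMap.mulRight ℂ y) := by
    clear hz
    refine wordSpan_le ?_
    rintro l rfl
    induction l with
    | nil => simp
    | cons j l ih =>
      simp only [LinearMap.mem_ker, LinearMap.sub_apply, LinearMap.mulRight_apply,
        LinearMap.smul_apply, LinearMap.mulLeft_apply, sub_eq_zero, List.map_cons, List.prod_cons,
        List.sum_cons] at ih ⊢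
      rw [← mul_assoc, mul_X_of_mem hb hy, smul_mul_assoc, mul_assoc, ih, mul_smul_comm, smul_smul,
        superSign_add_right, mul_assoc]
  simpa [sub_eq_zero] using this hz

/-! ### Superderivations -/

/-- A right superderivation is the upper right entry of an algebra homomorphism to upper triangular
2 × 2 matrices, with the identity and the sign automorphism on the diagonal. The universal property
of S(V) thus yields the derivation. -/
theorem exists_superDerivation (hb : IsHomogeneousBasis P b par) (q : ZMod 2)
    (f : I → SuperSym P) (hf : ∀ i, f i ∈ wordSpan (X P b) par (q + par i)) :
    ∃ D : SuperSym P →ₗ[ℂ] SuperSym P, D 1 = 0 ∧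
      ∀ z i, D (z * X P b i) = z * f i + superSign q (par i) • (D z * X P b i) := by
  -- The supercommutation relations hold for the matrices because `f i` has parity `q + par i`; only
  -- the upper right entry needs a computation.
  have hrel : ∀ i j, (!![X P b i, f i; 0, superSign q (par i) • X P b i] :
      Matrix (Fin 2) (Fin 2) (SuperSym P)) * !![X P b j, f j; 0, superSign q (par j) • X P b j] =
      superSign (par i) (par j) • (!![X P b j, f j; 0, superSign q (par j) • X P b j] *
        !![X P b i, f i; 0, superSign q (par i) • X P b i]) := by
    intro i j
    have h1 := mul_X_of_mem hb (hf i) j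
    have h2 := mul_X_of_mem hb (hf j) i
    have h3 := X_mul_X hb i j
    rw [superSign_add_left] at h1 h2
    ext a c
    fin_cases a <;> fin_cases c <;>
      simp only [Matrix.mul_apply, Fin.sum_univ_two, Matrix.smul_apply, Matrix.of_apply,
        Matrix.cons_val', Matrix.cons_val_zero, Matrix.cons_val_one, Matrix.cons_val_fin_one,
        Fin.zero_eta, Fin.mk_one, Fin.isValue, mul_zero, zero_mul, add_zero, zero_add, h3,
        smul_zero, mul_smul_comm, smul_mul_assoc, smul_smul, h1, h2, smul_add]
    · have e1 : superSign q (par j) * (superSign q (par j) * superSign (par i) (par j)) =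
          superSign (par i) (par j) := by
        rw [← mul_assoc, superSign_mul_self, one_mul]
      have e2 : superSign (par i) (par j) * (superSign q (par i) *
          (superSign q (par i) * superSign (par j) (par i))) = 1 := by
        rw [← mul_assoc (superSign q (par i)), superSign_mul_self, one_mul,
          superSign_comm (par j), superSign_mul_self]
      rw [e1, e2, one_smul, add_comm]
    · congr 1
      ring
  let Ψ : SuperSym P →ₐ[ℂ] Matrix (Fin 2) (Fin 2) (SuperSym P) := liftBasis hb _ hrel
  have hX : ∀ i, Ψ (X P b i) = !![X P b i, f i; 0, superSign q (par i) • X P b i] :=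
    liftBasis_X hb _ _
  have h00 : ∀ z, Ψ z 0 0 = z := by
    refine fun z => LinearMap.congr_fun (linearMap_ext_right b
      (f := Matrix.entryLinearMap ℂ (SuperSym P) (0 : Fin 2) (0 : Fin 2) ∘ₗ Ψ.toLinearMap)
      (g := LinearMap.id) (by simp) fun i z hz => ?_) z
    simpa [hX, Matrix.mul_apply, Fin.sum_univ_two] using congrArg (· * X P b i) hz
  refine ⟨Matrix.entryLinearMap ℂ (SuperSym P) (0 : Fin 2) (1 : Fin 2) ∘ₗ Ψ.toLinearMap, by simp,
    fun z i => ?_⟩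
  simp [hX, Matrix.mul_apply, Fin.sum_univ_two, h00]

/-- The right superderivation of parity `q` of `S(V)` with prescribed values on the generators. -/
noncomputable def superDer (hb : IsHomogeneousBasis P b par) (q : ZMod 2) (f : I → SuperSym P)
    (hf : ∀ i, f i ∈ wordSpan (X P b) par (q + par i)) : SuperSym P →ₗ[ℂ] SuperSym P :=
  (exists_superDerivation hb q f hf).choose

section

variable (hb : IsHomogeneousBasis P b par) (q : ZMod 2) (f : I → SuperSym P)
  (hf : ∀ i, f i ∈ wordSpan (X P b) par (q + par i))

@[simp] theorem superDer_one : superDer hb q f hf 1 = 0 :=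
  (exists_superDerivation hb q f hf).choose_spec.1

theorem superDer_mul_X (z : SuperSym P) (i : I) : superDer hb q f hf (z * X P b i) =
    z * f i + superSign q (par i) • (superDer hb q f hf z * X P b i) :=
  (exists_superDerivation hb q f hf).choose_spec.2 z i

@[simp] theorem superDer_X (i : I) : superDer hb q f hf (X P b i) = f i := by
  simpa using superDer_mul_X hb q f hf 1 i

theorem superDer_mem {M : Type} [AddCommMonoid M] {w : I → M} {δ : M}
    (hw : ∀ i, f i ∈ wordSpan (X P b) w (w i + δ)) {m : M} {z : SuperSym P}
    (hz : z ∈ wordSpan (X P b) w m) : superDer hb q f hf z ∈ wordSpan (X P b) w (m + δ) := by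
  have : wordSpan (X P b) w m ≤ (wordSpan (X P b) w (m + δ)).comap (superDer hb q f hf) := by
    clear hz
    refine wordSpan_le ?_
    rintro l rfl
    induction l using List.reverseRecOn with
    | nil => simp
    | append_singleton l i ih =>
      simp only [Submodule.mem_comap, List.map_append, List.map_cons, List.map_nil,
        List.prod_append, List.prod_cons, List.prod_nil, mul_one, List.sum_append, List.sum_cons,
        List.sum_nil, add_zero] at ih ⊢
      rw [superDer_mul_X]
      refine add_mem ?_ (Submodule.smul_mem _ _ ?_)
      · rw [add_assoc]
        exact mul_mem_wordSpan (word_mem l) (hw i)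
      · rw [add_assoc, add_comm (w i), ← add_assoc]
        exact mul_mem_wordSpan ih (letter_mem_wordSpan i)
  exact this hz

theorem superDer_mem_wordFil {w : I → ℤ} {δ : ℤ}
    (hw : ∀ i, f i ∈ wordSpan (X P b) w (w i + δ)) {m : ℤ} {z : SuperSym P}
    (hz : z ∈ wordFil (X P b) w m) : superDer hb q f hf z ∈ wordFil (X P b) w (m + δ) := by
  have : wordFil (X P b) w m ≤ (wordFil (X P b) w (m + δ)).comap (superDer hb q f hf) :=
    wordFil_le fun d hd z hz =>
      wordSpan_le_wordFil (add_le_add_left hd δ) (superDer_mem hb q f hf hw hz)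
  exact this hz

theorem superDer_ι (z : SuperSym P) {p : ZMod 2} {x : V} (hx : x ∈ P p) :
    superDer hb q f hf (z * SuperSym.ι P x) =
      z * b.constr ℂ f x + superSign q p • (superDer hb q f hf z * SuperSym.ι P x) := by
  have : P p ≤ LinearMap.ker (superDer hb q f hf ∘ₗ LinearMap.mulLeft ℂ z ∘ₗ SuperSym.ι P -
      LinearMap.mulLeft ℂ z ∘ₗ b.constr ℂ f - superSign q p •
        (LinearMap.mulLeft ℂ (superDer hb q f hf z) ∘ₗ SuperSym.ι P)) := by
    refine hb.induction fun i hi => ?_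
    subst hi
    have := superDer_mul_X hb q f hf z i
    simp only [X] at this
    simp [this]
  have := this hx
  simpa [sub_sub, sub_eq_zero] using this

end

section

variable (hb : IsHomogeneousBasis P b par) (f : I → SuperSym P)
  (hf : ∀ i, f i ∈ wordSpan (X P b) par (0 + par i))

theorem superDer_zero_mul (y z : SuperSym P) : superDer hb 0 f hf (y * z) =
    y * superDer hb 0 f hf z + superDer hb 0 f hf y * z := by
  refine LinearMap.congr_fun (linearMap_ext_right b
    (f := superDer hb 0 f hf ∘ₗ LinearMap.mulLeft ℂ y)
    (g := LinearMap.mulLeft ℂ y ∘ₗ superDer hb 0 f hf +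
      LinearMap.mulLeft ℂ (superDer hb 0 f hf y)) (by simp) fun i z hz => ?_) z
  simp only [LinearMap.comp_apply, LinearMap.mulLeft_apply, LinearMap.add_apply] at hz ⊢
  rw [← mul_assoc, superDer_mul_X, superDer_mul_X, hz]
  simp only [superSign_zero_left, one_smul]
  noncomm_ring

/-- Words in eigenvectors of an even derivation are eigenvectors. -/
theorem wordSpan_le_eigenspace {J : Type} {u : J → SuperSym P} {w : J → ℤ}
    (hu : ∀ j, superDer hb 0 f hf (u j) = (w j : ℂ) • u j) (m : ℤ) :
    wordSpan u w m ≤ Module.End.eigenspace (superDer hb 0 f hf) (m : ℂ) := by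
  refine wordSpan_le ?_
  rintro l rfl
  rw [Module.End.mem_eigenspace_iff]
  induction l with
  | nil => simp
  | cons j l ih =>
    simp only [List.map_cons, List.prod_cons, List.sum_cons] at ih ⊢
    rw [superDer_zero_mul, ih, hu]
    simp [add_smul, add_comm]

/-- Distinct integer weights are distinct complex eigenvalues of one derivation, so the weight
spaces are independent without knowing a basis of S(V). -/
theorem iSupIndep_wordSpan_of_eigen {J : Type} {u : J → SuperSym P} {w : J → ℤ}
    (hu : ∀ j, superDer hb 0 f hf (u j) = (w j : ℂ) • u j) : iSupIndep (wordSpan u w) := by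
  have h := (Module.End.eigenspaces_iSupIndep (superDer hb 0 f hf)).comp
    (f := fun m : ℤ => (m : ℂ)) Int.cast_injective
  exact h.mono (wordSpan_le_eigenspace hb f hf hu)

end

/-- The derivation multiplying each word by its weight. -/
noncomputable def euler (hb : IsHomogeneousBasis P b par) (w : I → ℤ) :
    SuperSym P →ₗ[ℂ] SuperSym P :=
  superDer hb 0 (fun i => (w i : ℂ) • X P b i) fun i => by
    rw [zero_add]
    exact Submodule.smul_mem _ _ (letter_mem_wordSpan i)

theorem euler_X (hb : IsHomogeneousBasis P b par) (w : I → ℤ) (i : I) :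
    euler hb w (X P b i) = (w i : ℂ) • X P b i :=
  superDer_X hb 0 _ _ i

theorem euler_apply (hb : IsHomogeneousBasis P b par) (w : I → ℤ) {m : ℤ} {z : SuperSym P}
    (hz : z ∈ wordSpan (X P b) w m) : euler hb w z = (m : ℂ) • z :=
  Module.End.mem_eigenspace_iff.1 (wordSpan_le_eigenspace hb _ _ (euler_X hb w) m hz)

theorem euler_mul_X (hb : IsHomogeneousBasis P b par) (w : I → ℤ) (z : SuperSym P) (i : I) :
    euler hb w (z * X P b i) = euler hb w z * X P b i + (w i : ℂ) • (z * X P b i) := by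
  rw [euler, superDer_mul_X]
  simp [add_comm]

theorem iSupIndep_wordSpan (hb : IsHomogeneousBasis P b par) (w : I → ℤ) :
    iSupIndep (wordSpan (X P b) w) :=
  iSupIndep_wordSpan_of_eigen hb _ _ (euler_X hb w)

theorem eq_zero_of_mem_wordFil (hb : IsHomogeneousBasis P b par) (w : I → ℤ) {k : ℤ}
    {z : SuperSym P} (hz : z ∈ wordSpan (X P b) w k) (hz' : z ∈ wordFil (X P b) w (k - 1)) :
    z = 0 := by
  refine Submodule.disjoint_def.1 (iSupIndep_wordSpan hb w k) z hz ?_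
  refine wordFil_le (fun d hd => ?_) hz'
  exact le_iSup_of_le d (le_iSup_of_le (by omega) le_rfl)

/-- The span of all words of weight at least `k`. -/
def _root_.wordCofil {A J : Type} [Ring A] [Algebra ℂ A] (f : J → A) (w : J → ℤ) (k : ℤ) :
    Submodule ℂ A :=
  ⨆ d : ℤ, ⨆ _ : k ≤ d, wordSpan f w d

theorem _root_.wordSpan_le_wordCofil {A J : Type} [Ring A] [Algebra ℂ A] {f : J → A} {w : J → ℤ}
    {d k : ℤ} (h : k ≤ d) : wordSpan f w d ≤ wordCofil f w k :=
  le_iSup_of_le d (le_iSup_of_le h le_rfl)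

theorem _root_.mem_wordCofil_succ {A J : Type} [Ring A] [Algebra ℂ A] {f : J → A} {w : J → ℤ}
    {k : ℤ} {a : A} (ha : a ∈ wordCofil f w k) :
    ∃ b ∈ wordSpan f w k, a - b ∈ wordCofil f w (k + 1) := by
  have : wordCofil f w k ≤ wordSpan f w k ⊔ wordCofil f w (k + 1) := by
    refine iSup_le fun d => iSup_le fun hd => ?_
    rcases hd.eq_or_lt with rfl | hd
    · exact le_sup_left
    · exact (wordSpan_le_wordCofil (by omega)).trans le_sup_right
  obtain ⟨b, hb, c, hc, rfl⟩ := Submodule.mem_sup.1 (this ha)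
  exact ⟨b, hb, by simpa using hc⟩

theorem eq_zero_of_mem_wordCofil (hb : IsHomogeneousBasis P b par) (w : I → ℤ) {k : ℤ}
    {z : SuperSym P} (hz : z ∈ wordSpan (X P b) w k) (hz' : z ∈ wordCofil (X P b) w (k + 1)) :
    z = 0 := by
  refine Submodule.disjoint_def.1 (iSupIndep_wordSpan hb w k) z hz ?_
  have : wordCofil (X P b) w (k + 1) ≤ ⨆ j, ⨆ _ : j ≠ k, wordSpan (X P b) w j := by
    refine iSup_le fun d => iSup_le fun hd => ?_
    exact le_iSup_of_le d (le_iSup_of_le (by omega) le_rfl)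
  exact this hz'

/-- A linear map whose leading term with respect to the length of words is injective. -/
theorem injective_of_leading (hb : IsHomogeneousBasis P b par)
    {L L₀ : SuperSym P →ₗ[ℂ] SuperSym P}
    (h₀ : ∀ d, ∀ z ∈ wordSpan (X P b) (fun _ => (1 : ℤ)) d,
      L₀ z ∈ wordSpan (X P b) (fun _ => (1 : ℤ)) d)
    (hinj : ∀ z, L₀ z = 0 → z = 0)
    (hL : ∀ d, ∀ z ∈ wordSpan (X P b) (fun _ => (1 : ℤ)) d,
      L z - L₀ z ∈ wordCofil (X P b) (fun _ => (1 : ℤ)) (d + 1))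
    (z : SuperSym P) (hz : L z = 0) : z = 0 := by
  set w : I → ℤ := fun _ => 1
  have hLc : ∀ d, ∀ z ∈ wordCofil (X P b) w d, L z ∈ wordCofil (X P b) w d := by
    intro d z hz
    have : wordCofil (X P b) w d ≤ (wordCofil (X P b) w d).comap L := by
      refine iSup_le fun e => iSup_le fun he y hy => ?_
      have h1 := wordSpan_le_wordCofil he (h₀ e y hy)
      have h2 : L y - L₀ y ∈ wordCofil (X P b) w d := by
        have : wordCofil (X P b) w (e + 1) ≤ wordCofil (X P b) w d :=
          iSup_le fun j => iSup_le fun hj => wordSpan_le_wordCofil (by omega)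
        exact this (hL e y hy)
      simpa using add_mem h1 h2
    exact this hz
  -- If z has only words of length at least n, the part of `L z` of length n is `L₀` of the part of
  -- z of length n. It vanishes, so z starts in length n + 1.
  have key : ∀ n : ℕ, z ∈ wordCofil (X P b) w n := by
    intro n
    induction n with
    | zero =>
      have hz : z ∈ ⨆ m, wordSpan (X P b) w m := by rw [iSup_wordSpan (adjoin_X b)]; trivial
      have : (⨆ m, wordSpan (X P b) w m) ≤ wordCofil (X P b) w 0 := by
        refine iSup_le fun m => wordSpan_le ?_
        rintro l rfl
        refine wordSpan_le_wordCofil ?_ (word_mem l)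
        simp [w]
      exact this hz
    | succ n ih =>
      obtain ⟨y, hy, hzy⟩ := mem_wordCofil_succ ih
      have h1 : L₀ y ∈ wordCofil (X P b) w (n + 1) := by
        have h2 := hLc _ _ hzy
        rw [map_sub, hz, zero_sub] at h2
        have h3 := neg_mem (add_mem h2 (hL _ _ hy))
        simpa using h3
      have h4 := hinj y (eq_zero_of_mem_wordCofil hb w (h₀ _ _ hy) h1)
      rw [h4, sub_zero] at hzy
      exact_mod_cast hzy
  obtain ⟨k, hk⟩ := exists_mem_wordFil (w := w) (adjoin_X b) z
  have hind := iSupIndep_wordSpan hb w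
  -- But z also involves words of length at most k only, and the two ranges of lengths are
  -- independent.
  have hdis : Disjoint (⨆ d ∈ Set.Iic k, wordSpan (X P b) w d)
      (⨆ d ∈ Set.Ici ((k.toNat + 1 : ℕ) : ℤ), wordSpan (X P b) w d) := by
    refine hind.disjoint_biSup_biSup ?_
    rw [Set.disjoint_left]
    intro d hd hd'
    simp only [Set.mem_Iic, Set.mem_Ici] at hd hd'
    omega
  exact Submodule.disjoint_def.1 hdis z hk (key _)

end SuperSym


/-! ### The universal enveloping algebra -/

namespace Env

variable {g I : Type} [AddCommGroup g] [Module ℂ g] [LieSuperalgebra g]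
  {A : Type} [Ring A] [Algebra ℂ A]

theorem ι_mul_ι {i j : ZMod 2} {x y : g} (hx : x ∈ LieSuperalgebra.part i)
    (hy : y ∈ LieSuperalgebra.part j) : Env.ι g x * Env.ι g y =
      superSign i j • (Env.ι g y * Env.ι g x) + Env.ι g (LieSuperalgebra.bracket x y) := by
  have := RingQuot.mkAlgHom_rel ℂ (EnvRel.mk i j x y hx hy)
  rw [map_add, map_smul, map_mul, map_mul] at this
  exact this

/-- The universal property of `U(g)`. -/
noncomputable def lift (f : g →ₗ[ℂ] A) (hf : ∀ i j x y, x ∈ LieSuperalgebra.part i →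
    y ∈ LieSuperalgebra.part j →
    f x * f y = superSign i j • (f y * f x) + f (LieSuperalgebra.bracket x y)) : Env g →ₐ[ℂ] A :=
  RingQuot.liftAlgHom ℂ (s := EnvRel g) ⟨TensorAlgebra.lift ℂ f, by
    rintro _ _ ⟨i, j, x, y, hx, hy⟩
    simpa using hf i j x y hx hy⟩

theorem lift_ι (f : g →ₗ[ℂ] A) (hf) (x : g) : lift f hf (Env.ι g x) = f x := by
  refine (RingQuot.liftAlgHom_mkAlgHom_apply ℂ _ _ _).trans ?_
  simp

theorem adjoin_ι : Algebra.adjoin ℂ (Set.range (Env.ι g)) = ⊤ := by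
  have h : (Algebra.adjoin ℂ (Set.range (TensorAlgebra.ι ℂ (M := g)))).map
      (RingQuot.mkAlgHom ℂ (EnvRel g)) = ⊤ := by
    rw [TensorAlgebra.adjoin_range_ι, Algebra.map_top, AlgHom.range_eq_top]
    exact RingQuot.mkAlgHom_surjective ℂ _
  rw [AlgHom.map_adjoin, ← Set.range_comp] at h
  exact h

variable (b : Module.Basis I ℂ g) {par : I → ZMod 2}

/-- The generator of `U(g)` attached to a basis vector. -/
noncomputable def X (i : I) : Env g := Env.ι g (b i)

theorem adjoin_X : Algebra.adjoin ℂ (Set.range (X b)) = ⊤ := by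
  rw [eq_top_iff, ← adjoin_ι, Algebra.adjoin_le_iff]
  rintro _ ⟨x, rfl⟩
  have : (⊤ : Submodule ℂ g) ≤
      (Subalgebra.toSubmodule (Algebra.adjoin ℂ (Set.range (X b)))).comap (Env.ι g) := by
    rw [← b.span_eq, Submodule.span_le]
    rintro _ ⟨i, rfl⟩
    exact Algebra.subset_adjoin ⟨i, rfl⟩
  exact this trivial

variable {b}

/-- The universal property of `U(g)` in terms of a homogeneous basis. -/
noncomputable def liftBasis
    (hb : IsHomogeneousBasis (LieSuperalgebra.part (g := g)) b par) (f : g →ₗ[ℂ] A)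
    (hf : ∀ i j, f (b i) * f (b j) = superSign (par i) (par j) • (f (b j) * f (b i)) +
      f (LieSuperalgebra.bracket (b i) (b j))) : Env g →ₐ[ℂ] A :=
  lift f (hb.bilinear_ext
    (F := fun _ _ => (LinearMap.mul ℂ A).compl₁₂ f f)
    (G := fun i j => superSign i j • ((LinearMap.mul ℂ A).compl₁₂ f f).flip +
      LieSuperalgebra.bracket.compr₂ f)
    (fun i j => by simpa using hf i j))

theorem liftBasis_ι (hb : IsHomogeneousBasis (LieSuperalgebra.part (g := g)) b par)
    (f : g →ₗ[ℂ] A) (hf) (x : g) : liftBasis hb f hf (Env.ι g x) = f x :=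
  lift_ι _ _ _

end Env

theorem map_mem_wordSpan_of_mem_span {V I M A : Type} [AddCommGroup V] [Module ℂ V] [AddMonoid M]
    [Ring A] [Algebra ℂ A] (j : V →ₗ[ℂ] A) (b : I → V) (w : I → M) {m : M} {x : V}
    (hx : x ∈ Submodule.span ℂ (b '' {i | w i = m})) : j x ∈ wordSpan (fun i => j (b i)) w m := by
  have : Submodule.span ℂ (b '' {i | w i = m}) ≤ (wordSpan (fun i => j (b i)) w m).comap j := by
    rw [Submodule.span_le]
    rintro _ ⟨i, rfl, rfl⟩
    exact letter_mem_wordSpan (f := fun i => j (b i)) i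
  exact this hx

/-! ### Associated graded algebras of almost supercommutative filtered algebras -/

namespace AlgFiltration

variable {V I A : Type} [AddCommGroup V] [Module ℂ V] [Ring A] [Algebra ℂ A]
  {P : ZMod 2 → Submodule ℂ V} {b : Module.Basis I ℂ V} {par : I → ZMod 2}
  (Φ : AlgFiltration A)

theorem of_symbol_eq {i j : ℤ} (hij : i = j) (a : Φ.F i) (b : Φ.F j) (hab : (a : A) = b) :
    DirectSum.lof ℂ ℤ Φ.Piece i (Φ.symbol i a) = DirectSum.lof ℂ ℤ Φ.Piece j (Φ.symbol j b) :=
  DirectSum.of_eq_of_gradedMonoid_eq (Φ.mk_symbol_eq hij a b hab)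

theorem lof_symbol_mul {i j : ℤ} (a : Φ.F i) (b : Φ.F j) :
    DirectSum.lof ℂ ℤ Φ.Piece i (Φ.symbol i a) * DirectSum.lof ℂ ℤ Φ.Piece j (Φ.symbol j b) =
      DirectSum.lof ℂ ℤ Φ.Piece (i + j)
        (Φ.symbol (i + j) ⟨(a : A) * b, Φ.mul_mem i j a b a.2 b.2⟩) :=
  DirectSum.of_mul_of _ _

/-- Letters that supercommute up to terms of lower degree define a homomorphism from the symmetric
superalgebra to the associated graded algebra. -/
noncomputable def grLift (hb : IsHomogeneousBasis P b par) (w : I → ℤ) (f : I → A)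
    (hf : ∀ i, f i ∈ Φ.F (w i))
    (hcomm : ∀ i j, f i * f j - superSign (par i) (par j) • (f j * f i) ∈ Φ.F (w i + w j - 1)) :
    SuperSym P →ₐ[ℂ] Φ.Gr :=
  SuperSym.liftBasis hb (fun i => DirectSum.lof ℂ ℤ Φ.Piece (w i) (Φ.symbol (w i) ⟨f i, hf i⟩))
    fun i j => by
      have h := Φ.mul_mem _ _ _ _ (hf j) (hf i)
      rw [add_comm] at h
      rw [lof_symbol_mul, lof_symbol_mul, Φ.of_symbol_eq (add_comm (w j) (w i)) _ ⟨_, h⟩ rfl,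
        ← map_smul, ← map_smul]
      congr 1
      rw [symbol_eq_iff]
      exact hcomm i j

/-- The same words read in A and in S(V): the homomorphism sends the second component of a pair to
the symbol of the first. -/
theorem grLift_eq (hb : IsHomogeneousBasis P b par) (w : I → ℤ) (f : I → A)
    (hf : ∀ i, f i ∈ Φ.F (w i)) (hcomm) {k : ℤ} {a : A} {t : SuperSym P}
    (h : (a, t) ∈ wordSpan (fun i => (f i, SuperSym.X P b i)) w k) :
    ∃ ha : a ∈ Φ.F k,
      Φ.grLift hb w f hf hcomm t = DirectSum.lof ℂ ℤ Φ.Piece k (Φ.symbol k ⟨a, ha⟩) := by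
  suffices H : ∀ q ∈ wordSpan (fun i => (f i, SuperSym.X P b i)) w k, ∃ ha : q.1 ∈ Φ.F k,
      Φ.grLift hb w f hf hcomm q.2 = DirectSum.lof ℂ ℤ Φ.Piece k (Φ.symbol k ⟨q.1, ha⟩) from
    H _ h
  clear h
  intro q hq
  refine Submodule.span_induction (p := fun q _ => ∃ ha : q.1 ∈ Φ.F k,
    Φ.grLift hb w f hf hcomm q.2 = DirectSum.lof ℂ ℤ Φ.Piece k (Φ.symbol k ⟨q.1, ha⟩))
    ?_ ?_ ?_ ?_ hq
  · clear hq
    rintro _ ⟨l, rfl, rfl⟩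
    induction l with
    | nil => exact ⟨Φ.one_mem, by simp; rfl⟩
    | cons i l ih =>
      obtain ⟨h1, h2⟩ := ih
      refine ⟨Φ.mul_mem _ _ _ _ (hf i) h1, ?_⟩
      simp only [List.map_cons, List.prod_cons, Prod.snd_mul, map_mul, h2]
      rw [grLift, SuperSym.liftBasis_X, lof_symbol_mul]
      rfl
  · refine ⟨zero_mem _, ?_⟩
    rw [Prod.snd_zero, map_zero]
    exact (((DirectSum.lof ℂ ℤ Φ.Piece k) ∘ₗ Φ.symbol k).map_zero).symm
  · rintro x y - - ⟨hx, hx'⟩ ⟨hy, hy'⟩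
    refine ⟨add_mem hx hy, ?_⟩
    rw [Prod.snd_add, map_add, hx', hy', ← map_add, ← map_add]
    rfl
  · rintro c x - ⟨hx, hx'⟩
    refine ⟨Submodule.smul_mem _ _ hx, ?_⟩
    rw [Prod.smul_snd, map_smul, hx', ← map_smul, ← map_smul]
    rfl

/-- The easy half of Poincaré-Birkhoff-Witt: a combination of words that vanishes after
supercommutation has symbol zero. -/
theorem mem_of_grLift (hb : IsHomogeneousBasis P b par) (w : I → ℤ) (f : I → A)
    (hf : ∀ i, f i ∈ Φ.F (w i))
    (hcomm : ∀ i j, f i * f j - superSign (par i) (par j) • (f j * f i) ∈ Φ.F (w i + w j - 1))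
    {k : ℤ} {a : A} (h : (a, (0 : SuperSym P)) ∈ wordSpan (fun i => (f i, SuperSym.X P b i)) w k) :
    a ∈ Φ.F (k - 1) := by
  obtain ⟨ha, h⟩ := Φ.grLift_eq hb w f hf hcomm h
  rw [map_zero] at h
  have h' := (DirectSum.of_injective k) (h.symm.trans (map_zero _).symm)
  have := (Φ.symbol_eq_iff k ⟨a, ha⟩ 0).1 (h'.trans (map_zero _).symm)
  simpa using this

end AlgFiltration

/-! ### The Poincaré-Birkhoff-Witt theorem for the commutator superalgebra of a graded algebra -/

/-- The bracket of `g` is the supercommutator of an associative product on `g` that is compatible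
with the parity and with a `ℤ`-grading; `b` is a homogeneous basis. -/
structure IsAssocGraded {g I : Type} [AddCommGroup g] [Module ℂ g] [LieSuperalgebra g]
    (b : Module.Basis I ℂ g) (par : I → ZMod 2) (deg : I → ℤ) (mul : g →ₗ[ℂ] g →ₗ[ℂ] g) :
    Prop where
  hom : IsHomogeneousBasis (LieSuperalgebra.part (g := g)) b par
  assoc : ∀ i j k, mul (mul (b i) (b j)) (b k) = mul (b i) (mul (b j) (b k))
  mul_mem : ∀ i j, mul (b i) (b j) ∈
    Submodule.span ℂ (b '' {k | (par k, deg k) = (par i + par j, deg i + deg j)})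
  bracket_eq : ∀ i j, LieSuperalgebra.bracket (b i) (b j) =
    mul (b i) (b j) - superSign (par i) (par j) • mul (b j) (b i)

namespace IsAssocGraded

variable {g I : Type} [AddCommGroup g] [Module ℂ g] [LieSuperalgebra g]
  {b : Module.Basis I ℂ g} {par : I → ZMod 2} {deg : I → ℤ} {mul : g →ₗ[ℂ] g →ₗ[ℂ] g}

/-- The symmetric superalgebra of `g`. -/
local notation "𝐒" => SuperSym (LieSuperalgebra.part (g := g))

/-- Its generators. -/
local notation "𝐱" => SuperSym.X (LieSuperalgebra.part (g := g)) b

theorem mul_mem_par (h : IsAssocGraded b par deg mul) (i j : I) :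
    mul (b i) (b j) ∈ Submodule.span ℂ (b '' {k | par k = par i + par j}) := by
  refine Submodule.span_mono (Set.image_mono ?_) (h.mul_mem i j)
  intro k hk
  exact congrArg Prod.fst hk

theorem mul_mem_deg (h : IsAssocGraded b par deg mul) (i j : I) :
    mul (b i) (b j) ∈ Submodule.span ℂ (b '' {k | deg k = deg i + deg j}) := by
  refine Submodule.span_mono (Set.image_mono ?_) (h.mul_mem i j)
  intro k hk
  exact congrArg Prod.snd hk

theorem bracket_mem (h : IsAssocGraded b par deg mul) (i j : I) :
    LieSuperalgebra.bracket (b i) (b j) ∈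
      Submodule.span ℂ (b '' {k | (par k, deg k) = (par i + par j, deg i + deg j)}) := by
  rw [h.bracket_eq]
  refine sub_mem (h.mul_mem i j) (Submodule.smul_mem _ _ ?_)
  rw [add_comm (par i), add_comm (deg i)]
  exact h.mul_mem j i

/-- The superderivation of `S(g)` extending right multiplication by a basis vector. -/
noncomputable def der (h : IsAssocGraded b par deg mul) (i : I) : 𝐒 →ₗ[ℂ] 𝐒 :=
  SuperSym.superDer h.hom (par i) (fun j => SuperSym.ι _ (mul (b j) (b i))) fun j => by
    rw [add_comm]
    exact map_mem_wordSpan_of_mem_span _ b par (h.mul_mem_par j i)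

theorem der_mul_X (h : IsAssocGraded b par deg mul) (i k : I) (z : 𝐒) :
    h.der i (z * 𝐱 k) = z * SuperSym.ι _ (mul (b k) (b i)) +
      superSign (par i) (par k) • (h.der i z * 𝐱 k) :=
  SuperSym.superDer_mul_X _ _ _ _ _ _

/-- The operators `der`, extended linearly to `g`. -/
noncomputable def derLin (h : IsAssocGraded b par deg mul) : g →ₗ[ℂ] 𝐒 →ₗ[ℂ] 𝐒 :=
  b.constr ℂ h.der

theorem derLin_mul_X (h : IsAssocGraded b par deg mul) {q : ZMod 2} {x : g}
    (hx : x ∈ Submodule.span ℂ (b '' {k | par k = q})) (k : I) (z : 𝐒) :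
    h.derLin x (z * 𝐱 k) = z * SuperSym.ι _ (mul (b k) x) +
      superSign q (par k) • (h.derLin x z * 𝐱 k) := by
  refine Submodule.span_induction (p := fun x _ => h.derLin x (z * 𝐱 k) =
    z * SuperSym.ι _ (mul (b k) x) + superSign q (par k) • (h.derLin x z * 𝐱 k)) ?_ ?_ ?_ ?_ hx
  · rintro _ ⟨i, rfl, rfl⟩
    simp [derLin, der_mul_X]
  · simp
  · intro x y _ _ hx hy
    simp only [map_add, LinearMap.add_apply, hx, hy, mul_add, add_mul, smul_add]
    abel
  · intro c x _ hx
    simp only [map_smul, LinearMap.smul_apply, hx, mul_smul_comm, smul_mul_assoc, smul_add,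
      smul_comm c]

/-- Both sides satisfy the same Leibniz rule, so only generators matter. There the identity is
associativity, (b_k b_i) b_j = b_k (b_i b_j), combined with the formula for the bracket as a
supercommutator. -/
theorem der_der (h : IsAssocGraded b par deg mul) (i j : I) (z : 𝐒) :
    h.der j (h.der i z) = superSign (par i) (par j) • h.der i (h.der j z) +
      h.derLin (LieSuperalgebra.bracket (b i) (b j)) z := by
  refine LinearMap.congr_fun (SuperSym.linearMap_ext_right b (f := h.der j ∘ₗ h.der i)
    (g := superSign (par i) (par j) • (h.der i ∘ₗ h.der j) +
      h.derLin (LieSuperalgebra.bracket (b i) (b j))) ?_ fun k z hz => ?_) z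
  · have h1 : ∀ x, h.derLin x 1 = 0 := by
      intro x
      have : (LinearMap.applyₗ (1 : 𝐒)) ∘ₗ h.derLin = 0 := by
        refine b.ext fun i => ?_
        simp [derLin, der]
      exact LinearMap.congr_fun this x
    simp [h1, der]
  · simp only [LinearMap.comp_apply, LinearMap.add_apply, LinearMap.smul_apply] at hz ⊢
    have hij : LieSuperalgebra.bracket (b i) (b j) ∈
        Submodule.span ℂ (b '' {k | par k = par i + par j}) := by
      refine Submodule.span_mono (Set.image_mono ?_) (h.bracket_mem i j)
      exact fun k hk => congrArg Prod.fst hk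
    have hpart : ∀ a c, mul (b a) (b c) ∈ LieSuperalgebra.part (par a + par c) := by
      intro a c
      rw [h.hom]
      exact h.mul_mem_par a c
    have e : ∀ a c (y : 𝐒), h.der c (y * SuperSym.ι _ (mul (b k) (b a))) =
        y * SuperSym.ι _ (mul (mul (b k) (b a)) (b c)) +
          superSign (par c) (par k + par a) • (h.der c y * SuperSym.ι _ (mul (b k) (b a))) := by
      intro a c y
      rw [der, SuperSym.superDer_ι _ _ _ _ _ (hpart k a)]
      have : b.constr ℂ (fun j => SuperSym.ι (LieSuperalgebra.part (g := g)) (mul (b j) (b c))) =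
          SuperSym.ι _ ∘ₗ mul.flip (b c) := b.ext fun i => by simp
      rw [this]
      simp
    have hbr : SuperSym.ι LieSuperalgebra.part (mul (mul (b k) (b i)) (b j)) =
        superSign (par i) (par j) • SuperSym.ι LieSuperalgebra.part (mul (mul (b k) (b j)) (b i)) +
          SuperSym.ι LieSuperalgebra.part (mul (b k) (LieSuperalgebra.bracket (b i) (b j))) := by
      rw [h.bracket_eq, map_sub, map_sub, h.assoc, h.assoc, map_smul, map_smul]
      abel
    rw [h.derLin_mul_X hij, h.der_mul_X, h.der_mul_X, map_add, map_add, e, e, map_smul, map_smul,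
      h.der_mul_X, h.der_mul_X, hz, hbr]
    have s1 : superSign (par i) (par j) * superSign (par i) (par k + par j) =
        superSign (par i) (par k) := by
      rw [superSign_add_right, mul_comm (superSign (par i) (par k)), ← mul_assoc,
        superSign_mul_self, one_mul]
    have s2 : superSign (par j) (par k + par i) =
        superSign (par i) (par j) * superSign (par j) (par k) := by
      rw [superSign_add_right, mul_comm, superSign_comm (par j) (par i)]
    have s3 : superSign (par i) (par k) * (superSign (par j) (par k) * superSign (par i) (par j)) =
        superSign (par i) (par j) * (superSign (par i) (par k) * superSign (par j) (par k)) := by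
      ring
    simp only [smul_add, smul_smul, s1, s2, superSign_add_left, mul_add, add_mul, smul_mul_assoc,
      mul_smul_comm]
    rw [s3, mul_comm (superSign (par j) (par k)) (superSign (par i) (par k))]
    abel


/-- The right action of `g` on `S(g)` by affine vector fields. -/
noncomputable def act (h : IsAssocGraded b par deg mul) : g →ₗ[ℂ] 𝐒 →ₗ[ℂ] 𝐒 :=
  (LinearMap.mul ℂ 𝐒).flip ∘ₗ SuperSym.ι _ + h.derLin

theorem act_basis (h : IsAssocGraded b par deg mul) (i : I) (z : 𝐒) :
    h.act (b i) z = z * 𝐱 i + h.der i z := by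
  simp [act, derLin, SuperSym.X]

/-- Multiplications supercommute and the derivations satisfy `der_der`. The cross terms contribute z
(b_i b_j) minus its signed transpose, which is z [b_i, b_j]. -/
theorem act_act (h : IsAssocGraded b par deg mul) (i j : I) (z : 𝐒) :
    h.act (b j) (h.act (b i) z) = superSign (par i) (par j) • h.act (b i) (h.act (b j) z) +
      h.act (LieSuperalgebra.bracket (b i) (b j)) z := by
  have e : h.act (LieSuperalgebra.bracket (b i) (b j)) z =
      z * SuperSym.ι _ (LieSuperalgebra.bracket (b i) (b j)) +
        h.derLin (LieSuperalgebra.bracket (b i) (b j)) z := rfl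
  rw [e, act_basis, act_basis, act_basis, act_basis, map_add, map_add, der_mul_X, der_mul_X,
    der_der h i j, h.bracket_eq]
  have s1 : superSign (par j) (par i) = superSign (par i) (par j) := superSign_comm _ _
  simp only [smul_add, add_mul, mul_assoc, SuperSym.X_mul_X h.hom i j, mul_smul_comm, s1, smul_smul,
    superSign_mul_self, one_smul, map_sub, map_smul, mul_sub]
  abel

/-- The right regular representation of `U(g)` on `S(g)`. -/
noncomputable def rep (h : IsAssocGraded b par deg mul) : Env g →ₐ[ℂ] (Module.End ℂ 𝐒)ᵐᵒᵖ :=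
  Env.liftBasis h.hom ((MulOpposite.opLinearEquiv ℂ).toLinearMap ∘ₗ h.act) fun i j => by
    apply MulOpposite.unop_injective
    ext z
    simpa using h.act_act i j z

/-- The symbol map `U(g) → S(g)`, `u ↦ 1 · u`. -/
noncomputable def toSym (h : IsAssocGraded b par deg mul) : Env g →ₗ[ℂ] 𝐒 :=
  LinearMap.applyₗ (1 : 𝐒) ∘ₗ (MulOpposite.opLinearEquiv ℂ).symm.toLinearMap ∘ₗ
    h.rep.toLinearMap

theorem toSym_one (h : IsAssocGraded b par deg mul) : h.toSym 1 = 1 := by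
  simp [toSym]

theorem toSym_mul_X (h : IsAssocGraded b par deg mul) (u : Env g) (i : I) :
    h.toSym (u * Env.X b i) = h.toSym u * 𝐱 i + h.der i (h.toSym u) := by
  have : h.rep (Env.X b i) = MulOpposite.op (h.act (b i)) := Env.liftBasis_ι _ _ _ _
  simp [toSym, this, act_basis]

/-- The pairs of corresponding homogeneous elements of `U(g)` and `S(g)`. -/
noncomputable abbrev pairs (g : Type) [AddCommGroup g] [Module ℂ g] [LieSuperalgebra g] {I M : Type} [AddMonoid M]
    (b : Module.Basis I ℂ g) (w : I → M) (k : M) :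
    Submodule ℂ (Env g × SuperSym (LieSuperalgebra.part (g := g))) :=
  wordSpan (fun i => (Env.X b i, SuperSym.X (LieSuperalgebra.part (g := g)) b i)) w k

theorem exists_pair_left {M : Type} [AddMonoid M] {w : I → M} {k : M} {u : Env g}
    (hu : u ∈ wordSpan (Env.X b) w k) : ∃ t, (u, t) ∈ pairs g b w k := by
  obtain ⟨⟨u, t⟩, hq, rfl⟩ := exists_map_mem_wordSpan (f := fun i => (Env.X b i, 𝐱 i))
    (AlgHom.fst ℂ (Env g) 𝐒) (fun _ => rfl) hu
  exact ⟨t, hq⟩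

theorem exists_pair_right {M : Type} [AddMonoid M] {w : I → M} {k : M} {t : 𝐒}
    (ht : t ∈ wordSpan 𝐱 w k) : ∃ u, (u, t) ∈ pairs g b w k := by
  obtain ⟨⟨u, t⟩, hq, rfl⟩ := exists_map_mem_wordSpan (f := fun i => (Env.X b i, 𝐱 i))
    (AlgHom.snd ℂ (Env g) 𝐒) (fun _ => rfl) ht
  exact ⟨u, hq⟩

theorem pairs_fst_mem {M : Type} [AddMonoid M] {w : I → M} {k : M} {q : Env g × 𝐒}
    (hq : q ∈ pairs g b w k) : q.1 ∈ wordSpan (Env.X b) w k :=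
  map_mem_wordSpan (f := fun i => (Env.X b i, 𝐱 i)) (f' := Env.X b) (AlgHom.fst ℂ (Env g) 𝐒)
    (fun _ => rfl) hq

theorem pairs_snd_mem {M : Type} [AddMonoid M] {w : I → M} {k : M} {q : Env g × 𝐒}
    (hq : q ∈ pairs g b w k) : q.2 ∈ wordSpan 𝐱 w k :=
  map_mem_wordSpan (f := fun i => (Env.X b i, 𝐱 i)) (f' := 𝐱) (AlgHom.snd ℂ (Env g) 𝐒)
    (fun _ => rfl) hq

/-- `der i` raises Kazhdan degree by `deg i` only, two less than multiplication by the generator, so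
in `act` it is a lower order correction. -/
theorem der_mem_wordFil (h : IsAssocGraded b par deg mul) (i : I) {k : ℤ} {z : 𝐒}
    (hz : z ∈ wordFil 𝐱 (fun i => deg i + 2) k) :
    h.der i z ∈ wordFil 𝐱 (fun i => deg i + 2) (k + deg i) := by
  refine SuperSym.superDer_mem_wordFil _ _ _ _ (fun j => ?_) hz
  refine map_mem_wordSpan_of_mem_span (SuperSym.ι _) b (fun i => deg i + 2) ?_
  refine Submodule.span_mono (Set.image_mono ?_) (h.mul_mem_deg j i)
  intro l hl
  simp only [Set.mem_ofPred_eq] at hl ⊢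
  omega

/-- Induction on the last letter: the multiplication part of the action reproduces the
supercommutative word, and the derivation part is of lower degree. -/
theorem toSym_sub_mem (h : IsAssocGraded b par deg mul) {k : ℤ} {q : Env g × 𝐒}
    (hq : q ∈ pairs g b (fun i => deg i + 2) k) :
    h.toSym q.1 - q.2 ∈ wordFil 𝐱 (fun i => deg i + 2) (k - 1) := by
  have : pairs g b (fun i => deg i + 2) k ≤ (wordFil 𝐱 (fun i => deg i + 2) (k - 1)).comap
      (h.toSym ∘ₗ LinearMap.fst ℂ _ _ - LinearMap.snd ℂ _ _) := by
    clear hq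
    refine wordSpan_le ?_
    rintro l rfl
    induction l using List.reverseRecOn with
    | nil => simp [toSym_one]
    | append_singleton l i ih =>
      simp only [Submodule.mem_comap, List.map_append, List.map_cons, List.map_nil,
        List.prod_append, List.prod_cons, List.prod_nil, mul_one, List.sum_append, List.sum_cons,
        List.sum_nil, add_zero, LinearMap.sub_apply, LinearMap.comp_apply, LinearMap.fst_apply,
        LinearMap.snd_apply, Prod.fst_mul, Prod.snd_mul, toSym_mul_X] at ih ⊢
      set u := (List.map (fun i => (Env.X b i, 𝐱 i)) l).prod
      have h1 : u.2 ∈ wordSpan 𝐱 (fun i => deg i + 2) (l.map fun i => deg i + 2).sum :=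
        pairs_snd_mem (word_mem l)
      have h2 : h.toSym u.1 ∈ wordFil 𝐱 (fun i => deg i + 2) (l.map fun i => deg i + 2).sum := by
        have := add_mem (wordFil_mono (by omega) ih) (wordSpan_le_wordFil le_rfl h1)
        simpa using this
      have h3 := h.der_mem_wordFil i h2
      have h4 := mul_mem_wordFil ih (wordSpan_le_wordFil le_rfl
        (letter_mem_wordSpan (f := 𝐱) (w := fun i => deg i + 2) i))
      have h5 := add_mem (wordFil_mono (k := (l.map fun i => deg i + 2).sum + (deg i + 2) - 1)
        (by omega) h4) (wordFil_mono (k := (l.map fun i => deg i + 2).sum + (deg i + 2) - 1)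
        (by omega) h3)
      convert h5 using 1
      rw [sub_mul]
      abel
  exact this hq

theorem toSym_mem (h : IsAssocGraded b par deg mul) {k : ℤ} {u : Env g}
    (hu : u ∈ wordFil (Env.X b) (fun i => deg i + 2) k) :
    h.toSym u ∈ wordFil 𝐱 (fun i => deg i + 2) k := by
  have : wordFil (Env.X b) (fun i => deg i + 2) k ≤
      (wordFil 𝐱 (fun i => deg i + 2) k).comap h.toSym := by
    refine wordFil_le fun d hd u hu => ?_
    obtain ⟨t, hq⟩ := exists_pair_left hu
    have := add_mem (wordFil_mono (k := k) (by omega) (h.toSym_sub_mem hq))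
      (wordSpan_le_wordFil hd (pairs_snd_mem hq))
    simpa using this
  exact this hu

/-- The Kazhdan filtration of `U(g)` in terms of a homogeneous basis. -/
noncomputable def envFil (b : Module.Basis I ℂ g) (deg : I → ℤ) : AlgFiltration (Env g) where
  F := wordFil (Env.X b) (fun i => deg i + 2)
  mono _ _ hij := wordFil_mono hij
  one_mem := wordSpan_le_wordFil le_rfl one_mem_wordSpan
  mul_mem _ _ _ _ ha hb := mul_mem_wordFil ha hb

theorem X_mul_X_sub_mem (h : IsAssocGraded b par deg mul) (i j : I) :
    Env.X b i * Env.X b j - superSign (par i) (par j) • (Env.X b j * Env.X b i) ∈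
      wordSpan (Env.X b) (fun i => deg i + 2) (deg i + deg j + 2) := by
  rw [Env.X, Env.X, Env.ι_mul_ι (h.hom.mem i) (h.hom.mem j), add_sub_cancel_left]
  refine map_mem_wordSpan_of_mem_span _ b _ (Submodule.span_mono (Set.image_mono ?_)
    (h.bracket_mem i j))
  intro k hk
  simp only [Set.mem_ofPred_eq, Prod.mk.injEq] at hk ⊢
  omega

/-- The Poincaré-Birkhoff-Witt theorem: an element of `U(g)` is of lower degree if and only if the
corresponding element of `S(g)` is zero. -/
theorem mem_wordFil_iff (h : IsAssocGraded b par deg mul) {k : ℤ} {u : Env g} {t : 𝐒}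
    (hq : (u, t) ∈ pairs g b (fun i => deg i + 2) k) :
    u ∈ wordFil (Env.X b) (fun i => deg i + 2) (k - 1) ↔ t = 0 := by
  constructor
  -- `toSym` respects filtrations, so t is homogeneous of degree k and at the same time of degree at
  -- most k - 1.
  · intro hu
    have h1 := sub_mem (h.toSym_mem hu) (h.toSym_sub_mem hq)
    rw [sub_sub_cancel] at h1
    have h2 : t ∈ wordSpan 𝐱 (fun i => deg i + 2) k := pairs_snd_mem hq
    exact SuperSym.eq_zero_of_mem_wordFil h.hom _ h2 h1
  · rintro rfl
    refine (envFil b deg).mem_of_grLift h.hom (fun i => deg i + 2) (Env.X b)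
      (fun i => wordSpan_le_wordFil le_rfl (letter_mem_wordSpan i)) (fun i j => ?_) hq
    exact wordSpan_le_wordFil (by omega) (h.X_mul_X_sub_mem i j)

end IsAssocGraded


/-! ### Exactness of the Koszul complex -/

namespace SuperSym

variable {V I : Type} [AddCommGroup V] [Module ℂ V] {P : ZMod 2 → Submodule ℂ V}
  {b : Module.Basis I ℂ V} {par : I → ZMod 2}

/-- With nonnegative weights S(V) is spanned by eigenvectors of the Euler operator with nonnegative
eigenvalues, so -c is not an eigenvalue. -/
theorem eq_zero_of_euler_add (hb : IsHomogeneousBasis P b par) {u : I → ℤ} (hu : ∀ i, 0 ≤ u i)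
    {c : ℤ} (hc : 0 < c) {z : SuperSym P} (hz : euler hb u z + (c : ℂ) • z = 0) : z = 0 := by
  have hind := Module.End.eigenspaces_iSupIndep (euler hb u)
  refine Submodule.disjoint_def.1 (hind (-(c : ℂ))) z ?_ ?_
  · rw [Module.End.mem_eigenspace_iff, neg_smul]
    exact eq_neg_of_add_eq_zero_left hz
  · have hz : z ∈ ⨆ m, wordSpan (X P b) u m := by rw [iSup_wordSpan (adjoin_X b)]; trivial
    have : (⨆ m, wordSpan (X P b) u m) ≤
        ⨆ μ, ⨆ _ : μ ≠ -(c : ℂ), Module.End.eigenspace (euler hb u) μ := by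
      refine iSup_le fun m => wordSpan_le ?_
      rintro l rfl
      have h0 : 0 ≤ (l.map u).sum := List.sum_nonneg (by simpa using fun i _ => hu i)
      refine Submodule.mem_iSup_of_mem ((l.map u).sum : ℂ) (Submodule.mem_iSup_of_mem ?_ ?_)
      · intro h
        have : (l.map u).sum = -c := by exact_mod_cast h
        omega
      · rw [Module.End.mem_eigenspace_iff]
        exact euler_apply hb u (word_mem l)
    exact this hz

theorem exists_euler_add (hb : IsHomogeneousBasis P b par) {u : I → ℤ} (hu : ∀ i, 0 ≤ u i)
    {c : ℤ} (hc : 0 < c) (w : I → ℤ) {k : ℤ} {z : SuperSym P} (hz : z ∈ wordSpan (X P b) w k) :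
    ∃ y ∈ wordSpan (X P b) w k, euler hb u y + (c : ℂ) • y = z := by
  have : wordSpan (X P b) w k ≤
      (wordSpan (X P b) w k).map (euler hb u + (c : ℂ) • LinearMap.id) := by
    refine wordSpan_le ?_
    rintro l rfl
    have h0 : 0 ≤ (l.map u).sum := List.sum_nonneg (by simpa using fun i _ => hu i)
    have hne : ((l.map u).sum : ℂ) + c ≠ 0 := by
      intro h
      have : (l.map u).sum + c = 0 := by exact_mod_cast h
      omega
    refine ⟨(((l.map u).sum : ℂ) + c)⁻¹ • (l.map (X P b)).prod,
      Submodule.smul_mem _ _ (word_mem l), ?_⟩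
    rw [map_smul, LinearMap.add_apply, euler_apply hb u (word_mem l), LinearMap.smul_apply,
      LinearMap.id_apply, ← add_smul, smul_smul, inv_mul_cancel₀ hne, one_smul]
  obtain ⟨y, hy, h⟩ := this hz
  exact ⟨y, hy, h⟩

/-- This is the division by a word count in the Koszul homotopy. The inverse preserves every other
weight `w` because words are simultaneous eigenvectors. -/
theorem exists_euler_inverse (hb : IsHomogeneousBasis P b par) {u : I → ℤ} (hu : ∀ i, 0 ≤ u i)
    {c : ℤ} (hc : 0 < c) (w : I → ℤ) : ∃ R : SuperSym P →ₗ[ℂ] SuperSym P,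
      (∀ z, euler hb u (R z) + (c : ℂ) • R z = z) ∧
      ∀ k, ∀ z ∈ wordSpan (X P b) w k, R z ∈ wordSpan (X P b) w k := by
  have hinj : Function.Injective
      (euler hb u + (c : ℂ) • LinearMap.id : SuperSym P →ₗ[ℂ] SuperSym P) := by
    rw [← LinearMap.ker_eq_bot, LinearMap.ker_eq_bot']
    exact fun z hz => eq_zero_of_euler_add hb hu hc hz
  have hsurj : Function.Surjective
      (euler hb u + (c : ℂ) • LinearMap.id : SuperSym P →ₗ[ℂ] SuperSym P) := by
    rw [← LinearMap.range_eq_top, eq_top_iff, ← iSup_wordSpan (adjoin_X (P := P) b) (w := w)]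
    refine iSup_le fun m z hz => ?_
    obtain ⟨y, -, h⟩ := exists_euler_add hb hu hc w hz
    exact ⟨y, h⟩
  let e : SuperSym P ≃ₗ[ℂ] SuperSym P :=
    LinearEquiv.ofBijective (euler hb u + (c : ℂ) • LinearMap.id) ⟨hinj, hsurj⟩
  refine ⟨e.symm.toLinearMap, fun z => e.apply_symm_apply z, fun k z hz => ?_⟩
  obtain ⟨y, hy, h⟩ := exists_euler_add hb hu hc w hz
  have : e.symm z = y := by
    rw [LinearEquiv.symm_apply_eq]
    exact h.symm
  simpa [this] using hy

/-- Exactness of the Koszul complex in degree one: linear relations between the generators in `N`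
are generated by the supercommutation relations. -/
theorem koszul [Fintype I] (hb : IsHomogeneousBasis P b par) (N : Set I) (w : I → ℤ) (k : ℤ)
    (t : I → SuperSym P) (ht : ∀ i, t i ∈ wordSpan (X P b) w (k - w i)) (htN : ∀ i ∉ N, t i = 0)
    (h : ∑ i, t i * X P b i = 0) :
    ∃ v : I → I → SuperSym P, (∀ j, t j = ∑ i, v i j * X P b i) ∧
      (∀ i j, v i j = -(superSign (par i) (par j) • v j i)) ∧
      (∀ i j, v i j ∈ wordSpan (X P b) w (k - w i - w j)) ∧
      ∀ i j, (i ∉ N ∨ j ∉ N) → v i j = 0 := by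
  classical
  -- The Euler operator for this weight counts the letters in `N`.
  let u : I → ℤ := fun i => if i ∈ N then 1 else 0
  have hu : ∀ i, 0 ≤ u i := fun i => by
    simp only [u]
    split_ifs <;> simp
  have hδ : ∀ j i, (if i = j then (1 : SuperSym P) else 0) ∈
      wordSpan (X P b) par (par j + par i) := by
    intro j i
    split_ifs with hij
    · rw [hij, CharTwo.add_self_eq_zero]
      exact one_mem_wordSpan
    · exact zero_mem _
  -- The partial derivatives, as right superderivations with the parity of the variable.
  let d : I → SuperSym P →ₗ[ℂ] SuperSym P := fun j =>
    superDer hb (par j) (fun i => if i = j then 1 else 0) (hδ j)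
  have hd1 : ∀ j, d j 1 = 0 := fun j => superDer_one _ _ _ _
  have hd : ∀ j z i, d j (z * X P b i) = z * (if i = j then 1 else 0) +
      superSign (par j) (par i) • (d j z * X P b i) := fun j z i => superDer_mul_X _ _ _ _ _ _
  have hdw : ∀ j m z, z ∈ wordSpan (X P b) w m → d j z ∈ wordSpan (X P b) w (m - w j) := by
    intro j m z hz
    rw [sub_eq_add_neg]
    refine superDer_mem _ _ _ _ (fun i => ?_) hz
    split_ifs with hij
    · rw [hij, add_neg_cancel]
      exact one_mem_wordSpan
    · exact zero_mem _
  -- Euler's formula: the counting operator is the sum of ∂_i z · x_i over i in `N`.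
  have hE : ∀ z, euler hb u z = ∑ i, if i ∈ N then d i z * X P b i else 0 := by
    intro z
    let G : SuperSym P →ₗ[ℂ] SuperSym P :=
      ∑ i, if i ∈ N then LinearMap.mulRight ℂ (X P b i) ∘ₗ d i else 0
    have hG : ∀ z, G z = ∑ i, if i ∈ N then d i z * X P b i else 0 := by
      intro z
      simp only [G, LinearMap.sum_apply]
      refine Finset.sum_congr rfl fun i _ => ?_
      split_ifs <;> simp
    rw [← hG]
    refine LinearMap.congr_fun (linearMap_ext_right b ?_ fun i z hz => ?_) z
    · rw [hG, euler, superDer_one]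
      simp [hd1]
    · rw [euler_mul_X, hz, hG, hG, Finset.sum_mul]
      have e1 : (u i : ℂ) • (z * X P b i) =
          ∑ j, if j ∈ N then z * (if i = j then 1 else 0) * X P b j else 0 := by
        rw [Finset.sum_eq_single i]
        · simp only [u]
          split_ifs <;> simp
        · intro j _ hj
          simp [hj.symm]
        · simp
      rw [e1, ← Finset.sum_add_distrib]
      refine Finset.sum_congr rfl fun j _ => ?_
      by_cases hj : j ∈ N
      · simp only [if_pos hj]
        rw [hd, add_mul, add_comm, mul_assoc (d j z), X_mul_X hb j i, smul_mul_assoc, mul_smul_comm,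
          mul_assoc (d j z)]
      · simp [hj]
  -- R = (E + 2)⁻¹, with E the Euler operator. If E + 1 acts on t_j as multiplication by e + 1, the
  -- coefficient of x_i in its expansion has one letter fewer, so E + 2 acts there by e + 1 as well.
  obtain ⟨R, hR, hRw⟩ := exists_euler_inverse hb hu (c := 2) (by norm_num) w
  -- The homotopy is the super curl of t. Differentiating the relation by ∂_j and adding Euler's
  -- formula gives (E + 1) t_j = ∑ v₀ i j · x_i.
  let v₀ : I → I → SuperSym P := fun i j =>
    if i ∈ N ∧ j ∈ N then d i (t j) - superSign (par i) (par j) • d j (t i) else 0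
  refine ⟨fun i j => R (v₀ i j), fun j => ?_, fun i j => ?_, fun i j => ?_, fun i j hij => ?_⟩
  · by_cases hj : j ∈ N
    · have h1 : t j + ∑ i, superSign (par j) (par i) • (d j (t i) * X P b i) = 0 := by
        have := congrArg (d j) h
        rw [map_sum, map_zero] at this
        simp only [hd, Finset.sum_add_distrib, mul_ite, mul_one, mul_zero, Finset.sum_ite_eq',
          Finset.mem_univ, if_true] at this
        exact this
      have h2 : euler hb u (t j) + (1 : ℂ) • t j = ∑ i, v₀ i j * X P b i := by
        have e : ∑ i, v₀ i j * X P b i = (∑ i, if i ∈ N then d i (t j) * X P b i else 0) -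
            ∑ i, superSign (par j) (par i) • (d j (t i) * X P b i) := by
          rw [← Finset.sum_sub_distrib]
          refine Finset.sum_congr rfl fun i _ => ?_
          by_cases hi : i ∈ N
          · simp only [v₀, hi, hj, if_true, and_self, sub_mul, smul_mul_assoc,
              superSign_comm (par j)]
          · simp [v₀, hi, htN i hi]
        rw [e, one_smul, hE, sub_eq_add_neg, ← eq_neg_of_add_eq_zero_left h1]
      have h3 : ∀ i, euler hb u (R (v₀ i j) * X P b i) + (1 : ℂ) • (R (v₀ i j) * X P b i) =
          v₀ i j * X P b i := by
        intro i
        by_cases hi : i ∈ N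
        · conv_rhs => rw [← hR (v₀ i j)]
          rw [euler_mul_X]
          simp only [u, hi, if_true, Int.cast_one, one_smul, add_mul, smul_mul_assoc]
          rw [show ((2 : ℤ) : ℂ) = 1 + 1 by norm_num, add_smul, one_smul]
          abel
        · simp [v₀, hi]
      -- Both sides solve the same equation for E + 1, which is injective.
      rw [← sub_eq_zero]
      refine eq_zero_of_euler_add hb hu (c := 1) one_pos ?_
      rw [Int.cast_one, map_sub, smul_sub, map_sum, Finset.smul_sum, sub_add_sub_comm, h2,
        ← Finset.sum_add_distrib, sub_eq_zero]
      exact Finset.sum_congr rfl fun i _ => (h3 i).symm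
    · simp [htN j hj, v₀, hj]
  · rw [← map_smul, ← map_neg]
    simp only [v₀, and_comm (a := j ∈ N)]
    split_ifs
    · rw [smul_sub, smul_smul, superSign_comm (par j), superSign_mul_self, one_smul, neg_sub]
    · simp
  · refine hRw _ _ ?_
    simp only [v₀]
    split_ifs
    · refine sub_mem ?_ (Submodule.smul_mem _ _ ?_)
      · rw [sub_right_comm]
        exact hdw i _ _ (ht j)
      · exact hdw j _ _ (ht i)
    · exact zero_mem _
  · have : v₀ i j = 0 := by
      simp only [v₀]
      rw [if_neg (by tauto)]
    simp only [this, map_zero]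

end SuperSym


/-! ### The associated graded of the Whittaker ideal -/

/-- Data for a finite W-superalgebra attached to an even good grading, in terms of a homogeneous
basis of the Lie superalgebra of supercommutators of a graded associative superalgebra. -/
structure IsWhittakerDatum {g I : Type} [AddCommGroup g] [Module ℂ g] [LieSuperalgebra g]
    (b : Module.Basis I ℂ g) (par : I → ZMod 2) (deg : I → ℤ) (mul : g →ₗ[ℂ] g →ₗ[ℂ] g)
    (χ : g →ₗ[ℂ] ℂ) (gr : ℤ → Submodule ℂ g) : Prop extends IsAssocGraded b par deg mul where
  gr_hom : IsHomogeneousBasis gr b deg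
  deg_ne : ∀ i, deg i ≠ -1
  apply_par : ∀ i, par i ≠ 0 → χ (b i) = 0
  apply_deg : ∀ i, deg i ≠ -2 → χ (b i) = 0

namespace IsWhittakerDatum

open IsAssocGraded

variable {g I : Type} [AddCommGroup g] [Module ℂ g] [LieSuperalgebra g]
  {b : Module.Basis I ℂ g} {par : I → ZMod 2} {deg : I → ℤ} {mul : g →ₗ[ℂ] g →ₗ[ℂ] g}
  {χ : g →ₗ[ℂ] ℂ} {gr : ℤ → Submodule ℂ g}

local notation "𝐒" => SuperSym (LieSuperalgebra.part (g := g))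
local notation "𝐱" => SuperSym.X (LieSuperalgebra.part (g := g)) b

variable (b χ) in
/-- The elements `a - χ(a)` of `U(g)` and `S(g)`. -/
noncomputable def shifted (i : I) : Env g × 𝐒 :=
  (Env.X b i - algebraMap ℂ _ (χ (b i)), 𝐱 i - algebraMap ℂ _ (χ (b i)))

theorem deg_le (h : IsWhittakerDatum b par deg mul χ gr) {i : I} (hi : deg i < 0) : deg i ≤ -2 := by
  have := h.deg_ne i
  omega

theorem shifted_mem (h : IsWhittakerDatum b par deg mul χ gr) (i : I) :
    shifted b χ i ∈ pairs g b (fun i => deg i + 2) (deg i + 2) := by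
  have e : shifted b χ i = (Env.X b i, 𝐱 i) - χ (b i) • (1 : Env g × 𝐒) := by
    ext <;> simp [shifted, Algebra.algebraMap_eq_smul_one]
  rw [e]
  refine sub_mem (letter_mem_wordSpan (f := fun i => (Env.X b i, 𝐱 i)) i) ?_
  by_cases hi : deg i = -2
  · rw [hi]
    exact Submodule.smul_mem _ _ one_mem_wordSpan
  · rw [h.apply_deg i hi, zero_smul]
    exact zero_mem _

/-- χ is even: either the sign is trivial or the value is zero. -/
theorem χ_smul_sign (h : IsWhittakerDatum b par deg mul χ gr) (i : I) (p : ZMod 2) :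
    χ (b i) * superSign (par i) p = χ (b i) := by
  by_cases hi : par i = 0
  · simp [hi]
  · simp [h.apply_par i hi]

/-- The subtracted constants are nonzero only for even vectors, so they are invisible in
supercommutators. -/
theorem shifted_mul_shifted (h : IsWhittakerDatum b par deg mul χ gr) (i j : I) :
    (shifted b χ i).1 * (shifted b χ j).1 -
      superSign (par i) (par j) • ((shifted b χ j).1 * (shifted b χ i).1) =
    Env.ι g (LieSuperalgebra.bracket (b i) (b j)) := by
  have e := Env.ι_mul_ι (h.hom.mem i) (h.hom.mem j)
  have h1 := h.χ_smul_sign i (par j)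
  have h2 := h.χ_smul_sign j (par i)
  rw [superSign_comm] at h2
  simp only [shifted, Env.X, Algebra.algebraMap_eq_smul_one]
  simp only [sub_mul, mul_sub, e, smul_sub, mul_smul_comm, smul_mul_assoc, mul_one, one_mul,
    smul_smul]
  rw [mul_comm (superSign (par i) (par j)) (χ (b j)), h2,
    mul_comm (superSign (par i) (par j)) (χ (b i)), h1,
    ← mul_assoc, mul_comm (superSign (par i) (par j)) (χ (b i)), h1, mul_comm (χ (b j)) (χ (b i))]
  abel

theorem X_shift_comm (h : IsWhittakerDatum b par deg mul χ gr) (c : ℂ) (i j : I) :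
    (𝐱 i + (c * χ (b i)) • 1) * (𝐱 j + (c * χ (b j)) • 1) =
      superSign (par i) (par j) • ((𝐱 j + (c * χ (b j)) • 1) * (𝐱 i + (c * χ (b i)) • 1)) := by
  have h1 := h.χ_smul_sign i (par j)
  have h2 := h.χ_smul_sign j (par i)
  rw [superSign_comm] at h2
  simp only [add_mul, mul_add, SuperSym.X_mul_X h.hom i j, smul_add, mul_smul_comm, smul_mul_assoc,
    mul_one, one_mul, smul_smul]
  have e1 : superSign (par i) (par j) * (c * χ (b j)) = c * χ (b j) := by
    linear_combination c * h2
  have e2 : superSign (par i) (par j) * (c * χ (b i)) = c * χ (b i) := by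
    linear_combination c * h1
  have e3 : superSign (par i) (par j) * (c * χ (b i) * (c * χ (b j))) =
      c * χ (b j) * (c * χ (b i)) := by
    linear_combination c * c * χ (b j) * h1
  simp only [e1, e2, e3]
  abel

/-- The automorphism `x ↦ x + c χ(x)` of `S(g)`. -/
noncomputable def shift (h : IsWhittakerDatum b par deg mul χ gr) (c : ℂ) : 𝐒 →ₐ[ℂ] 𝐒 :=
  SuperSym.liftBasis h.hom (fun i => 𝐱 i + (c * χ (b i)) • 1) (h.X_shift_comm c)

theorem shift_X (h : IsWhittakerDatum b par deg mul χ gr) (c : ℂ) (i : I) :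
    h.shift c (𝐱 i) = 𝐱 i + (c * χ (b i)) • 1 :=
  SuperSym.liftBasis_X _ _ _ _

theorem shift_shift (h : IsWhittakerDatum b par deg mul χ gr) (z : 𝐒) :
    h.shift (-1) (h.shift 1 z) = z := by
  have : (h.shift (-1)).comp (h.shift 1) = AlgHom.id ℂ 𝐒 := by
    refine SuperSym.algHom_ext b fun i => ?_
    simp [shift_X]
  exact DFunLike.congr_fun this z

theorem shift_mem (h : IsWhittakerDatum b par deg mul χ gr) (c : ℂ) {k : ℤ} {z : 𝐒}
    (hz : z ∈ wordSpan 𝐱 (fun i => deg i + 2) k) :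
    h.shift c z ∈ wordSpan 𝐱 (fun i => deg i + 2) k := by
  refine map_mem_wordSpan_of_letters _ (fun i => ?_) hz
  rw [shift_X]
  refine add_mem (letter_mem_wordSpan (f := 𝐱) i) ?_
  by_cases hi : deg i = -2
  · rw [hi]
    exact Submodule.smul_mem _ _ one_mem_wordSpan
  · rw [h.apply_deg i hi, mul_zero, zero_smul]
    exact zero_mem _

/-- Relations between the elements `a - χ(a)`, `a ∈ m`, of `S(g)`. -/
theorem koszul_shifted [Fintype I] (h : IsWhittakerDatum b par deg mul χ gr) (k : ℤ) (t : I → 𝐒)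
    (ht : ∀ i, t i ∈ wordSpan 𝐱 (fun i => deg i + 2) (k - (deg i + 2)))
    (htN : ∀ i, ¬ deg i < 0 → t i = 0) (h0 : ∑ i, t i * (shifted b χ i).2 = 0) :
    ∃ v : I → I → 𝐒, (∀ j, t j = ∑ i, v i j * (shifted b χ i).2) ∧
      (∀ i j, v i j = -(superSign (par i) (par j) • v j i)) ∧
      (∀ i j, v i j ∈ wordSpan 𝐱 (fun i => deg i + 2) (k - (deg i + 2) - (deg j + 2))) ∧
      ∀ i j, (¬ deg i < 0 ∨ ¬ deg j < 0) → v i j = 0 := by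
  have e1 : ∀ i, h.shift (-1) (𝐱 i) = (shifted b χ i).2 := fun i => by
    simp [shift_X, shifted, Algebra.algebraMap_eq_smul_one, sub_eq_add_neg]
  have e2 : ∀ i, h.shift 1 (shifted b χ i).2 = 𝐱 i := fun i => by
    simp [shift_X, shifted, Algebra.algebraMap_eq_smul_one]
  -- The translation automorphism carries the elements x - χ(x) to the generators x, where the
  -- Koszul statement applies with `N` the negative letters. It preserves Kazhdan degree because χ
  -- lives in degree -2, whose letters have weight 0.
  obtain ⟨v, hv1, hv2, hv3, hv4⟩ := SuperSym.koszul h.hom {i | deg i < 0} (fun i => deg i + 2) k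
    (fun i => h.shift 1 (t i)) (fun i => h.shift_mem 1 (ht i))
    (fun i hi => by rw [htN i hi, map_zero]) (by
      have := congrArg (h.shift 1) h0
      simpa [e2] using this)
  refine ⟨fun i j => h.shift (-1) (v i j), fun j => ?_, fun i j => ?_, fun i j => ?_,
    fun i j hij => ?_⟩
  · have := congrArg (h.shift (-1)) (hv1 j)
    simpa [shift_shift, e1] using this
  · exact (congrArg (h.shift (-1)) (hv2 i j)).trans (by simp)
  · exact h.shift_mem _ (hv3 i j)
  · simp only [hv4 i j hij, map_zero]

variable (b χ deg) in
/-- The part of the left ideal of `U(g)` generated by `a - χ(a)`, `a ∈ m`, that is visibly of degree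
at most `d`. -/
def idealFil (d : ℤ) : Submodule ℂ (Env g) :=
  Submodule.span ℂ {y | ∃ i, deg i < 0 ∧
    ∃ u ∈ wordFil (Env.X b) (fun i => deg i + 2) (d - (deg i + 2)), u * (shifted b χ i).1 = y}

theorem idealFil_mono {d e : ℤ} (hde : d ≤ e) : idealFil b deg χ d ≤ idealFil b deg χ e := by
  refine Submodule.span_mono ?_
  rintro _ ⟨i, hi, u, hu, rfl⟩
  exact ⟨i, hi, u, wordFil_mono (by omega) hu, rfl⟩

theorem shifted_fst_mem (h : IsWhittakerDatum b par deg mul χ gr) (i : I) :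
    (shifted b χ i).1 ∈ wordFil (Env.X b) (fun i => deg i + 2) (deg i + 2) :=
  wordSpan_le_wordFil le_rfl (pairs_fst_mem (h.shifted_mem i))

theorem idealFil_le (h : IsWhittakerDatum b par deg mul χ gr) (d : ℤ) :
    idealFil b deg χ d ≤ wordFil (Env.X b) (fun i => deg i + 2) d := by
  refine Submodule.span_le.2 ?_
  rintro _ ⟨i, hi, u, hu, rfl⟩
  have := mul_mem_wordFil hu (h.shifted_fst_mem i)
  rwa [sub_add_cancel] at this

theorem mul_mem_idealFil {d e : ℤ} {u y : Env g}
    (hu : u ∈ wordFil (Env.X b) (fun i => deg i + 2) e) (hy : y ∈ idealFil b deg χ d) :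
    u * y ∈ idealFil b deg χ (e + d) := by
  have : idealFil b deg χ d ≤ (idealFil b deg χ (e + d)).comap (LinearMap.mulLeft ℂ u) := by
    refine Submodule.span_le.2 ?_
    rintro _ ⟨i, hi, v, hv, rfl⟩
    refine Submodule.subset_span ⟨i, hi, u * v, ?_, by simp [mul_assoc]⟩
    have := mul_mem_wordFil hu hv
    rwa [← add_sub_assoc] at this
  exact this hy

theorem mSub_le (h : IsWhittakerDatum b par deg mul χ gr) {N : Submodule ℂ g}
    (hN : ∀ i, deg i < 0 → b i ∈ N) : mSub gr ⊥ ≤ N := by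
  refine sup_le (iSup_le fun j => iSup_le fun hj => ?_) bot_le
  exact h.gr_hom.induction fun i hi => hN i (by omega)

theorem mem_mSub (h : IsWhittakerDatum b par deg mul χ gr) {i : I} (hi : deg i < 0) :
    b i ∈ mSub gr ⊥ :=
  Submodule.mem_sup_left (Submodule.mem_iSup_of_mem (deg i) (Submodule.mem_iSup_of_mem
    (h.deg_le hi) (h.gr_hom.mem i)))

theorem shifted_mem_ideal (h : IsWhittakerDatum b par deg mul χ gr) {i : I} (hi : deg i < 0) :
    (shifted b χ i).1 ∈ whittakerIdeal χ gr ⊥ :=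
  Submodule.subset_span ⟨b i, h.mem_mSub hi, rfl⟩

/-- Every element of the ideal has some visible degree bound; `mem_idealFil` later improves it to
the Kazhdan degree of the element. -/
theorem exists_mem_idealFil (h : IsWhittakerDatum b par deg mul χ gr) {y : Env g}
    (hy : y ∈ whittakerIdeal χ gr ⊥) : ∃ d, y ∈ idealFil b deg χ d := by
  have hgen : ∀ a ∈ mSub gr ⊥, ∃ d, Env.ι g a - algebraMap ℂ (Env g) (χ a) ∈ idealFil b deg χ d := by
    intro a ha
    let N : Submodule ℂ g := (⨆ d, idealFil b deg χ d).comap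
      (Env.ι g - (Algebra.linearMap ℂ (Env g)) ∘ₗ χ)
    have hN : mSub gr ⊥ ≤ N := by
      refine h.mSub_le fun i hi => ?_
      refine Submodule.mem_iSup_of_mem (deg i + 2) (Submodule.subset_span ⟨i, hi, 1, ?_, ?_⟩)
      · rw [sub_self]
        exact wordSpan_le_wordFil le_rfl one_mem_wordSpan
      · simp [shifted, Env.X]
    have := hN ha
    rwa [Submodule.mem_comap, Submodule.mem_iSup_of_directed _
      (Monotone.directed_le fun _ _ => idealFil_mono)] at this
  refine Submodule.span_induction (p := fun y _ => ∃ d, y ∈ idealFil b deg χ d) ?_ ?_ ?_ ?_ hy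
  · rintro _ ⟨a, ha, rfl⟩
    exact hgen a ha
  · exact ⟨0, zero_mem _⟩
  · rintro x y - - ⟨d, hx⟩ ⟨e, hy⟩
    exact ⟨max d e, add_mem (idealFil_mono (le_max_left _ _) hx)
      (idealFil_mono (le_max_right _ _) hy)⟩
  · rintro u x - ⟨d, hx⟩
    obtain ⟨e, hu⟩ := exists_mem_wordFil (w := fun i => deg i + 2) (Env.adjoin_X b) u
    exact ⟨e + d, mul_mem_idealFil hu hx⟩

theorem exists_sum_of_mem_idealFil [Fintype I] {d : ℤ} {y : Env g}
    (hy : y ∈ idealFil b deg χ d) : ∃ u : I → Env g,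
      (∀ i, u i ∈ wordFil (Env.X b) (fun i => deg i + 2) (d - (deg i + 2))) ∧
      (∀ i, ¬ deg i < 0 → u i = 0) ∧ y = ∑ i, u i * (shifted b χ i).1 := by
  classical
  refine Submodule.span_induction (p := fun y _ => ∃ u : I → Env g,
      (∀ i, u i ∈ wordFil (Env.X b) (fun i => deg i + 2) (d - (deg i + 2))) ∧
      (∀ i, ¬ deg i < 0 → u i = 0) ∧ y = ∑ i, u i * (shifted b χ i).1) ?_ ?_ ?_ ?_ hy
  · rintro _ ⟨i, hi, u, hu, rfl⟩
    refine ⟨Pi.single i u, fun j => ?_, fun j hj => ?_, ?_⟩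
    · rcases eq_or_ne j i with rfl | hij
      · simpa using hu
      · rw [Pi.single_eq_of_ne hij]
        exact zero_mem _
    · rw [Pi.single_eq_of_ne]
      rintro rfl
      exact hj hi
    · rw [Finset.sum_eq_single i]
      · simp
      · intro j _ hj
        simp [hj]
      · simp
  · exact ⟨0, fun _ => zero_mem _, fun _ _ => rfl, by simp⟩
  · rintro x y - - ⟨u, h1, h2, rfl⟩ ⟨v, h1', h2', rfl⟩
    exact ⟨u + v, fun i => add_mem (h1 i) (h1' i), fun i hi => by simp [h2 i hi, h2' i hi],
      by simp [add_mul, Finset.sum_add_distrib]⟩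
  · rintro c x - ⟨u, h1, h2, rfl⟩
    exact ⟨c • u, fun i => Submodule.smul_mem _ _ (h1 i), fun i hi => by simp [h2 i hi],
      by simp [Finset.smul_sum]⟩

/-- Homogeneous leading coefficients of an element of the Whittaker ideal. -/
theorem exists_leading [Fintype I] {d : ℤ} {y : Env g}
    (hy : y ∈ idealFil b deg χ d) : ∃ q : I → Env g × 𝐒,
      (∀ i, q i ∈ pairs g b (fun i => deg i + 2) (d - (deg i + 2))) ∧
      (∀ i, ¬ deg i < 0 → q i = 0) ∧
      y - ∑ i, (q i).1 * (shifted b χ i).1 ∈ idealFil b deg χ (d - 1) := by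
  obtain ⟨u, hu, hu0, rfl⟩ := exists_sum_of_mem_idealFil hy
  have : ∀ i, ∃ q : Env g × 𝐒, q ∈ pairs g b (fun i => deg i + 2) (d - (deg i + 2)) ∧
      (¬ deg i < 0 → q = 0) ∧
      u i - q.1 ∈ wordFil (Env.X b) (fun i => deg i + 2) (d - (deg i + 2) - 1) := by
    intro i
    by_cases hi : deg i < 0
    · obtain ⟨u', hu', hsub⟩ := mem_wordFil_succ (hu i)
      obtain ⟨t, ht⟩ := exists_pair_left hu'
      exact ⟨(u', t), ht, fun h => absurd hi h, hsub⟩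
    · refine ⟨0, zero_mem _, fun _ => rfl, ?_⟩
      rw [hu0 i hi]
      simp
  choose q hq hq0 hsub using this
  refine ⟨q, hq, hq0, ?_⟩
  rw [← Finset.sum_sub_distrib]
  refine Submodule.sum_mem _ fun i _ => ?_
  by_cases hi : deg i < 0
  · rw [← sub_mul]
    refine Submodule.subset_span ⟨i, hi, _, ?_, rfl⟩
    rw [sub_right_comm]
    exact hsub i
  · rw [hq0 i hi, hu0 i hi]
    simp

theorem sum_leading_mem [Fintype I] (h : IsWhittakerDatum b par deg mul χ gr) {d : ℤ}
    {q : I → Env g × 𝐒} (hq : ∀ i, q i ∈ pairs g b (fun i => deg i + 2) (d - (deg i + 2))) :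
    ∑ i, q i * shifted b χ i ∈ pairs g b (fun i => deg i + 2) d := by
  refine Submodule.sum_mem _ fun i _ => ?_
  have := mul_mem_wordSpan (hq i) (h.shifted_mem i)
  rwa [sub_add_cancel] at this

/-- Since there is no degree -1, the bracket of two elements of m has degree at most -4. It lies
again in m, χ vanishes on it, and it has Kazhdan degree two less than the product. -/
theorem mul_bracket_mem_idealFil (h : IsWhittakerDatum b par deg mul χ gr) {i j : I}
    (hi : deg i < 0) (hj : deg j < 0) {d : ℤ} {u : Env g}
    (hu : u ∈ wordSpan (Env.X b) (fun i => deg i + 2) (d - (deg i + 2) - (deg j + 2))) :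
    u * Env.ι g (LieSuperalgebra.bracket (b i) (b j)) ∈ idealFil b deg χ (d - 1) := by
  have : Submodule.span ℂ (b '' {k | (par k, deg k) = (par i + par j, deg i + deg j)}) ≤
      (idealFil b deg χ (d - 1)).comap (LinearMap.mulLeft ℂ u ∘ₗ Env.ι g) := by
    rw [Submodule.span_le]
    rintro _ ⟨k, hk, rfl⟩
    have hk' : deg k = deg i + deg j := congrArg Prod.snd hk
    have h1 := h.deg_le hi
    have h2 := h.deg_le hj
    refine Submodule.subset_span ⟨k, by omega, u, wordSpan_le_wordFil (by omega) hu, ?_⟩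
    simp [shifted, h.apply_deg k (by omega), Env.X]
  exact this (h.bracket_mem i j)

/-- If the leading terms of an element ∑ q_j s_j of the ideal cancel, with s_j the shifted
generators, their coefficients form a Koszul cycle, hence equal ∑_i v_ij s_i with v superskew. For a
superskew lift u of v to U(g), the coefficients q_j - ∑ u_ij s_i are of lower degree, and ∑ u_ij s_i
s_j collapses to half the sum of u_ij [b_i, b_j], again of lower visible degree. -/
theorem idealFil_inf_le [Fintype I] (h : IsWhittakerDatum b par deg mul χ gr) {d : ℤ} {y : Env g}
    (hy : y ∈ idealFil b deg χ d)
    (hy' : y ∈ wordFil (Env.X b) (fun i => deg i + 2) (d - 1)) : y ∈ idealFil b deg χ (d - 1) := by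
  obtain ⟨q, hq, hq0, hsub⟩ := exists_leading hy
  have hsum := h.sum_leading_mem hq
  have h1 : (∑ i, q i * shifted b χ i).1 ∈ wordFil (Env.X b) (fun i => deg i + 2) (d - 1) := by
    have := sub_mem hy' (h.idealFil_le _ hsub)
    rw [sub_sub_cancel] at this
    rw [Prod.fst_sum]
    simpa using this
  have h2 : ∑ i, (q i).2 * (shifted b χ i).2 = 0 := by
    have : (∑ i, q i * shifted b χ i).2 = 0 := (h.mem_wordFil_iff hsum).1 h1
    rw [Prod.snd_sum] at this
    simpa using this
  obtain ⟨v, hv1, hv2, hv3, hv4⟩ := h.koszul_shifted d (fun i => (q i).2)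
    (fun i => pairs_snd_mem (hq i)) (fun i hi => by rw [hq0 i hi]; rfl) h2
  have hlift : ∀ i j, ∃ u, (u, v i j) ∈
      pairs g b (fun i => deg i + 2) (d - (deg i + 2) - (deg j + 2)) ∧
      ((¬ deg i < 0 ∨ ¬ deg j < 0) → u = 0) := by
    intro i j
    by_cases hij : ¬ deg i < 0 ∨ ¬ deg j < 0
    · refine ⟨0, ?_, fun _ => rfl⟩
      rw [hv4 i j hij]
      exact zero_mem _
    · obtain ⟨u, hu⟩ := exists_pair_right (hv3 i j)
      exact ⟨u, hu, fun h => absurd h hij⟩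
  choose u₀ hu₀ hu₀' using hlift
  -- Arbitrary lifts of v are antisymmetrised. This does not change their symbols, since v is
  -- already superskew.
  let u : I → I → Env g := fun i j =>
    (1 / 2 : ℂ) • (u₀ i j - superSign (par i) (par j) • u₀ j i)
  have hu : ∀ i j, (u i j, v i j) ∈
      pairs g b (fun i => deg i + 2) (d - (deg i + 2) - (deg j + 2)) := by
    intro i j
    have e : (u i j, v i j) = (1 / 2 : ℂ) • ((u₀ i j, v i j) -
        superSign (par i) (par j) • (u₀ j i, v j i)) := by
      ext
      · simp [u]
      · have : superSign (par i) (par j) • v j i = - v i j := by rw [hv2 i j, neg_neg]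
        simp [this, ← two_smul ℂ, smul_smul]
    rw [e]
    refine Submodule.smul_mem _ _ (sub_mem (hu₀ i j) (Submodule.smul_mem _ _ ?_))
    rw [sub_right_comm]
    exact hu₀ j i
  have hskew : ∀ i j, u i j = -(superSign (par i) (par j) • u j i) := by
    intro i j
    have e := superSign_mul_self (par i) (par j)
    simp only [u, superSign_comm (par j) (par i)]
    rw [← sub_eq_zero]
    simp only [smul_sub, smul_smul]
    have e' : superSign (par i) (par j) * (1 / 2 * superSign (par i) (par j)) = 1 / 2 := by
      linear_combination (1 / 2) * e
    rw [e', mul_comm (superSign (par i) (par j))]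
    abel
  have hu0 : ∀ i j, (¬ deg i < 0 ∨ ¬ deg j < 0) → u i j = 0 := by
    intro i j hij
    simp [u, hu₀' i j hij, hu₀' j i hij.symm]
  -- The symbol of this difference is zero by the Koszul formula, so Poincaré-Birkhoff-Witt lowers
  -- its degree.
  have h3 : ∀ j, (q j).1 - ∑ i, u i j * (shifted b χ i).1 ∈
      wordFil (Env.X b) (fun i => deg i + 2) (d - (deg j + 2) - 1) := by
    intro j
    refine (h.mem_wordFil_iff (t := (0 : 𝐒)) ?_).2 rfl
    have h4 : ∑ i, ((u i j, v i j) : Env g × 𝐒) * shifted b χ i ∈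
        pairs g b (fun i => deg i + 2) (d - (deg j + 2)) := by
      refine h.sum_leading_mem fun i => ?_
      rw [sub_right_comm]
      exact hu i j
    have h5 := sub_mem (hq j) h4
    have e : q j - ∑ i, ((u i j, v i j) : Env g × 𝐒) * shifted b χ i =
        ((q j).1 - ∑ i, u i j * (shifted b χ i).1, 0) := by
      ext
      · simp [Prod.fst_sum]
      · simp [Prod.snd_sum, hv1 j]
    rwa [e] at h5
  have h6 : ∑ j, ((q j).1 - ∑ i, u i j * (shifted b χ i).1) * (shifted b χ j).1 ∈
      idealFil b deg χ (d - 1) := by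
    refine Submodule.sum_mem _ fun j _ => ?_
    by_cases hj : deg j < 0
    · refine Submodule.subset_span ⟨j, hj, _, ?_, rfl⟩
      rw [sub_right_comm]
      exact h3 j
    · simp [hq0 j hj, hu0 _ j (Or.inr hj)]
  have h7 : ∑ j, (∑ i, u i j * (shifted b χ i).1) * (shifted b χ j).1 ∈
      idealFil b deg χ (d - 1) := by
    -- Swapping the summation indices and using skewness pairs each product with its signed
    -- transpose, leaving supercommutators.
    have e : ∑ j, (∑ i, u i j * (shifted b χ i).1) * (shifted b χ j).1 = (1 / 2 : ℂ) •
        ∑ j, ∑ i, u i j * Env.ι g (LieSuperalgebra.bracket (b i) (b j)) := by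
      have e1 : ∑ j, (∑ i, u i j * (shifted b χ i).1) * (shifted b χ j).1 =
          ∑ j, ∑ i, u i j * ((shifted b χ i).1 * (shifted b χ j).1) := by
        simp [Finset.sum_mul, mul_assoc]
      have e2 : ∑ j, ∑ i, u i j * ((shifted b χ i).1 * (shifted b χ j).1) =
          ∑ j, ∑ i, -(superSign (par i) (par j) •
            (u i j * ((shifted b χ j).1 * (shifted b χ i).1))) := by
        rw [Finset.sum_comm]
        refine Finset.sum_congr rfl fun i _ => Finset.sum_congr rfl fun j _ => ?_
        rw [hskew i j, superSign_comm]
        simp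
      have e3 : ∑ j, ∑ i, u i j * Env.ι g (LieSuperalgebra.bracket (b i) (b j)) =
          (2 : ℂ) • ∑ j, ∑ i, u i j * ((shifted b χ i).1 * (shifted b χ j).1) := by
        rw [two_smul]
        conv_rhs => arg 2; rw [e2]
        rw [← Finset.sum_add_distrib]
        refine Finset.sum_congr rfl fun j _ => ?_
        rw [← Finset.sum_add_distrib]
        refine Finset.sum_congr rfl fun i _ => ?_
        rw [← h.shifted_mul_shifted i j, mul_sub, mul_smul_comm, sub_eq_add_neg]
      rw [e1, e3, smul_smul]
      norm_num
    rw [e]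
    refine Submodule.smul_mem _ _ (Submodule.sum_mem _ fun j _ => Submodule.sum_mem _ fun i _ => ?_)
    by_cases hij : ¬ deg i < 0 ∨ ¬ deg j < 0
    · simp [hu0 i j hij]
    · push Not at hij
      exact h.mul_bracket_mem_idealFil hij.1 hij.2 (pairs_fst_mem (hu i j))
  have h8 := add_mem hsub (add_mem h6 h7)
  rw [← Finset.sum_add_distrib] at h8
  simpa [sub_mul] using h8

/-- The visible degree can be lowered one step at a time until it meets the actual degree. Hence the
symbols of the ideal are generated by the symbols of its generators. -/
theorem mem_idealFil [Fintype I] (h : IsWhittakerDatum b par deg mul χ gr) {k : ℤ} {y : Env g}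
    (hy : y ∈ whittakerIdeal χ gr ⊥) (hk : y ∈ wordFil (Env.X b) (fun i => deg i + 2) k) :
    y ∈ idealFil b deg χ k := by
  obtain ⟨d, hd⟩ := h.exists_mem_idealFil hy
  have : ∀ n : ℕ, y ∈ idealFil b deg χ (k + n) → y ∈ idealFil b deg χ k := by
    intro n
    induction n with
    | zero => simp
    | succ n ih =>
      intro hn
      refine ih ?_
      have := h.idealFil_inf_le hn (wordFil_mono (by omega) hk)
      rwa [Nat.cast_succ, ← add_assoc, add_sub_cancel_right] at this
  exact this (d - k).toNat (idealFil_mono (by omega) hd)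

end IsWhittakerDatum


/-! ### The associated graded of the Whittaker module -/

namespace IsWhittakerDatum

open IsAssocGraded

variable {g I : Type} [AddCommGroup g] [Module ℂ g] [LieSuperalgebra g]
  {b : Module.Basis I ℂ g} {par : I → ZMod 2} {deg : I → ℤ} {mul : g →ₗ[ℂ] g →ₗ[ℂ] g}
  {χ : g →ₗ[ℂ] ℂ} {gr : ℤ → Submodule ℂ g}

local notation "𝐒" => SuperSym (LieSuperalgebra.part (g := g))
local notation "𝐱" => SuperSym.X (LieSuperalgebra.part (g := g)) b

/-- The projection `S(g) → S(p)`, `p = ⨁_{j ≥ 0} g_j`, with `a ↦ χ(a)` for `a ∈ m`. -/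
noncomputable def proj (h : IsWhittakerDatum b par deg mul χ gr) : 𝐒 →ₐ[ℂ] 𝐒 :=
  SuperSym.liftBasis h.hom (fun i => if deg i < 0 then χ (b i) • 1 else 𝐱 i) fun i j => by
    have h1 := h.χ_smul_sign i (par j)
    have h2 := h.χ_smul_sign j (par i)
    rw [superSign_comm] at h2
    split_ifs
    · simp only [smul_mul_smul_comm, mul_one, smul_smul]
      congr 1
      linear_combination -χ (b j) * h1
    · simp only [smul_mul_assoc, one_mul, mul_smul_comm, mul_one, smul_smul]
      rw [mul_comm, h1]
    · simp only [smul_mul_assoc, one_mul, mul_smul_comm, mul_one, smul_smul]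
      rw [mul_comm, h2]
    · exact SuperSym.X_mul_X h.hom i j

theorem proj_X (h : IsWhittakerDatum b par deg mul χ gr) (i : I) :
    h.proj (𝐱 i) = if deg i < 0 then χ (b i) • 1 else 𝐱 i :=
  SuperSym.liftBasis_X _ _ _ _

theorem proj_shifted (h : IsWhittakerDatum b par deg mul χ gr) {i : I} (hi : deg i < 0) :
    h.proj (shifted b χ i).2 = 0 := by
  simp [shifted, proj_X, hi, Algebra.algebraMap_eq_smul_one]

variable (b χ deg) in
/-- Pairs of elements of the ideals of `U(g)` and `S(g)` generated by `a - χ(a)`, `a ∈ m`. -/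
noncomputable def idealPairs (k : ℤ) : Submodule ℂ (Env g × 𝐒) :=
  Submodule.span ℂ {q | ∃ i, deg i < 0 ∧
    ∃ p ∈ pairs g b (fun i => deg i + 2) (k - (deg i + 2)), p * shifted b χ i = q}

theorem idealPairs_le (h : IsWhittakerDatum b par deg mul χ gr) (k : ℤ) :
    idealPairs b deg χ k ≤ pairs g b (fun i => deg i + 2) k := by
  refine Submodule.span_le.2 ?_
  rintro _ ⟨i, hi, p, hp, rfl⟩
  have := mul_mem_wordSpan hp (h.shifted_mem i)
  rwa [sub_add_cancel] at this

theorem fst_mem_ideal (h : IsWhittakerDatum b par deg mul χ gr) {k : ℤ} {q : Env g × 𝐒}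
    (hq : q ∈ idealPairs b deg χ k) : q.1 ∈ whittakerIdeal χ gr ⊥ := by
  have : idealPairs b deg χ k ≤ ((whittakerIdeal χ gr ⊥).restrictScalars ℂ).comap
      (LinearMap.fst ℂ (Env g) 𝐒) := by
    refine Submodule.span_le.2 ?_
    rintro _ ⟨i, hi, p, -, rfl⟩
    exact Submodule.smul_mem _ p.1 (h.shifted_mem_ideal hi)
  exact this hq

theorem mul_mem_idealPairs {d e : ℤ} {p q : Env g × 𝐒}
    (hp : p ∈ pairs g b (fun i => deg i + 2) e) (hq : q ∈ idealPairs b deg χ d) :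
    p * q ∈ idealPairs b deg χ (e + d) := by
  have : idealPairs b deg χ d ≤ (idealPairs b deg χ (e + d)).comap (LinearMap.mulLeft ℂ p) := by
    refine Submodule.span_le.2 ?_
    rintro _ ⟨i, hi, v, hv, rfl⟩
    refine Submodule.subset_span ⟨i, hi, p * v, ?_, by simp [mul_assoc]⟩
    have := mul_mem_wordSpan hp hv
    rwa [← add_sub_assoc] at this
  exact this hq

/-- Negative letters are replaced by their χ-values one at a time. The error terms are recorded as
pairs, so that each comes with a representative in the left ideal of U(g). -/
theorem sub_proj_mem (h : IsWhittakerDatum b par deg mul χ gr) {k : ℤ} {t : 𝐒}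
    (ht : t ∈ wordSpan 𝐱 (fun i => deg i + 2) k) :
    t - h.proj t ∈ (idealPairs b deg χ k).map (LinearMap.snd ℂ (Env g) 𝐒) := by
  have : wordSpan 𝐱 (fun i => deg i + 2) k ≤ ((idealPairs b deg χ k).map
      (LinearMap.snd ℂ (Env g) 𝐒)).comap (LinearMap.id - h.proj.toLinearMap) := by
    clear ht
    refine wordSpan_le ?_
    rintro l rfl
    induction l with
    | nil => simp
    | cons i l ih =>
      obtain ⟨q, hq, hq2⟩ := ih
      simp only [LinearMap.snd_apply, LinearMap.sub_apply, LinearMap.id_apply,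
        AlgHom.toLinearMap_apply] at hq2
      simp only [List.map_cons, List.prod_cons, List.sum_cons, Submodule.mem_comap,
        LinearMap.sub_apply, LinearMap.id_apply, AlgHom.toLinearMap_apply, map_mul, proj_X]
      have hz : (l.map 𝐱).prod ∈ wordSpan 𝐱 par (l.map par).sum := word_mem l
      have hz' : (l.map 𝐱).prod ∈ wordSpan 𝐱 (fun i => deg i + 2)
        (l.map fun i => deg i + 2).sum := word_mem l
      set z := (l.map 𝐱).prod
      split_ifs with hi
      · obtain ⟨u, hu⟩ := exists_pair_right hz'
        -- The ideal of U(g) is a left ideal, so the negative letter is first moved to the right end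
        -- of the word. In S(g) this costs only a sign.
        have e : 𝐱 i * z - χ (b i) • 1 * h.proj z =
            superSign (l.map par).sum (par i) • (z * (shifted b χ i).2) + χ (b i) • q.2 := by
          have e1 := SuperSym.mul_X_of_mem h.hom hz i
          have e2 := h.χ_smul_sign i (l.map par).sum
          rw [superSign_comm] at e2
          simp only [shifted, Algebra.algebraMap_eq_smul_one, mul_sub, e1, hq2, smul_sub, smul_smul,
            superSign_mul_self, one_smul, mul_smul_comm, mul_one, smul_mul_assoc, one_mul]
          rw [mul_comm, e2]
          abel
        rw [e]
        refine add_mem (Submodule.smul_mem _ _ ⟨(u, z) * shifted b χ i,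
          Submodule.subset_span ⟨i, hi, _, ?_, rfl⟩, rfl⟩) ?_
        · rwa [add_sub_cancel_left]
        · by_cases hd : deg i = -2
          · refine Submodule.smul_mem _ _ ⟨q, ?_, rfl⟩
            simpa [hd] using hq
          · rw [h.apply_deg i hd, zero_smul]
            exact zero_mem _
      · rw [← mul_sub, ← hq2]
        exact ⟨(Env.X b i, 𝐱 i) * q, mul_mem_idealPairs
          (letter_mem_wordSpan (f := fun i => (Env.X b i, 𝐱 i)) (w := fun i => deg i + 2) i) hq, rfl⟩
  exact this ht

/-- An element of `U(g)` is of lower degree modulo the Whittaker ideal if and only if the projection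
of the corresponding element of `S(g)` is zero. -/
theorem exists_sub_mem_ideal_iff [Fintype I] (h : IsWhittakerDatum b par deg mul χ gr) {k : ℤ}
    {u : Env g} {t : 𝐒} (hq : (u, t) ∈ pairs g b (fun i => deg i + 2) k) :
    (∃ y ∈ wordFil (Env.X b) (fun i => deg i + 2) (k - 1), u - y ∈ whittakerIdeal χ gr ⊥) ↔
      h.proj t = 0 := by
  constructor
  · rintro ⟨y, hy, huy⟩
    have h1 := h.mem_idealFil huy (sub_mem (wordSpan_le_wordFil le_rfl (pairs_fst_mem hq))
      (wordFil_mono (by omega) hy))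
    obtain ⟨q, hqm, hq0, hsub⟩ := exists_leading h1
    have h2 := h.sum_leading_mem hqm
    have h3 : u - (∑ i, q i * shifted b χ i).1 ∈
        wordFil (Env.X b) (fun i => deg i + 2) (k - 1) := by
      have := add_mem hy (h.idealFil_le _ hsub)
      rw [Prod.fst_sum]
      convert this using 1
      simp only [Prod.fst_mul]
      abel
    have h4 := (h.mem_wordFil_iff (u := u - (∑ i, q i * shifted b χ i).1)
      (t := t - (∑ i, q i * shifted b χ i).2) (sub_mem hq h2)).1 h3
    rw [sub_eq_zero.1 h4, Prod.snd_sum, map_sum]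
    refine Finset.sum_eq_zero fun i _ => ?_
    by_cases hi : deg i < 0
    · rw [Prod.snd_mul, map_mul, h.proj_shifted hi, mul_zero]
    · simp [hq0 i hi]
  · intro h0
    obtain ⟨q, hqm, hq2⟩ := h.sub_proj_mem (pairs_snd_mem hq)
    rw [h0, sub_zero] at hq2
    have h1 := sub_mem hq (h.idealPairs_le k hqm)
    have h2 : (u, t) - q = (u - q.1, (0 : 𝐒)) := by
      ext
      · rfl
      · simpa [sub_eq_zero] using hq2.symm
    rw [h2] at h1
    refine ⟨u - q.1, (h.mem_wordFil_iff h1).2 rfl, ?_⟩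
    rw [sub_sub_cancel]
    exact h.fst_mem_ideal hqm

/-! ### Parity -/

/-- The automorphism of `S(g)` multiplying the elements of parity `q` by `(-1)^{pq}`. -/
noncomputable def parSym (h : IsWhittakerDatum b par deg mul χ gr) (p : ZMod 2) : 𝐒 →ₐ[ℂ] 𝐒 :=
  SuperSym.liftBasis h.hom (fun i => superSign p (par i) • 𝐱 i) fun i j => by
    simp only [smul_mul_smul_comm, SuperSym.X_mul_X h.hom i j]
    rw [smul_comm, mul_comm]

theorem parSym_X (h : IsWhittakerDatum b par deg mul χ gr) (p : ZMod 2) (i : I) :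
    h.parSym p (𝐱 i) = superSign p (par i) • 𝐱 i :=
  SuperSym.liftBasis_X _ _ _ _

/-- The automorphism of `U(g)` multiplying the elements of parity `q` by `(-1)^{pq}`. -/
noncomputable def parEnv (h : IsWhittakerDatum b par deg mul χ gr) (p : ZMod 2) :
    Env g →ₐ[ℂ] Env g :=
  Env.liftBasis h.hom (b.constr ℂ fun i => superSign p (par i) • Env.X b i) fun i j => by
    have : Submodule.span ℂ (b '' {k | (par k, deg k) = (par i + par j, deg i + deg j)}) ≤
        LinearMap.eqLocus (b.constr ℂ fun i => superSign p (par i) • Env.X b i)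
          (superSign p (par i + par j) • Env.ι g) := by
      rw [Submodule.span_le]
      rintro _ ⟨k, hk, rfl⟩
      have hk' : par k = par i + par j := congrArg Prod.fst hk
      simp [LinearMap.mem_eqLocus, hk', Env.X]
    rw [LinearMap.mem_eqLocus.1 (this (h.bracket_mem i j))]
    simp only [Module.Basis.constr_basis, smul_mul_smul_comm, LinearMap.smul_apply]
    rw [Env.X, Env.X, Env.ι_mul_ι (h.hom.mem i) (h.hom.mem j), smul_add, smul_comm,
      superSign_add_right, mul_comm (superSign p (par j))]

theorem parEnv_X (h : IsWhittakerDatum b par deg mul χ gr) (p : ZMod 2) (i : I) :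
    h.parEnv p (Env.X b i) = superSign p (par i) • Env.X b i := by
  rw [Env.X, parEnv, Env.liftBasis_ι]
  simp [Env.X]

theorem par_mem_pairs (h : IsWhittakerDatum b par deg mul χ gr) (p : ZMod 2) {M : Type} [AddMonoid M]
    {w : I → M} {k : M} {q : Env g × 𝐒} (hq : q ∈ pairs g b w k) :
    (h.parEnv p q.1, h.parSym p q.2) ∈ pairs g b w k := by
  refine map_mem_wordSpan_of_letters ((h.parEnv p).prodMap (h.parSym p)) (fun i => ?_) hq
  have : (h.parEnv p).prodMap (h.parSym p) (Env.X b i, 𝐱 i) =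
      superSign p (par i) • (Env.X b i, 𝐱 i) := by
    ext
    · exact h.parEnv_X p i
    · exact h.parSym_X p i
  rw [this]
  exact Submodule.smul_mem _ _ (letter_mem_wordSpan (f := fun i => (Env.X b i, 𝐱 i)) i)

theorem parEnv_shifted (h : IsWhittakerDatum b par deg mul χ gr) (p : ZMod 2) (i : I) :
    h.parEnv p (shifted b χ i).1 = superSign p (par i) • (shifted b χ i).1 := by
  have e := h.χ_smul_sign i p
  rw [superSign_comm] at e
  simp only [shifted, map_sub, parEnv_X, Algebra.algebraMap_eq_smul_one, map_smul, map_one, smul_sub,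
    smul_smul]
  rw [mul_comm, e]

theorem parEnv_mem_ideal (h : IsWhittakerDatum b par deg mul χ gr) (p : ZMod 2) {y : Env g}
    (hy : y ∈ whittakerIdeal χ gr ⊥) : h.parEnv p y ∈ whittakerIdeal χ gr ⊥ := by
  obtain ⟨d, hd⟩ := h.exists_mem_idealFil hy
  have : idealFil b deg χ d ≤ ((whittakerIdeal χ gr ⊥).restrictScalars ℂ).comap
      (h.parEnv p).toLinearMap := by
    refine Submodule.span_le.2 ?_
    rintro _ ⟨i, hi, u, -, rfl⟩
    simp only [Submodule.comap_coe, Set.mem_preimage, AlgHom.toLinearMap_apply, map_mul,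
      parEnv_shifted, mul_smul_comm]
    exact Submodule.smul_mem _ _ (Submodule.smul_mem _ (h.parEnv p u) (h.shifted_mem_ideal hi))
  exact this hd

theorem parEnv_apply (h : IsWhittakerDatum b par deg mul χ gr) (p q : ZMod 2) {y : Env g}
    (hy : y ∈ wordSpan (Env.X b) par q) : h.parEnv p y = superSign p q • y := by
  have : wordSpan (Env.X b) par q ≤
      LinearMap.eqLocus (h.parEnv p).toLinearMap (superSign p q • LinearMap.id) := by
    clear hy
    refine wordSpan_le ?_
    rintro l rfl
    induction l with
    | nil => simp
    | cons i l ih =>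
      simp only [LinearMap.mem_eqLocus, AlgHom.toLinearMap_apply, LinearMap.smul_apply,
        LinearMap.id_apply] at ih
      simp [ih, parEnv_X, superSign_add_right, smul_smul, mul_comm]
  exact this hy

/-! ### The adjoint action -/

/-- The superderivation `x ↦ [x, b_i]` of `S(g)`. -/
noncomputable def adSym (h : IsWhittakerDatum b par deg mul χ gr) (i : I) : 𝐒 →ₗ[ℂ] 𝐒 :=
  SuperSym.superDer h.hom (par i) (fun j => SuperSym.ι _ (LieSuperalgebra.bracket (b j) (b i)))
    fun j => by
      rw [add_comm]
      refine map_mem_wordSpan_of_mem_span _ b par (Submodule.span_mono (Set.image_mono ?_)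
        (h.bracket_mem j i))
      exact fun k hk => congrArg Prod.fst hk

theorem adSym_mul_X (h : IsWhittakerDatum b par deg mul χ gr) (i j : I) (z : 𝐒) :
    h.adSym i (z * 𝐱 j) = z * SuperSym.ι _ (LieSuperalgebra.bracket (b j) (b i)) +
      superSign (par i) (par j) • (h.adSym i z * 𝐱 j) :=
  SuperSym.superDer_mul_X _ _ _ _ _ _

/-- The superderivation `x ↦ [x, b_i]` of `U(g)`. -/
noncomputable def adEnv (h : IsWhittakerDatum b par deg mul χ gr) (i : I) : Env g →ₗ[ℂ] Env g :=
  LinearMap.mulRight ℂ (Env.X b i) - LinearMap.mulLeft ℂ (Env.X b i) ∘ₗ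
    (h.parEnv (par i)).toLinearMap

theorem adEnv_mul_X (h : IsWhittakerDatum b par deg mul χ gr) (i j : I) (u : Env g) :
    h.adEnv i (u * Env.X b j) = u * Env.ι g (LieSuperalgebra.bracket (b j) (b i)) +
      superSign (par i) (par j) • (h.adEnv i u * Env.X b j) := by
  have e := Env.ι_mul_ι (h.hom.mem j) (h.hom.mem i)
  simp only [adEnv, LinearMap.sub_apply, LinearMap.mulRight_apply, LinearMap.comp_apply,
    LinearMap.mulLeft_apply, AlgHom.toLinearMap_apply, map_mul, parEnv_X, mul_assoc, sub_mul,
    smul_sub, mul_smul_comm]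
  rw [Env.X, Env.X, e, superSign_comm, mul_add, mul_smul_comm]
  abel

/-- The two superderivations obey the same Leibniz rule with the same values on generators, so they
carry corresponding words to corresponding combinations of words. -/
theorem ad_mem_pairs (h : IsWhittakerDatum b par deg mul χ gr) (i : I) {k : ℤ} {q : Env g × 𝐒}
    (hq : q ∈ pairs g b (fun i => deg i + 2) k) :
    (h.adEnv i q.1, h.adSym i q.2) ∈ pairs g b (fun i => deg i + 2) (k + deg i) := by
  have : pairs g b (fun i => deg i + 2) k ≤ (pairs g b (fun i => deg i + 2) (k + deg i)).comap
      ((h.adEnv i).prodMap (h.adSym i)) := by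
    clear hq
    refine wordSpan_le ?_
    rintro l rfl
    induction l using List.reverseRecOn with
    | nil =>
      have : (h.adEnv i).prodMap (h.adSym i) 1 = 0 := by
        ext <;> simp [adEnv, adSym]
      simp [this]
    | append_singleton l j ih =>
      have hl := word_mem (f := fun i => (Env.X b i, 𝐱 i)) (w := fun i => deg i + 2) l
      rw [Submodule.mem_comap] at ih ⊢
      simp only [List.map_append, List.map_cons, List.map_nil, List.prod_append, List.prod_cons,
        List.prod_nil, mul_one, List.sum_append, List.sum_cons, List.sum_nil, add_zero]
      set u := (List.map (fun i => (Env.X b i, 𝐱 i)) l).prod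
      have e : (h.adEnv i).prodMap (h.adSym i) (u * (Env.X b j, 𝐱 j)) =
          u * ((Env.ι g).prod (SuperSym.ι _) (LieSuperalgebra.bracket (b j) (b i))) +
          superSign (par i) (par j) •
            ((h.adEnv i).prodMap (h.adSym i) u * (Env.X b j, 𝐱 j)) := by
        ext
        · exact h.adEnv_mul_X i j u.1
        · exact h.adSym_mul_X i j u.2
      rw [e]
      refine add_mem ?_ (Submodule.smul_mem _ _ ?_)
      · have h1 : (Env.ι g).prod (SuperSym.ι _) (LieSuperalgebra.bracket (b j) (b i)) ∈
            pairs g b (fun i => deg i + 2) (deg j + deg i + 2) := by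
          refine map_mem_wordSpan_of_mem_span ((Env.ι g).prod (SuperSym.ι _)) b _
            (Submodule.span_mono (Set.image_mono ?_) (h.bracket_mem j i))
          intro k hk
          have : deg k = deg j + deg i := congrArg Prod.snd hk
          simp [this]
        have := mul_mem_wordSpan hl h1
        convert this using 2
        ring
      · have := mul_mem_wordSpan ih
          (letter_mem_wordSpan (f := fun i => (Env.X b i, 𝐱 i)) (w := fun i => deg i + 2) j)
        convert this using 2
        ring
  exact this hq

/-- y (b_i - χ(b_i)) is always in the left ideal and the opposite product is in it by hypothesis.
Their supercommutator is `adEnv i y`; the twist by the parity automorphism does not affect the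
constants, as χ(b_i) = 0 for odd b_i. -/
theorem adEnv_mem_ideal (h : IsWhittakerDatum b par deg mul χ gr) {i : I} (hi : deg i < 0)
    {y : Env g} (hy : (shifted b χ i).1 * y ∈ whittakerIdeal χ gr ⊥) :
    h.adEnv i y ∈ whittakerIdeal χ gr ⊥ := by
  have h1 := h.parEnv_mem_ideal (par i) hy
  rw [map_mul, parEnv_shifted, smul_mul_assoc] at h1
  have h2 : (shifted b χ i).1 * h.parEnv (par i) y ∈ whittakerIdeal χ gr ⊥ := by
    have := Submodule.smul_of_tower_mem (whittakerIdeal χ gr ⊥) (superSign (par i) (par i)) h1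
    rwa [smul_smul, superSign_mul_self, one_smul] at this
  have h3 : y * (shifted b χ i).1 ∈ whittakerIdeal χ gr ⊥ :=
    Submodule.smul_mem _ y (h.shifted_mem_ideal hi)
  -- For even b_i the parity twist is the identity, and for odd b_i the scalar is zero.
  have h4 : χ (b i) • h.parEnv (par i) y = χ (b i) • y := by
    by_cases hp : par i = 0
    · have : h.parEnv (par i) = AlgHom.id ℂ _ := by
        refine AlgHom.ext_of_adjoin_eq_top (Env.adjoin_X b) ?_
        rintro _ ⟨j, rfl⟩
        simp [parEnv_X, hp]
      rw [this]
      rfl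
    · simp [h.apply_par i hp]
  have h5 := sub_mem h3 h2
  have e : h.adEnv i y = y * (shifted b χ i).1 - (shifted b χ i).1 * h.parEnv (par i) y := by
    simp only [adEnv, shifted, Algebra.algebraMap_eq_smul_one, LinearMap.sub_apply,
      LinearMap.mulRight_apply, LinearMap.comp_apply, LinearMap.mulLeft_apply,
      AlgHom.toLinearMap_apply, mul_sub, sub_mul, mul_smul_comm, smul_mul_assoc, mul_one, one_mul, h4]
    abel
  rwa [e]

end IsWhittakerDatum


/-! ### Invariants -/

/-- A graded projection of `g` onto `g^χ` that kills `m`, with an explicit complement of `g^χ` in the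
nonnegative part. -/
structure IsSlice {g I : Type} [AddCommGroup g] [Module ℂ g] [LieSuperalgebra g]
    (b : Module.Basis I ℂ g) (par : I → ZMod 2) (deg : I → ℤ) (χ : g →ₗ[ℂ] ℂ) [Fintype I]
    (pV : g →ₗ[ℂ] annihilator χ) (c : I → g) : Prop where
  proj_neg : ∀ i, deg i < 0 → pV (b i) = 0
  proj_id : ∀ v : annihilator χ, pV v = v
  proj_mem : ∀ i, (pV (b i) : g) ∈ LieSuperalgebra.part (g := g) (par i)
  slice_mem : ∀ i, c i ∈ LieSuperalgebra.part (g := g) (par i)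
  slice_eq : ∀ i, ¬ deg i < 0 → c i = 0
  decomp : ∀ j, ¬ deg j < 0 →
    b j = (pV (b j) : g) + ∑ i, χ (LieSuperalgebra.bracket (b j) (b i)) • c i

namespace IsSlice

open IsAssocGraded IsWhittakerDatum

variable {g I : Type} [AddCommGroup g] [Module ℂ g] [LieSuperalgebra g]
  {b : Module.Basis I ℂ g} {par : I → ZMod 2} {deg : I → ℤ} {mul : g →ₗ[ℂ] g →ₗ[ℂ] g}
  {χ : g →ₗ[ℂ] ℂ} {gr : ℤ → Submodule ℂ g} {pV : g →ₗ[ℂ] annihilator χ} {c : I → g}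

local notation "𝐒" => SuperSym (LieSuperalgebra.part (g := g))
local notation "𝐱" => SuperSym.X (LieSuperalgebra.part (g := g)) b

theorem ι_mem_wordSpan_par (h : IsWhittakerDatum b par deg mul χ gr) {p : ZMod 2} {x : g}
    (hx : x ∈ LieSuperalgebra.part (g := g) p) :
    SuperSym.ι LieSuperalgebra.part x ∈ wordSpan 𝐱 par p := by
  rw [h.hom] at hx
  exact map_mem_wordSpan_of_mem_span _ b par hx

theorem ι_mem_wordSpan_one (x : g) :
    SuperSym.ι LieSuperalgebra.part x ∈ wordSpan 𝐱 (fun _ => (1 : ℤ)) 1 := by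
  refine map_mem_wordSpan_of_mem_span _ b _ ?_
  simp [Set.image_univ, b.span_eq]

section

variable [Fintype I]

/-- The algebra map `S(g) → S(g)` extending `pV`. -/
noncomputable def rho (s : IsSlice b par deg χ pV c) (h : IsWhittakerDatum b par deg mul χ gr) :
    𝐒 →ₐ[ℂ] 𝐒 :=
  SuperSym.liftBasis h.hom (fun i => SuperSym.ι _ (pV (b i) : g)) fun i j =>
    SuperSym.ι_mul_ι (s.proj_mem i) (s.proj_mem j)

theorem rho_ι (s : IsSlice b par deg χ pV c) (h : IsWhittakerDatum b par deg mul χ gr) (x : g) :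
    s.rho h (SuperSym.ι _ x) = SuperSym.ι _ (pV x : g) := by
  have : (s.rho h).toLinearMap ∘ₗ SuperSym.ι _ =
      SuperSym.ι _ ∘ₗ (annihilator χ).subtype ∘ₗ pV := by
    refine b.ext fun i => ?_
    exact SuperSym.liftBasis_X _ _ _ _
  exact LinearMap.congr_fun this x

/-- The derivation of `S(g)` extending `1 - pV`. -/
noncomputable def compl (s : IsSlice b par deg χ pV c)
    (h : IsWhittakerDatum b par deg mul χ gr) : 𝐒 →ₗ[ℂ] 𝐒 :=
  SuperSym.superDer h.hom 0 (fun i => SuperSym.ι _ (b i - pV (b i))) fun i => by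
    rw [zero_add]
    exact ι_mem_wordSpan_par h (sub_mem (h.hom.mem i) (s.proj_mem i))

theorem compl_mul_X (s : IsSlice b par deg χ pV c) (h : IsWhittakerDatum b par deg mul χ gr)
    (i : I) (z : 𝐒) : s.compl h (z * 𝐱 i) =
      z * SuperSym.ι _ (b i - pV (b i)) + s.compl h z * 𝐱 i := by
  refine (SuperSym.superDer_mul_X _ _ _ _ _ _).trans ?_
  rw [superSign_zero_left, one_smul]
  rfl

theorem compl_ι (s : IsSlice b par deg χ pV c) (h : IsWhittakerDatum b par deg mul χ gr) (x : g) :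
    s.compl h (SuperSym.ι _ x) = SuperSym.ι _ (x - pV x) := by
  have : (s.compl h) ∘ₗ SuperSym.ι _ =
      SuperSym.ι _ ∘ₗ (LinearMap.id - (annihilator χ).subtype ∘ₗ pV) := by
    refine b.ext fun i => ?_
    exact SuperSym.superDer_X _ _ _ _ i
  exact LinearMap.congr_fun this x

theorem proj_sub_proj (s : IsSlice b par deg χ pV c) (x : g) : pV (x - pV x) = 0 := by
  rw [map_sub, s.proj_id, sub_self]

/-- Each application of the derivation `compl` puts in a factor from the kernel of `pV`. -/
theorem rho_compl (s : IsSlice b par deg χ pV c) (h : IsWhittakerDatum b par deg mul χ gr) (z : 𝐒) :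
    s.rho h (s.compl h z) = 0 := by
  refine LinearMap.congr_fun (SuperSym.linearMap_ext_right b
    (f := (s.rho h).toLinearMap ∘ₗ s.compl h) (g := 0) (by simp [compl]) fun i z hz => ?_) z
  simp only [LinearMap.comp_apply, AlgHom.toLinearMap_apply, LinearMap.zero_apply] at hz ⊢
  rw [compl_mul_X, map_add, map_mul, map_mul, hz, rho_ι,
    s.proj_sub_proj]
  simp

/-- `compl` counts the letters from the kernel of `pV`, and `rho` projects onto the words without
such letters. If the sum kills z, both summands do. Then z has eigenvalue 0 for `compl`, while z = z
- `rho` z lies in the sum of the nonzero eigenspaces. -/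
theorem eq_zero_of_rho_add_compl (s : IsSlice b par deg χ pV c)
    (h : IsWhittakerDatum b par deg mul χ gr) {z : 𝐒} (hz : s.rho h z + s.compl h z = 0) :
    z = 0 := by
  have hrho2 : ∀ z, s.rho h (s.rho h z) = s.rho h z := by
    intro z
    have : (s.rho h).comp (s.rho h) = s.rho h := by
      refine SuperSym.algHom_ext b fun i => ?_
      simp [SuperSym.X, rho_ι, s.proj_id]
    exact DFunLike.congr_fun this z
  have h1 : s.rho h z = 0 := by
    have := congrArg (s.rho h) hz
    rwa [map_add, rho_compl, add_zero, hrho2, map_zero] at this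
  have h2 : s.compl h z = 0 := by rwa [h1, zero_add] at hz
  -- New generators: each basis vector is split into its component in g^χ (weight 0) and its
  -- component in the kernel of `pV` (weight 1).
  let u : I × Bool → 𝐒 := fun i =>
    if i.2 then SuperSym.ι _ (b i.1 - pV (b i.1)) else SuperSym.ι _ (pV (b i.1) : g)
  let w : I × Bool → ℤ := fun i => if i.2 then 1 else 0
  have hu : ∀ j, s.compl h (u j) = (w j : ℂ) • u j := by
    rintro ⟨i, _ | _⟩
    · simp [u, w, compl_ι, s.proj_id]
    · simp only [u, w, if_true, compl_ι, s.proj_sub_proj]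
      simp
  have hadj : Algebra.adjoin ℂ (Set.range u) = ⊤ := by
    rw [eq_top_iff, ← SuperSym.adjoin_X b, Algebra.adjoin_le_iff]
    rintro _ ⟨i, rfl⟩
    have e : 𝐱 i = u (i, true) + u (i, false) := by
      simp [u, SuperSym.X]
    rw [e]
    exact add_mem (Algebra.subset_adjoin ⟨_, rfl⟩) (Algebra.subset_adjoin ⟨_, rfl⟩)
  have hmain : (⊤ : Submodule ℂ 𝐒) ≤ (⨆ m, ⨆ _ : m ≠ 0,
      Module.End.eigenspace (s.compl h) m).comap (LinearMap.id - (s.rho h).toLinearMap) := by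
    rw [← iSup_wordSpan (w := w) hadj]
    refine iSup_le fun m => ?_
    have hm0 := SuperSym.wordSpan_le_eigenspace h.hom _ _ hu m
    by_cases hm : m = 0
    · subst hm
      refine wordSpan_le fun l hl => ?_
      have hlet : ∀ j ∈ l, w j = 0 := by
        intro j hj
        have hnn : ∀ x ∈ l.map w, 0 ≤ x := by
          intro x hx
          obtain ⟨j, -, rfl⟩ := List.mem_map.1 hx
          simp only [w]
          split_ifs <;> simp
        have h1 := List.single_le_sum hnn (w j) (List.mem_map_of_mem hj)
        have h2 := hnn _ (List.mem_map_of_mem hj)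
        omega
      have : s.rho h (l.map u).prod = (l.map u).prod := by
        rw [map_list_prod, List.map_map]
        congr 1
        refine List.map_congr_left fun j hj => ?_
        have := hlet j hj
        rcases j with ⟨i, _ | _⟩
        · simp [u, rho_ι, s.proj_id]
        · simp [w] at this
      simp [this]
    · intro y hy
      have : s.rho h y = 0 := by
        have hle : wordSpan u w m ≤ LinearMap.ker (s.rho h).toLinearMap := by
          refine wordSpan_le fun l hl => ?_
          have : ∃ j ∈ l, w j ≠ 0 := by
            by_contra! hcon
            refine hm (hl ▸ List.sum_eq_zero fun x hx => ?_)
            obtain ⟨j, hj, rfl⟩ := List.mem_map.1 hx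
            exact hcon j hj
          obtain ⟨j, hj, hj0⟩ := this
          rw [LinearMap.mem_ker, AlgHom.toLinearMap_apply, map_list_prod]
          refine List.prod_eq_zero (List.mem_map.2 ⟨u j, List.mem_map_of_mem hj, ?_⟩)
          rcases j with ⟨i, _ | _⟩
          · simp [w] at hj0
          · simp only [u, if_true, rho_ι, s.proj_sub_proj]
            simp
        exact hle hy
      have e : (LinearMap.id - (s.rho h).toLinearMap : 𝐒 →ₗ[ℂ] 𝐒) y = y := by simp [this]
      rw [Submodule.mem_comap, e]
      exact Submodule.mem_iSup_of_mem (m : ℂ) (Submodule.mem_iSup_of_mem (by exact_mod_cast hm)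
        (hm0 hy))
  have h3 := hmain (Submodule.mem_top (x := z))
  rw [Submodule.mem_comap] at h3
  simp only [LinearMap.sub_apply, LinearMap.id_apply, AlgHom.toLinearMap_apply, h1, sub_zero] at h3
  refine Submodule.disjoint_def.1 (Module.End.eigenspaces_iSupIndep (s.compl h) 0) z ?_ h3
  rw [Module.End.mem_eigenspace_iff, h2, zero_smul]

end

/-! ### The action of m on S(p) -/

variable (b deg) in
/-- The projection of `g` onto its nonnegative part. -/
noncomputable def nonneg : g →ₗ[ℂ] g := b.constr ℂ fun i => if deg i < 0 then 0 else b i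

theorem nonneg_basis (i : I) : nonneg b deg (b i) = if deg i < 0 then 0 else b i :=
  b.constr_basis ℂ _ _

theorem proj_ι (h : IsWhittakerDatum b par deg mul χ gr) (x : g) :
    h.proj (SuperSym.ι _ x) = χ x • 1 + SuperSym.ι _ (nonneg b deg x) := by
  have : h.proj.toLinearMap ∘ₗ SuperSym.ι _ =
      χ.smulRight 1 + SuperSym.ι _ ∘ₗ nonneg b deg := by
    refine b.ext fun i => ?_
    refine (h.proj_X i).trans ?_
    split_ifs with hi
    · simp [nonneg_basis, hi]
    · simp [nonneg_basis, hi, h.apply_deg i (by omega), SuperSym.X]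
  exact LinearMap.congr_fun this x

theorem nonneg_mem (h : IsWhittakerDatum b par deg mul χ gr) {p : ZMod 2} {x : g}
    (hx : x ∈ LieSuperalgebra.part (g := g) p) :
    nonneg b deg x ∈ LieSuperalgebra.part (g := g) p := by
  have : LieSuperalgebra.part (g := g) p ≤
      (LieSuperalgebra.part (g := g) p).comap (nonneg b deg) := by
    refine h.hom.induction fun i hi => ?_
    simp only [nonneg_basis, Submodule.mem_comap]
    split_ifs
    · exact zero_mem _
    · exact hi ▸ h.hom.mem i
  exact this hx

theorem apply_smul_one_mem (h : IsWhittakerDatum b par deg mul χ gr) {p : ZMod 2} {x : g}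
    (hx : x ∈ LieSuperalgebra.part (g := g) p) : χ x • (1 : 𝐒) ∈ wordSpan 𝐱 par p := by
  by_cases hp : p = 0
  · subst hp
    exact Submodule.smul_mem _ _ one_mem_wordSpan
  · have : LieSuperalgebra.part (g := g) p ≤ LinearMap.ker χ := by
      refine h.hom.induction fun i hi => ?_
      exact h.apply_par i (by rwa [hi])
    rw [LinearMap.mem_ker.1 (this hx), zero_smul]
    exact zero_mem _

/-- The constant part of the action of `b_i` on `S(p)`. -/
noncomputable def adConst (h : IsWhittakerDatum b par deg mul χ gr) (i : I) : 𝐒 →ₗ[ℂ] 𝐒 :=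
  SuperSym.superDer h.hom (par i) (fun j => χ (LieSuperalgebra.bracket (b j) (b i)) • 1) fun j =>
    apply_smul_one_mem h (by
      rw [add_comm]
      exact LieSuperalgebra.bracket_mem _ _ _ _ (h.hom.mem j) (h.hom.mem i))

/-- The linear part of the action of `b_i` on `S(p)`. -/
noncomputable def adLin (h : IsWhittakerDatum b par deg mul χ gr) (i : I) : 𝐒 →ₗ[ℂ] 𝐒 :=
  SuperSym.superDer h.hom (par i)
    (fun j => SuperSym.ι _ (nonneg b deg (LieSuperalgebra.bracket (b j) (b i)))) fun j =>
    ι_mem_wordSpan_par h (nonneg_mem h (by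
      rw [add_comm]
      exact LieSuperalgebra.bracket_mem _ _ _ _ (h.hom.mem j) (h.hom.mem i)))

/-- Two negative degrees are at most -2 each, so the bracket has degree at most -4. -/
theorem apply_bracket_eq_zero (h : IsWhittakerDatum b par deg mul χ gr) {i j : I} (hi : deg i < 0)
    (hj : deg j < 0) : χ (LieSuperalgebra.bracket (b j) (b i)) = 0 ∧
      nonneg b deg (LieSuperalgebra.bracket (b j) (b i)) = 0 := by
  have : Submodule.span ℂ (b '' {k | (par k, deg k) = (par j + par i, deg j + deg i)}) ≤
      LinearMap.ker χ ⊓ LinearMap.ker (nonneg b deg) := by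
    rw [Submodule.span_le]
    rintro _ ⟨k, hk, rfl⟩
    have hk' : deg k = deg j + deg i := congrArg Prod.snd hk
    have h1 := h.deg_le hi
    have h2 := h.deg_le hj
    refine ⟨h.apply_deg k (by omega), ?_⟩
    have : deg k < 0 := by omega
    simp [nonneg_basis, this]
  exact this (h.bracket_mem j i)

theorem adConst_mul_X (h : IsWhittakerDatum b par deg mul χ gr) (i j : I) (z : 𝐒) :
    adConst h i (z * 𝐱 j) = χ (LieSuperalgebra.bracket (b j) (b i)) • z +
      superSign (par i) (par j) • (adConst h i z * 𝐱 j) := by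
  refine (SuperSym.superDer_mul_X _ _ _ _ _ _).trans ?_
  rw [mul_smul_comm, mul_one]
  rfl

theorem adLin_mul_X (h : IsWhittakerDatum b par deg mul χ gr) (i j : I) (z : 𝐒) :
    adLin h i (z * 𝐱 j) =
      z * SuperSym.ι _ (nonneg b deg (LieSuperalgebra.bracket (b j) (b i))) +
      superSign (par i) (par j) • (adLin h i z * 𝐱 j) :=
  SuperSym.superDer_mul_X _ _ _ _ _ _

/-- Modulo a = χ(a) for a ∈ m, the bracket [b_j, b_i] becomes the constant χ([b_j, b_i]) plus its
nonnegative part. Negative letters b_j contribute neither, so the adjoint action descends to S(p).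
-/
theorem proj_adSym (h : IsWhittakerDatum b par deg mul χ gr) {i : I} (hi : deg i < 0) (z : 𝐒) :
    h.proj (h.adSym i z) = adConst h i (h.proj z) + adLin h i (h.proj z) := by
  refine LinearMap.congr_fun (SuperSym.linearMap_ext_right b
    (f := h.proj.toLinearMap ∘ₗ h.adSym i)
    (g := adConst h i ∘ₗ h.proj.toLinearMap + adLin h i ∘ₗ h.proj.toLinearMap)
    (by simp [adSym, adConst, adLin]) fun j z hz => ?_) z
  simp only [LinearMap.comp_apply, AlgHom.toLinearMap_apply, LinearMap.add_apply] at hz ⊢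
  rw [h.adSym_mul_X, map_add, map_mul, map_smul, map_mul, hz, map_mul,
    proj_ι, proj_X]
  split_ifs with hj
  · obtain ⟨h1, h2⟩ := apply_bracket_eq_zero h hi hj
    have e := h.χ_smul_sign j (par i)
    rw [superSign_comm] at e
    simp only [h1, h2, zero_smul, map_zero, add_zero, mul_zero, zero_add, mul_smul_comm, mul_one,
      map_smul, smul_smul, ← smul_add]
    rw [mul_comm, e]
  · rw [adConst_mul_X, adLin_mul_X]
    simp only [mul_add, add_mul, smul_add, mul_smul_comm, mul_one]
    abel

/-- The derivation killing the nonnegative generators and fixing the negative ones. -/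
noncomputable def neg (h : IsWhittakerDatum b par deg mul χ gr) : 𝐒 →ₗ[ℂ] 𝐒 :=
  SuperSym.euler h.hom fun i => if deg i < 0 then 1 else 0

theorem neg_mul_X (h : IsWhittakerDatum b par deg mul χ gr) (j : I) (z : 𝐒) :
    neg h (z * 𝐱 j) = neg h z * 𝐱 j + (if deg j < 0 then (1 : ℂ) else 0) • (z * 𝐱 j) := by
  refine (SuperSym.euler_mul_X _ _ _ _).trans ?_
  split_ifs <;> simp [neg]

theorem neg_proj (h : IsWhittakerDatum b par deg mul χ gr) (z : 𝐒) : neg h (h.proj z) = 0 := by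
  refine LinearMap.congr_fun (SuperSym.linearMap_ext_right b
    (f := neg h ∘ₗ h.proj.toLinearMap) (g := 0) (by simp [neg, SuperSym.euler]) fun j z hz => ?_) z
  simp only [LinearMap.comp_apply, AlgHom.toLinearMap_apply, LinearMap.zero_apply] at hz ⊢
  rw [map_mul, proj_X]
  split_ifs with hj
  · simp [hz]
  · rw [neg_mul_X, hz]
    simp [hj]

variable [Fintype I]

/-- The decomposition of b_j along g^χ and the vectors c_i has coefficients χ([b_j, b_i]), which are
the values of `adConst h i`. So counting letters outside g^χ is the constant part of the action of
m, contracted with the dual vectors c_i, plus the count of negative letters. -/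
theorem compl_eq (s : IsSlice b par deg χ pV c) (h : IsWhittakerDatum b par deg mul χ gr) (z : 𝐒) :
    s.compl h z = neg h z + ∑ i, adConst h i z * SuperSym.ι _ (c i) := by
  suffices s.compl h = neg h + ∑ i, (LinearMap.mulRight ℂ (SuperSym.ι _ (c i))) ∘ₗ adConst h i by
    simp [this]
  refine SuperSym.linearMap_ext_right b (f := s.compl h)
    (g := neg h + ∑ i, (LinearMap.mulRight ℂ (SuperSym.ι _ (c i))) ∘ₗ adConst h i)
    (by simp [compl, neg, adConst, SuperSym.euler]) fun j z hz => ?_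
  simp only [LinearMap.add_apply, LinearMap.sum_apply, LinearMap.comp_apply,
    LinearMap.mulRight_apply] at hz ⊢
  rw [compl_mul_X, hz, neg_mul_X]
  have e1 : ∀ i, adConst h i (z * 𝐱 j) * SuperSym.ι _ (c i) =
      z * SuperSym.ι _ (χ (LieSuperalgebra.bracket (b j) (b i)) • c i) +
        adConst h i z * SuperSym.ι _ (c i) * 𝐱 j := by
    intro i
    rw [adConst_mul_X, add_mul, smul_mul_assoc, smul_mul_assoc, mul_assoc,
      SuperSym.X, SuperSym.ι_mul_ι (h.hom.mem j) (s.slice_mem i), superSign_comm (par j),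
      mul_smul_comm, smul_smul, superSign_mul_self, one_smul, mul_assoc]
    simp
  simp only [e1, Finset.sum_add_distrib, ← Finset.mul_sum, ← Finset.sum_mul, ← map_sum]
  have e2 : b j - pV (b j) = (if deg j < 0 then (1 : ℂ) else 0) • b j +
      ∑ i, χ (LieSuperalgebra.bracket (b j) (b i)) • c i := by
    split_ifs with hj
    · rw [s.proj_neg j hj, Finset.sum_eq_zero]
      · simp
      · intro i _
        by_cases hi : deg i < 0
        · rw [(apply_bracket_eq_zero h hi hj).1, zero_smul]
        · rw [s.slice_eq i hi, smul_zero]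
    · conv_lhs => rw [s.decomp j hj]
      rw [zero_smul, zero_add, map_add, s.proj_id]
      have : pV (∑ i, χ (LieSuperalgebra.bracket (b j) (b i)) • c i) = 0 := by
        have := congrArg pV (s.decomp j hj)
        rwa [map_add, s.proj_id, left_eq_add] at this
      rw [this]
      simp
  rw [e2]
  simp only [map_add, map_smul, mul_add, add_mul, mul_smul_comm]
  simp only [SuperSym.X]
  abel

/-- An invariant element of `S(p)` is determined by its image in `S(g^χ)`. -/
theorem eq_zero_of_rho (s : IsSlice b par deg χ pV c) (h : IsWhittakerDatum b par deg mul χ gr)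
    {z : 𝐒} (hneg : neg h z = 0) (hrho : s.rho h z = 0)
    (hinv : ∀ i, deg i < 0 → adConst h i z + adLin h i z = 0) : z = 0 := by
  -- `adLin` preserves word length and c_i adds a letter, so the last sum is a higher order
  -- perturbation of `rho + compl`. On an invariant z the perturbed operator vanishes: `compl` z is
  -- the contraction of the constant parts, and constant plus linear part is zero.
  refine SuperSym.injective_of_leading h.hom (L₀ := (s.rho h).toLinearMap + s.compl h)
    (L := (s.rho h).toLinearMap + s.compl h + ∑ i, (LinearMap.mulRight ℂ (SuperSym.ι _ (c i))) ∘ₗ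
      adLin h i) ?_ ?_ ?_ z ?_
  · intro d z hz
    refine add_mem (map_mem_wordSpan_of_letters (s.rho h) (fun i => ?_) hz) ?_
    · rw [SuperSym.X, rho_ι]
      exact ι_mem_wordSpan_one _
    · have := SuperSym.superDer_mem h.hom 0 (fun i => SuperSym.ι _ (b i - pV (b i))) (fun i => by
        rw [zero_add]
        exact ι_mem_wordSpan_par h (sub_mem (h.hom.mem i) (s.proj_mem i)))
        (w := fun _ => (1 : ℤ)) (δ := 0) (fun i => by rw [add_zero]; exact ι_mem_wordSpan_one _) hz
      rwa [add_zero] at this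
  · exact fun z hz => s.eq_zero_of_rho_add_compl h hz
  · intro d z hz
    rw [LinearMap.add_apply _ (∑ i : I, _), add_sub_cancel_left, LinearMap.sum_apply]
    refine Submodule.sum_mem _ fun i _ => wordSpan_le_wordCofil le_rfl ?_
    refine mul_mem_wordSpan ?_ (ι_mem_wordSpan_one _)
    have := SuperSym.superDer_mem h.hom (par i)
      (fun j => SuperSym.ι _ (nonneg b deg (LieSuperalgebra.bracket (b j) (b i)))) (fun j =>
      ι_mem_wordSpan_par h (nonneg_mem h (by
      rw [add_comm]
      exact LieSuperalgebra.bracket_mem _ _ _ _ (h.hom.mem j) (h.hom.mem i))))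
      (w := fun _ => (1 : ℤ)) (δ := 0) (fun i => by rw [add_zero]; exact ι_mem_wordSpan_one _) hz
    rwa [add_zero] at this
  · simp only [LinearMap.add_apply, AlgHom.toLinearMap_apply, LinearMap.sum_apply,
      LinearMap.comp_apply, LinearMap.mulRight_apply]
    rw [hrho, compl_eq, hneg, zero_add, zero_add, ← Finset.sum_add_distrib]
    refine Finset.sum_eq_zero fun i _ => ?_
    by_cases hi : deg i < 0
    · rw [← add_mul, hinv i hi, zero_mul]
    · rw [s.slice_eq i hi]
      simp

end IsSlice


theorem wordSpan_le_map_weight {A J M N : Type} [Ring A] [Algebra ℂ A] [AddMonoid M] [AddMonoid N]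
    (f : J → A) (w : J → M) (φ : M →+ N) (m : M) :
    wordSpan f w m ≤ wordSpan f (fun i => φ (w i)) (φ m) := by
  refine wordSpan_le ?_
  rintro l rfl
  have := word_mem (f := f) (w := fun i => φ (w i)) l
  rwa [map_list_sum, List.map_map]

section

variable {A J M N : Type} [Ring A] [Algebra ℂ A] [AddMonoid M] [AddMonoid N] {f : J → A}
  {w : J → M} {v : J → N} {m : M} {n : N} {a : A}

theorem mem_wordSpan_fst (ha : a ∈ wordSpan f (fun i => (w i, v i)) (m, n)) : a ∈ wordSpan f w m :=
  wordSpan_le_map_weight f (fun i => (w i, v i)) (AddMonoidHom.fst M N) (m, n) ha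

theorem mem_wordSpan_snd (ha : a ∈ wordSpan f (fun i => (w i, v i)) (m, n)) : a ∈ wordSpan f v n :=
  wordSpan_le_map_weight f (fun i => (w i, v i)) (AddMonoidHom.snd M N) (m, n) ha

end

/-! ### Elements of the W-algebra and their symbols -/

namespace FiniteW

variable {g : Type} [AddCommGroup g] [Module ℂ g] [LieSuperalgebra g]
  {χ : g →ₗ[ℂ] ℂ} {gr : ℤ → Submodule ℂ g} {l : Submodule ℂ g}

theorem proj_eq_iff {x y : Env g} :
    whittakerProj χ gr l x = whittakerProj χ gr l y ↔ x - y ∈ whittakerIdeal χ gr l :=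
  Submodule.Quotient.eq (whittakerIdeal χ gr l)

theorem proj_mul (x y : Env g) : whittakerProj χ gr l (x * y) = x • whittakerProj χ gr l y := by
  change (whittakerIdeal χ gr l).mkQ (x * y) = x • (whittakerIdeal χ gr l).mkQ y
  rw [← map_smul, smul_eq_mul]

theorem unop_proj (w : FiniteW χ gr l) (x : Env g) :
    w.unop (whittakerProj χ gr l x) = x • eval χ gr l w := by
  have := proj_mul (χ := χ) (gr := gr) (l := l) x 1
  rw [mul_one] at this
  rw [this, map_smul]
  rfl

/-- The opposite algebra in the definition of W is what makes the order of factors agree with that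
in U(g). -/
theorem eval_mul {w w' : FiniteW χ gr l} {y y' : Env g} (h : eval χ gr l w = whittakerProj χ gr l y)
    (h' : eval χ gr l w' = whittakerProj χ gr l y') :
    eval χ gr l (w * w') = whittakerProj χ gr l (y * y') := by
  change w'.unop (eval χ gr l w) = _
  rw [h, unop_proj, h', proj_mul]

theorem eval_one : eval χ gr l 1 = whittakerProj χ gr l 1 := rfl

/-- Under this condition the whole left ideal annihilates the class of y, so right multiplication by
y descends to the quotient. -/
theorem exists_eval_eq {y : Env g} (hy : ∀ a ∈ mSub gr l,
    (Env.ι g a - algebraMap ℂ (Env g) (χ a)) * y ∈ whittakerIdeal χ gr l) :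
    ∃ w, eval χ gr l w = whittakerProj χ gr l y := by
  have hle : whittakerIdeal χ gr l ≤
      LinearMap.ker (LinearMap.toSpanSingleton (Env g) _ (whittakerProj χ gr l y)) := by
    refine Submodule.span_le.2 ?_
    rintro _ ⟨a, ha, rfl⟩
    rw [SetLike.mem_coe, LinearMap.mem_ker, LinearMap.toSpanSingleton_apply, ← proj_mul,
      ← map_zero (whittakerProj χ gr l), proj_eq_iff, sub_zero]
    exact hy a ha
  refine ⟨MulOpposite.op ((whittakerIdeal χ gr l).liftQ _ hle), ?_⟩
  change (whittakerIdeal χ gr l).liftQ _ hle ((whittakerIdeal χ gr l).mkQ 1) = _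
  rw [Submodule.mkQ_apply, Submodule.liftQ_apply, LinearMap.toSpanSingleton_apply, one_smul]

/-- An endomorphism sends the class of x, which is zero, to the class of x y. -/
theorem mul_mem_ideal {w : FiniteW χ gr l} {y : Env g}
    (hw : eval χ gr l w = whittakerProj χ gr l y) {x : Env g} (hx : x ∈ whittakerIdeal χ gr l) :
    x * y ∈ whittakerIdeal χ gr l := by
  have h1 : whittakerProj χ gr l x = 0 := by
    rw [← map_zero (whittakerProj χ gr l), proj_eq_iff, sub_zero]
    exact hx
  have h2 := unop_proj w x
  rw [h1, map_zero, hw, ← proj_mul, eq_comm, ← map_zero (whittakerProj χ gr l), proj_eq_iff,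
    sub_zero] at h2
  exact h2

end FiniteW

/-- A homogeneous basis of `g^χ`, compatible with a slice. -/
structure IsAnnihilatorBasis {g I K : Type} [AddCommGroup g] [Module ℂ g] [LieSuperalgebra g]
    (b : Module.Basis I ℂ g) (par : I → ZMod 2) (deg : I → ℤ) (mul : g →ₗ[ℂ] g →ₗ[ℂ] g)
    (χ : g →ₗ[ℂ] ℂ) (gr : ℤ → Submodule ℂ g) [Fintype I]
    (pV : g →ₗ[ℂ] annihilator χ) (c : I → g) (bV : Module.Basis K ℂ (annihilator χ))
    (parV : K → ZMod 2) (degV : K → ℤ) : Prop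
    extends IsWhittakerDatum b par deg mul χ gr, IsSlice b par deg χ pV c where
  hom_par : IsHomogeneousBasis (annihilatorPart χ) bV parV
  hom_deg : IsHomogeneousBasis (fun j => (gr j).submoduleOf (annihilator χ)) bV degV
  proj_deg : ∀ i, (pV (b i) : g) ∈ gr (deg i)
  deg_nonneg : ∀ k, 0 ≤ degV k

namespace IsAnnihilatorBasis

open IsAssocGraded IsWhittakerDatum IsSlice

variable {g I K : Type} [AddCommGroup g] [Module ℂ g] [LieSuperalgebra g] [Fintype I]
  {b : Module.Basis I ℂ g} {par : I → ZMod 2} {deg : I → ℤ} {mul : g →ₗ[ℂ] g →ₗ[ℂ] g}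
  {χ : g →ₗ[ℂ] ℂ} {gr : ℤ → Submodule ℂ g} {pV : g →ₗ[ℂ] annihilator χ} {c : I → g}
  {bV : Module.Basis K ℂ (annihilator χ)} {parV : K → ZMod 2} {degV : K → ℤ}

local notation "𝐒" => SuperSym (LieSuperalgebra.part (g := g))
local notation "𝐱" => SuperSym.X (LieSuperalgebra.part (g := g)) b
local notation "𝐯" => SuperSym.X (annihilatorPart χ) bV

theorem kazhdanEnv_eq (h : IsWhittakerDatum b par deg mul χ gr) (k : ℤ) :
    kazhdanEnv gr k = wordFil (Env.X b) (fun i => deg i + 2) k := by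
  unfold kazhdanEnv wordFil
  refine iSup_congr fun d => iSup_congr fun _ => ?_
  refine monomialSpan_eq_wordSpan (Env.ι g) b (fun i => deg i + 2) _ (fun m => ?_) d
  rw [h.gr_hom]
  congr 3
  ext i
  omega

theorem parity_eq (h : IsWhittakerDatum b par deg mul χ gr) (p : ZMod 2) :
    Env.parity g p = wordSpan (Env.X b) par p :=
  monomialSpan_eq_wordSpan (Env.ι g) b par _ h.hom p

theorem bidegree_eq (h : IsAnnihilatorBasis b par deg mul χ gr pV c bV parV degV) (p : ZMod 2)
    (k : ℤ) : SymAnn.bidegree χ gr p k = wordSpan 𝐯 (fun i => (parV i, degV i + 2)) (p, k) := by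
  refine monomialSpan_eq_wordSpan (SuperSym.ι (annihilatorPart χ)) bV
    (fun i => (parV i, degV i + 2)) _ (fun m => ?_) (p, k)
  refine (h.hom_par.inf h.hom_deg (m.1, m.2 - 2)).trans ?_
  congr 3
  ext i
  rcases m with ⟨m, m'⟩
  simp only [Prod.mk.injEq]
  exact and_congr_right fun _ => by omega

/-- The algebra map `S(g) → S(g^χ)`, `x ↦ χ(x) + pV(x)`. -/
noncomputable def restr (h : IsAnnihilatorBasis b par deg mul χ gr pV c bV parV degV) :
    𝐒 →ₐ[ℂ] SymAnn χ :=
  SuperSym.liftBasis h.hom (fun i => χ (b i) • 1 + SuperSym.ι (annihilatorPart χ) (pV (b i)))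
    fun i j => by
      have h1 := h.χ_smul_sign i (par j)
      have h2 := h.χ_smul_sign j (par i)
      rw [superSign_comm] at h2
      have e := SuperSym.ι_mul_ι (P := annihilatorPart χ) (h.proj_mem i) (h.proj_mem j)
      have e1 : superSign (par i) (par j) * χ (b j) = χ (b j) := by linear_combination h2
      have e2 : superSign (par i) (par j) * χ (b i) = χ (b i) := by linear_combination h1
      have e3 : superSign (par i) (par j) * (χ (b i) * χ (b j)) = χ (b i) * χ (b j) := by
        linear_combination χ (b j) * h1
      simp only [add_mul, mul_add, e, smul_add, mul_smul_comm, smul_mul_assoc, mul_one, one_mul,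
        smul_smul, e1, e2]
      rw [mul_comm (χ (b j)), e3]
      abel

theorem restr_X (h : IsAnnihilatorBasis b par deg mul χ gr pV c bV parV degV) (i : I) :
    h.restr (𝐱 i) = χ (b i) • 1 + SuperSym.ι (annihilatorPart χ) (pV (b i)) :=
  SuperSym.liftBasis_X _ _ _ _

theorem restr_proj (h : IsAnnihilatorBasis b par deg mul χ gr pV c bV parV degV) (t : 𝐒) :
    h.restr (h.proj t) = h.restr t := by
  have : h.restr.comp h.proj = h.restr := by
    refine SuperSym.algHom_ext b fun i => ?_
    rw [AlgHom.comp_apply, h.proj_X]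
    split_ifs with hi
    · simp [restr_X, h.proj_neg i hi]
    · rfl
  exact DFunLike.congr_fun this t

theorem rho_proj (h : IsAnnihilatorBasis b par deg mul χ gr pV c bV parV degV) {t : 𝐒}
    (ht : h.restr t = 0) : h.toIsSlice.rho h.toIsWhittakerDatum (h.proj t) = 0 := by
  let incl : SymAnn χ →ₐ[ℂ] 𝐒 := SuperSym.lift (SuperSym.ι _ ∘ₗ (annihilator χ).subtype)
    fun i j x y hx hy => SuperSym.ι_mul_ι hx hy
  have : (h.toIsSlice.rho h.toIsWhittakerDatum).comp h.proj = incl.comp h.restr := by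
    refine SuperSym.algHom_ext b fun i => ?_
    rw [AlgHom.comp_apply, AlgHom.comp_apply, h.proj_X, restr_X, map_add, map_smul, map_one,
      SuperSym.lift_ι]
    split_ifs with hi
    · simp [h.proj_neg i hi]
    · rw [h.apply_deg i (by omega), SuperSym.X, rho_ι]
      simp
  have := DFunLike.congr_fun this t
  simp only [AlgHom.comp_apply] at this
  rw [this, ht, map_zero]

theorem restr_mem (h : IsAnnihilatorBasis b par deg mul χ gr pV c bV parV degV)
    {m : ZMod 2 × ℤ} {t : 𝐒} (ht : t ∈ wordSpan 𝐱 (fun i => (par i, deg i + 2)) m) :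
    h.restr t ∈ wordSpan 𝐯 (fun i => (parV i, degV i + 2)) m := by
  refine map_mem_wordSpan_of_letters _ (fun i => ?_) ht
  rw [restr_X]
  refine add_mem ?_ ?_
  · by_cases hp : par i = 0
    · by_cases hd : deg i = -2
      · rw [hp, hd]
        exact Submodule.smul_mem _ _ one_mem_wordSpan
      · simp [h.apply_deg i hd]
    · simp [h.apply_par i hp]
  · refine map_mem_wordSpan_of_mem_span _ bV _ ?_
    have e := h.hom_par.inf h.hom_deg (par i, deg i)
    have hm : pV (b i) ∈ annihilatorPart χ (par i) ⊓ (gr (deg i)).submoduleOf (annihilator χ) :=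
      ⟨h.proj_mem i, h.proj_deg i⟩
    have hm' := e.le hm
    convert hm' using 4
    ext j
    simp

theorem mem_parity_iff (h : IsWhittakerDatum b par deg mul χ gr) {w : FiniteW χ gr ⊥}
    {p : ZMod 2} : w ∈ FiniteW.parity χ gr ⊥ p ↔ ∃ y ∈ wordSpan (Env.X b) par p,
      whittakerProj χ gr ⊥ y = FiniteW.eval χ gr ⊥ w := by
  rw [← parity_eq h]
  rfl

variable (k : ℤ)

/-- The pairs of elements of degree at most `k` of the W-algebra and their symbols in `S(g^χ)`. -/
noncomputable def symbols (h : IsAnnihilatorBasis b par deg mul χ gr pV c bV parV degV) :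
    Submodule ℂ (FiniteW χ gr ⊥ × SymAnn χ) :=
  (((pairs g b (fun i => deg i + 2) k).prod
    (wordFil (Env.X b) (fun i => deg i + 2) (k - 1))).map
    (LinearMap.prodMap (whittakerProj χ gr ⊥) h.restr.toLinearMap ∘ₗ LinearMap.fst ℂ _ _ +
      LinearMap.inl ℂ _ _ ∘ₗ whittakerProj χ gr ⊥ ∘ₗ LinearMap.snd ℂ _ _)).comap
    ((FiniteW.eval χ gr ⊥).prodMap LinearMap.id)

variable {k}

/-- A relation rather than a map, because the leading part u and its partner t are not unique. That
z depends only on w is part of `mem_kazhdan_sub_one_iff`. -/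
theorem mem_symbols (h : IsAnnihilatorBasis b par deg mul χ gr pV c bV parV degV)
    {w : FiniteW χ gr ⊥} {z : SymAnn χ} : (w, z) ∈ h.symbols k ↔
      ∃ u t y, (u, t) ∈ pairs g b (fun i => deg i + 2) k ∧
        y ∈ wordFil (Env.X b) (fun i => deg i + 2) (k - 1) ∧
        FiniteW.eval χ gr ⊥ w = whittakerProj χ gr ⊥ (u + y) ∧ h.restr t = z := by
  constructor
  · rintro ⟨⟨⟨u, t⟩, y⟩, ⟨hq, hy⟩, e⟩
    have e1 := congrArg Prod.fst e
    have e2 := congrArg Prod.snd e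
    refine ⟨u, t, y, hq, hy, ?_, ?_⟩
    · simpa using e1.symm
    · simpa using e2
  · rintro ⟨u, t, y, hq, hy, e1, e2⟩
    refine ⟨⟨⟨u, t⟩, y⟩, ⟨hq, hy⟩, ?_⟩
    ext
    · simp [e1]
    · simp [e2]

theorem one_mem_symbols (h : IsAnnihilatorBasis b par deg mul χ gr pV c bV parV degV) :
    (1, 1) ∈ h.symbols 0 :=
  h.mem_symbols.2 ⟨1, 1, 0, one_mem_wordSpan, zero_mem _, by rw [add_zero, FiniteW.eval_one],
    map_one _⟩

theorem mul_mem_symbols (h : IsAnnihilatorBasis b par deg mul χ gr pV c bV parV degV) {j k : ℤ}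
    {q q' : FiniteW χ gr ⊥ × SymAnn χ} (hq : q ∈ h.symbols j) (hq' : q' ∈ h.symbols k) :
    q * q' ∈ h.symbols (j + k) := by
  rcases q with ⟨w, z⟩
  rcases q' with ⟨w', z'⟩
  obtain ⟨u, t, y, hp, hy, e, rfl⟩ := h.mem_symbols.1 hq
  obtain ⟨u', t', y', hp', hy', e', rfl⟩ := h.mem_symbols.1 hq'
  refine h.mem_symbols.2 ⟨u * u', t * t', u * y' + y * (u' + y'), mul_mem_wordSpan hp hp', ?_, ?_,
    map_mul _ _ _⟩
  · have hu : u ∈ wordFil (Env.X b) (fun i => deg i + 2) j :=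
      wordSpan_le_wordFil le_rfl (pairs_fst_mem hp)
    have hu' : u' ∈ wordFil (Env.X b) (fun i => deg i + 2) k :=
      wordSpan_le_wordFil le_rfl (pairs_fst_mem hp')
    refine add_mem (wordFil_mono (by omega) (mul_mem_wordFil hu hy'))
      (wordFil_mono (by omega) (mul_mem_wordFil hy (add_mem hu' (wordFil_mono (by omega) hy'))))
  · rw [FiniteW.eval_mul e e']
    congr 1
    noncomm_ring

theorem mem_kazhdan_iff (h : IsWhittakerDatum b par deg mul χ gr) {w : FiniteW χ gr ⊥} :
    w ∈ (kazhdan χ gr ⊥).F k ↔ ∃ y ∈ wordFil (Env.X b) (fun i => deg i + 2) k,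
      whittakerProj χ gr ⊥ y = FiniteW.eval χ gr ⊥ w := by
  rw [← kazhdanEnv_eq h]
  rfl

theorem mem_kazhdan_of_mem_symbols (h : IsAnnihilatorBasis b par deg mul χ gr pV c bV parV degV)
    {q : FiniteW χ gr ⊥ × SymAnn χ} (hq : q ∈ h.symbols k) : q.1 ∈ (kazhdan χ gr ⊥).F k := by
  rcases q with ⟨w, z⟩
  obtain ⟨u, t, y, hp, hy, e, rfl⟩ := h.mem_symbols.1 hq
  exact (mem_kazhdan_iff h.toIsWhittakerDatum).2
    ⟨u + y, add_mem (wordSpan_le_wordFil le_rfl (pairs_fst_mem hp))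
    (wordFil_mono (by omega) hy), e.symm⟩

theorem adEnv_mem_wordFil (h : IsWhittakerDatum b par deg mul χ gr) (i : I) {y : Env g}
    (hy : y ∈ wordFil (Env.X b) (fun i => deg i + 2) k) :
    h.adEnv i y ∈ wordFil (Env.X b) (fun i => deg i + 2) (k + deg i) := by
  have : wordFil (Env.X b) (fun i => deg i + 2) k ≤
      (wordFil (Env.X b) (fun i => deg i + 2) (k + deg i)).comap (h.adEnv i) := by
    refine wordFil_le fun d hd u hu => ?_
    obtain ⟨t, hq⟩ := exists_pair_left hu
    exact wordSpan_le_wordFil (by omega) (pairs_fst_mem (h.ad_mem_pairs i hq))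
  exact this hy

/-- An element of the W-algebra is of lower degree if and only if its symbol vanishes. -/
theorem mem_kazhdan_sub_one_iff (h : IsAnnihilatorBasis b par deg mul χ gr pV c bV parV degV)
    {q : FiniteW χ gr ⊥ × SymAnn χ} (hq : q ∈ h.symbols k) :
    q.1 ∈ (kazhdan χ gr ⊥).F (k - 1) ↔ q.2 = 0 := by
  rcases q with ⟨w, z⟩
  obtain ⟨u, t, y, hp, hy, e, rfl⟩ := h.mem_symbols.1 hq
  rw [mem_kazhdan_iff h.toIsWhittakerDatum]
  constructor
  · rintro ⟨y', hy', e'⟩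
    have h1 : u - (y' - y) ∈ whittakerIdeal χ gr ⊥ := by
      rw [e, eq_comm, FiniteW.proj_eq_iff] at e'
      convert e' using 1
      abel
    have h2 := (h.exists_sub_mem_ideal_iff hp).1 ⟨_, sub_mem hy' hy, h1⟩
    change h.restr t = 0
    rw [← restr_proj, h2, map_zero]
  · intro ht
    -- The action of m on an element of W vanishes modulo the ideal. Comparing leading terms makes
    -- the projected symbol an invariant of S(p).
    have hinv : ∀ i, deg i < 0 → adConst h.toIsWhittakerDatum i (h.proj t) +
        adLin h.toIsWhittakerDatum i (h.proj t) = 0 := by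
      intro i hi
      rw [← proj_adSym h.toIsWhittakerDatum hi]
      have h1 := h.adEnv_mem_ideal hi (FiniteW.mul_mem_ideal e (h.shifted_mem_ideal hi))
      rw [map_add] at h1
      refine (h.exists_sub_mem_ideal_iff (h.ad_mem_pairs i hp)).1 ⟨-h.adEnv i y, ?_, ?_⟩
      · exact wordFil_mono (by omega) (neg_mem (adEnv_mem_wordFil h.toIsWhittakerDatum i hy))
      · rwa [sub_neg_eq_add]
    have h0 := h.toIsSlice.eq_zero_of_rho h.toIsWhittakerDatum
      (neg_proj h.toIsWhittakerDatum t) (h.rho_proj ht) hinv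
    obtain ⟨y', hy', hI⟩ := (h.exists_sub_mem_ideal_iff hp).2 h0
    refine ⟨y' + y, add_mem hy' hy, ?_⟩
    rw [e, eq_comm, FiniteW.proj_eq_iff]
    convert hI using 1
    abel

/-- Averaging with the parity automorphism, weighted by (-1)^p, is the projector onto parity p; it
acts on both components of a pair at once. -/
theorem half_mem_pairs (h : IsWhittakerDatum b par deg mul χ gr) (p : ZMod 2) {q : Env g × 𝐒}
    (hq : q ∈ pairs g b (fun i => deg i + 2) k) :
    (1 / 2 : ℂ) • (q + superSign 1 p • (h.parEnv 1 q.1, h.parSym 1 q.2)) ∈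
      pairs g b (fun i => (par i, deg i + 2)) (p, k) := by
  have : pairs g b (fun i => deg i + 2) k ≤
      (pairs g b (fun i => (par i, deg i + 2)) (p, k)).comap ((1 / 2 : ℂ) • (LinearMap.id +
        superSign 1 p • ((h.parEnv 1).prodMap (h.parSym 1)).toLinearMap)) := by
    clear hq
    refine wordSpan_le ?_
    rintro l rfl
    have e : ((h.parEnv 1).prodMap (h.parSym 1)) (l.map fun i => (Env.X b i, 𝐱 i)).prod =
        superSign 1 (l.map par).sum • (l.map fun i => (Env.X b i, 𝐱 i)).prod := by
      induction l with
      | nil => simp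
      | cons i l ih =>
        have ei : ((h.parEnv 1).prodMap (h.parSym 1)) (Env.X b i, 𝐱 i) =
            superSign 1 (par i) • (Env.X b i, 𝐱 i) := by
          ext
          · exact h.parEnv_X 1 i
          · exact h.parSym_X 1 i
        rw [List.map_cons, List.prod_cons, map_mul, ih, ei, smul_mul_smul_comm, List.map_cons,
          List.sum_cons, superSign_add_right]
    have hmem := word_mem (f := fun i => (Env.X b i, 𝐱 i)) (w := fun i => (par i, deg i + 2)) l
    have e2 : (l.map fun i => (par i, deg i + 2)).sum =
        ((l.map par).sum, (l.map fun i => deg i + 2).sum) := by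
      clear e hmem
      induction l with
      | nil => rfl
      | cons i l ih => simp [ih]
    rw [e2] at hmem
    simp only [Submodule.mem_comap, LinearMap.smul_apply, LinearMap.add_apply, LinearMap.id_apply,
      AlgHom.toLinearMap_apply, e]
    generalize (l.map fun i => (Env.X b i, 𝐱 i)).prod = x at hmem
    generalize (l.map par).sum = p' at hmem
    by_cases hp : p' = p
    · subst hp
      rw [smul_smul, superSign_mul_self, one_smul]
      exact Submodule.smul_mem _ _ (add_mem hmem hmem)
    · have : superSign 1 p * superSign 1 p' = -1 := by
        rcases parity_cases p with rfl | rfl <;> rcases parity_cases p' with rfl | rfl <;>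
          simp at hp ⊢
      rw [smul_smul, this, neg_one_smul, add_neg_cancel, smul_zero]
      exact zero_mem _
  exact this hq

/-- Every element of the W-algebra of degree at most `k` and of parity `p` has a symbol of degree `k`
and of parity `p`. -/
theorem exists_symbol (h : IsAnnihilatorBasis b par deg mul χ gr pV c bV parV degV) {p : ZMod 2}
    {w : FiniteW χ gr ⊥} (hw : w ∈ (kazhdan χ gr ⊥).F k) (hwp : w ∈ FiniteW.parity χ gr ⊥ p) :
    ∃ z ∈ wordSpan 𝐯 (fun i => (parV i, degV i + 2)) (p, k), (w, z) ∈ h.symbols k := by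
  obtain ⟨y₀, hy₀, e₀⟩ := (mem_kazhdan_iff h.toIsWhittakerDatum).1 hw
  obtain ⟨y₁, hy₁, e₁⟩ := (mem_parity_iff h.toIsWhittakerDatum).1 hwp
  obtain ⟨u, hu, hsub⟩ := mem_wordFil_succ hy₀
  obtain ⟨t, hq⟩ := exists_pair_left hu
  have hmem := half_mem_pairs h.toIsWhittakerDatum p hq
  -- The filtered and the parity representatives of w may differ. Since the ideal is stable under
  -- the parity automorphism, projecting the filtered one to parity p still represents w.
  have e : FiniteW.eval χ gr ⊥ w = whittakerProj χ gr ⊥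
      ((1 / 2 : ℂ) • (y₀ + superSign 1 p • h.parEnv 1 y₀)) := by
    rw [← e₁, FiniteW.proj_eq_iff]
    have h1 : y₁ - y₀ ∈ whittakerIdeal χ gr ⊥ := by
      rw [← FiniteW.proj_eq_iff, e₀, e₁]
    have h2 := h.parEnv_mem_ideal 1 h1
    have h3 : y₁ = (1 / 2 : ℂ) • (y₁ + superSign 1 p • h.parEnv 1 y₁) := by
      rw [h.parEnv_apply 1 p hy₁, smul_smul, superSign_mul_self, one_smul, ← two_smul ℂ, smul_smul]
      norm_num
    rw [h3, ← smul_sub]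
    refine Submodule.smul_of_tower_mem _ _ ?_
    have := add_mem h1 (Submodule.smul_of_tower_mem _ (superSign 1 p) h2)
    convert this using 1
    rw [map_sub, smul_sub]
    abel
  have hpar : wordFil (Env.X b) (fun i => deg i + 2) (k - 1) ≤
      (wordFil (Env.X b) (fun i => deg i + 2) (k - 1)).comap (h.parEnv 1).toLinearMap := by
    refine wordFil_le fun d hd v hv => ?_
    obtain ⟨s, hs⟩ := exists_pair_left hv
    exact wordSpan_le_wordFil hd (pairs_fst_mem (h.par_mem_pairs 1 hs))
  have hmem' := mem_wordSpan_snd hmem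
  refine ⟨_, h.restr_mem (pairs_snd_mem hmem), h.mem_symbols.2 ⟨_, _,
    (1 / 2 : ℂ) • ((y₀ - u) + superSign 1 p • h.parEnv 1 (y₀ - u)), hmem',
    Submodule.smul_mem _ _ (add_mem hsub (Submodule.smul_mem _ _ (hpar hsub))), ?_, rfl⟩⟩
  rw [e]
  congr 1
  simp only [map_sub, smul_sub, smul_add, Prod.fst_add, Prod.smul_fst]
  abel

end IsAnnihilatorBasis


/-! ### Triangular endomorphisms of symmetric superalgebras -/

namespace SuperSym

variable {V I M : Type} [AddCommGroup V] [Module ℂ V] {P : ZMod 2 → Submodule ℂ V}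
  {b : Module.Basis I ℂ V} {par : I → ZMod 2} [AddCommMonoid M]

variable (P) in
/-- The homomorphism `S(V) → ℂ[ε]`, `v ↦ f(v) ε`. -/
noncomputable def dual (f : V →ₗ[ℂ] ℂ) : SuperSym P →ₐ[ℂ] DualNumber ℂ :=
  lift (TrivSqZeroExt.inrHom ℂ ℂ ∘ₗ f) fun i j x y _ _ => by simp

theorem dual_ι (f : V →ₗ[ℂ] ℂ) (x : V) :
    dual P f (SuperSym.ι P x) = TrivSqZeroExt.inr (f x) :=
  lift_ι _ _ _

variable (P b) in
/-- The span of the words of weight `m` and length at least `d`. -/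
noncomputable def longWords (w : I → M) (m : M) (d : ℕ) : Submodule ℂ (SuperSym P) :=
  Submodule.span ℂ {a | ∃ l : List I, (l.map w).sum = m ∧ d ≤ l.length ∧ (l.map (X P b)).prod = a}

theorem longWords_zero (w : I → M) (m : M) : longWords P b w m 0 = wordSpan (X P b) w m := by
  simp [longWords, wordSpan]

theorem longWords_mono (w : I → M) (m : M) {d e : ℕ} (h : d ≤ e) :
    longWords P b w m e ≤ longWords P b w m d :=
  Submodule.span_mono fun _ ⟨l, h1, h2, h3⟩ => ⟨l, h1, h.trans h2, h3⟩

theorem mul_mem_longWords {w : I → M} {m m' : M} {d d' : ℕ} {y z : SuperSym P}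
    (hy : y ∈ longWords P b w m d) (hz : z ∈ longWords P b w m' d') :
    y * z ∈ longWords P b w (m + m') (d + d') := by
  have h : longWords P b w m d * longWords P b w m' d' ≤ longWords P b w (m + m') (d + d') := by
    unfold longWords
    rw [Submodule.span_mul_span]
    apply Submodule.span_mono
    rintro _ ⟨a, ⟨l, h1, h2, rfl⟩, b, ⟨l', h1', h2', rfl⟩, rfl⟩
    exact ⟨l ++ l', by simp [h1, h1'], by simp; omega, by simp⟩
  exact h (Submodule.mul_mem_mul hy hz)

theorem X_mem_longWords (w : I → M) (i : I) : X P b i ∈ longWords P b w (w i) 1 :=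
  Submodule.subset_span ⟨[i], by simp, by simp, by simp⟩

/-- z is a constant plus a vector plus longer words. The longer words vanish in the dual numbers,
and functionals on V separate the rest. -/
theorem mem_longWords_of_dual {w : I → M} {m : M} {z : SuperSym P}
    (hz : z ∈ wordSpan (X P b) w m) (h : ∀ f, dual P f z = 0) : z ∈ longWords P b w m 2 := by
  have H : ∃ (c : ℂ) (v : V), z - c • 1 - SuperSym.ι P v ∈ longWords P b w m 2 := by
    refine Submodule.span_induction (p := fun z _ => ∃ (c : ℂ) (v : V),
      z - c • 1 - SuperSym.ι P v ∈ longWords P b w m 2) ?_ ?_ ?_ ?_ hz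
    · rintro _ ⟨l, hl, rfl⟩
      match l, hl with
      | [], _ => exact ⟨1, 0, by simp⟩
      | [i], _ => exact ⟨0, b i, by simp [X]⟩
      | i :: j :: l, hl =>
        refine ⟨0, 0, ?_⟩
        simp only [zero_smul, map_zero, sub_zero]
        exact Submodule.subset_span ⟨_, hl, by simp, rfl⟩
    · exact ⟨0, 0, by simp⟩
    · rintro x y - - ⟨c, v, h1⟩ ⟨d, u, h2⟩
      refine ⟨c + d, v + u, ?_⟩
      convert add_mem h1 h2 using 1
      rw [add_smul, map_add]
      abel
    · rintro a x - ⟨c, v, h1⟩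
      refine ⟨a * c, a • v, ?_⟩
      convert Submodule.smul_mem _ a h1 using 1
      rw [mul_smul, map_smul, smul_sub, smul_sub]
  obtain ⟨c, v, hcv⟩ := H
  have hdual : ∀ f, dual P f (z - c • 1 - SuperSym.ι P v) = 0 := by
    intro f
    have : longWords P b w m 2 ≤ LinearMap.ker (dual P f).toLinearMap := by
      refine Submodule.span_le.2 ?_
      rintro _ ⟨l, -, hl, rfl⟩
      match l, hl with
      | i :: j :: l, _ =>
        simp [X, dual_ι, ← mul_assoc]
    exact this hcv
  have hc : ∀ f : V →ₗ[ℂ] ℂ, c = 0 ∧ f v = 0 := by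
    intro f
    have := hdual f
    rw [map_sub, map_sub, h, map_smul, map_one, dual_ι] at this
    have h1 := congrArg TrivSqZeroExt.fst this
    have h2 := congrArg TrivSqZeroExt.snd this
    simp at h1 h2
    exact ⟨h1, h2⟩
  have hv : v = 0 := b.ext_elem fun i => by simpa using (hc (b.coord i)).2
  rw [(hc 0).1, hv] at hcv
  simpa using hcv

variable {w : I → M} {f : I → SuperSym P} {θ : SuperSym P →ₐ[ℂ] SuperSym P}

/-- Unitriangularity passes from letters to words: an endomorphism that is the identity on letters
up to longer words is so on all words, with weights preserved. -/
theorem map_sub_mem_longWords (hf : ∀ i, θ (X P b i) - X P b i ∈ longWords P b w (w i) 2) (l : List I) :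
    θ (l.map (X P b)).prod - (l.map (X P b)).prod ∈
      longWords P b w (l.map w).sum (l.length + 1) := by
  induction l with
  | nil => simp
  | cons i l ih =>
    set z := (l.map (X P b)).prod
    have hz : z ∈ longWords P b w (l.map w).sum l.length :=
      Submodule.subset_span ⟨l, rfl, le_rfl, rfl⟩
    have h1 : θ z ∈ longWords P b w (l.map w).sum l.length := by
      have := add_mem (longWords_mono w _ (Nat.le_succ _) ih) hz
      rwa [sub_add_cancel] at this
    have h2 := add_mem (longWords_mono w _ (d := l.length + 2) (by omega)
      (mul_mem_longWords (hf i) h1)) (longWords_mono w _ (d := l.length + 2) (by omega)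
      (mul_mem_longWords (X_mem_longWords w i) ih))
    simp only [List.map_cons, List.prod_cons, List.sum_cons, List.length_cons, map_mul]
    convert h2 using 1
    noncomm_ring

theorem injective_of_longWords (hb : IsHomogeneousBasis P b par)
    (hf : ∀ i, θ (X P b i) - X P b i ∈ longWords P b w (w i) 2) {z : SuperSym P} (hz : θ z = 0) :
    z = 0 := by
  refine injective_of_leading hb (L := θ.toLinearMap) (L₀ := LinearMap.id) (fun _ _ hz => hz)
    (fun _ hz => hz) (fun d z hz => ?_) z hz
  have : wordSpan (X P b) (fun _ => (1 : ℤ)) d ≤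
      (wordCofil (X P b) (fun _ => (1 : ℤ)) (d + 1)).comap (θ.toLinearMap - LinearMap.id) := by
    refine wordSpan_le fun l hl => ?_
    have hle : longWords P b w (l.map w).sum (l.length + 1) ≤
        wordCofil (X P b) (fun _ => (1 : ℤ)) (d + 1) := by
      refine Submodule.span_le.2 ?_
      rintro _ ⟨l', -, hl', rfl⟩
      refine wordSpan_le_wordCofil ?_ (word_mem (w := fun _ => (1 : ℤ)) l')
      simp only [List.map_const', List.sum_replicate, mul_one, nsmul_eq_mul] at hl ⊢
      omega
    exact hle (map_sub_mem_longWords hf l)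
  exact this hz

/-- Successive approximation: a word is its own preimage up to longer words of the same weight.
Positive weights bound the length, so the process stops; hence the downward induction on length. -/
theorem exists_map_eq_of_longWords (δ : M →+ ℤ) (hw : ∀ i, 0 < δ (w i))
    (hf : ∀ i, θ (X P b i) - X P b i ∈ longWords P b w (w i) 2) {m : M} {z : SuperSym P}
    (hz : z ∈ wordSpan (X P b) w m) : ∃ x ∈ wordSpan (X P b) w m, θ x = z := by
  rw [← longWords_zero] at hz
  suffices H : ∀ (n d : ℕ), δ m < d + n →
      longWords P b w m d ≤ (wordSpan (X P b) w m).map θ.toLinearMap from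
    H (δ m + 1).toNat 0 (by omega) hz
  clear hz
  · intro n
    induction n with
    | zero =>
      intro d hd
      refine Submodule.span_le.2 ?_
      rintro _ ⟨l, rfl, hl, rfl⟩
      exfalso
      have : (l.length : ℤ) ≤ δ (l.map w).sum := by
        clear hl hd
        induction l with
        | nil => simp
        | cons i l ih =>
          have := hw i
          simp only [List.length_cons, List.map_cons, List.sum_cons, map_add]
          push_cast
          omega
      omega
    | succ n ih =>
      intro d hd
      refine Submodule.span_le.2 ?_
      rintro _ ⟨l, rfl, hl, rfl⟩
      have h1 := ih (l.length + 1) (by push_cast at hd ⊢; omega) (map_sub_mem_longWords hf l)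
      have h2 : θ (l.map (X P b)).prod ∈
          (wordSpan (X P b) w (l.map w).sum).map θ.toLinearMap := ⟨_, word_mem l, rfl⟩
      have := sub_mem h2 h1
      rwa [sub_sub_cancel] at this

end SuperSym

/-! ### Filtered algebras with a symmetric superalgebra of symbols -/

/-- S behaves like an injective multiplicative symbol map from the graded algebra of A to S(V). The
elements W_k have symbols f_k with linear part b_k, so θ : x_k ↦ f_k is unitriangular and bijective
in each bidegree. The map φ sending x_k to the class of W_k satisfies "symbol of φ = θ", which gives
injectivity of φ from that of θ and surjectivity from that of θ and totality of S. -/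
theorem AlgFiltration.exists_algEquiv {A V K : Type} [Ring A] [Algebra ℂ A] [AddCommGroup V]
    [Module ℂ V] {P : ZMod 2 → Submodule ℂ V} {b : Module.Basis K ℂ V} {par : K → ZMod 2}
    (Φ : AlgFiltration A) (hb : IsHomogeneousBasis P b par) (w : K → ℤ) (hw : ∀ k, 0 < w k)
    (Q : ZMod 2 → Submodule ℂ A) (S : ℤ → Submodule ℂ (A × SuperSym P))
    (hSF : ∀ k, ∀ q ∈ S k, q.1 ∈ Φ.F k)
    (hS : ∀ k, ∀ q ∈ S k, q.1 ∈ Φ.F (k - 1) ↔ q.2 = 0) (hone : 1 ∈ S 0)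
    (hmul : ∀ j k, ∀ q ∈ S j, ∀ q' ∈ S k, q * q' ∈ S (j + k))
    (htot : ∀ k, ∀ a ∈ Φ.F k,
      ∃ z ∈ ⨆ p, wordSpan (SuperSym.X P b) (fun i => (par i, w i)) (p, k), (a, z) ∈ S k)
    (hptot : ∀ k p, ∀ a ∈ Φ.F k, a ∈ Q p →
      ∃ z ∈ wordSpan (SuperSym.X P b) (fun i => (par i, w i)) (p, k), (a, z) ∈ S k)
    (W : K → A) (hpar : ∀ p, wordSpan W par p ≤ Q p) (f : K → SuperSym P)
    (hsym : ∀ k, (W k, f k) ∈ S (w k))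
    (hf : ∀ k, f k ∈ wordSpan (SuperSym.X P b) (fun i => (par i, w i)) (par k, w k))
    (hlin : ∀ k l, SuperSym.dual P l (f k) = TrivSqZeroExt.inr (l (b k))) :
    ∃ φ : SuperSym P ≃ₐ[ℂ] Φ.Gr, ∀ (p : ZMod 2) (k : ℤ),
      (wordSpan (SuperSym.X P b) (fun i => (par i, w i)) (p, k)).map φ.toLinearMap =
        ((Q p).submoduleOf (Φ.F k)).map (DirectSum.lof ℂ ℤ Φ.Piece k ∘ₗ Φ.symbol k) := by
  have hfpar : ∀ k, f k ∈ wordSpan (SuperSym.X P b) par (par k) :=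
    fun k => mem_wordSpan_fst (hf k)
  have hFW : ∀ k, W k ∈ Φ.F (w k) := fun k => hSF _ _ (hsym k)
  have hcomm : ∀ i j, W i * W j - superSign (par i) (par j) • (W j * W i) ∈
      Φ.F (w i + w j - 1) := by
    intro i j
    have h1 := hmul _ _ _ (hsym i) _ (hsym j)
    have h2 := hmul _ _ _ (hsym j) _ (hsym i)
    rw [add_comm] at h2
    have h3 := sub_mem h1 (Submodule.smul_mem _ (superSign (par i) (par j)) h2)
    exact (hS _ _ h3).2
      (sub_eq_zero.2 (SuperSym.mul_comm_of_mem hb (hfpar i) (hfpar j)))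
  let θ : SuperSym P →ₐ[ℂ] SuperSym P := SuperSym.liftBasis hb f
    fun i j => SuperSym.mul_comm_of_mem hb (hfpar i) (hfpar j)
  have hθX : ∀ k, θ ((SuperSym.X P b) k) = f k := fun k => SuperSym.liftBasis_X _ _ _ _
  have hθ : ∀ k, θ ((SuperSym.X P b) k) - (SuperSym.X P b) k ∈ SuperSym.longWords P b
      (fun i => (par i, w i)) (par k, w k) 2 := by
    intro k
    refine SuperSym.mem_longWords_of_dual (sub_mem ?_ (letter_mem_wordSpan (f := (SuperSym.X P b))
      (w := fun i => (par i, w i)) k)) fun f => ?_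
    · rw [hθX]
      exact hf k
    · rw [map_sub, hθX, hlin, SuperSym.X, SuperSym.dual_ι, sub_self]
  let φ := Φ.grLift hb (w) W hFW hcomm
  -- Words in the W_k are related by S to the images under θ of the same words in the generators.
  have hPW : ∀ k, wordSpan (fun i => (W i, (SuperSym.X P b) i)) (w) k ≤
      (S k).comap (LinearMap.id.prodMap θ.toLinearMap) := by
    intro k
    refine wordSpan_le ?_
    rintro l rfl
    induction l with
    | nil =>
      have : (LinearMap.id.prodMap θ.toLinearMap : A × SuperSym P →ₗ[ℂ] _) 1 = 1 := by
        ext <;> simp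
      simpa [this] using hone
    | cons i l ih =>
      have := hmul _ _ _ (hsym i) _ ih
      rw [← hθX] at this
      have e : (LinearMap.id.prodMap θ.toLinearMap : A × SuperSym P →ₗ[ℂ] _)
          ((W i, (SuperSym.X P b) i) * (l.map fun i => (W i, (SuperSym.X P b) i)).prod) =
          (W i, θ ((SuperSym.X P b) i)) * (LinearMap.id.prodMap θ.toLinearMap :
            A × SuperSym P →ₗ[ℂ] _) (l.map fun i => (W i, (SuperSym.X P b) i)).prod := by
        ext <;> simp
      rw [List.map_cons, List.map_cons, List.prod_cons, List.sum_cons, Submodule.mem_comap, e]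
      exact this
  -- Any element related to θ x represents φ x: it differs from the corresponding word combination
  -- in the W_k by an element with zero symbol.
  have hsymbol : ∀ {k : ℤ} {a : A} {x : SuperSym P}
      (ha : a ∈ Φ.F k), x ∈ wordSpan (SuperSym.X P b) (w) k →
      (a, θ x) ∈ S k →
      φ x = DirectSum.lof ℂ ℤ Φ.Piece k (Φ.symbol k ⟨a, ha⟩) := by
    intro k a x ha hx hax
    obtain ⟨⟨a', x'⟩, ha', rfl⟩ := exists_map_mem_wordSpan (f := fun i => (W i, (SuperSym.X P b) i)) (f' := (SuperSym.X P b))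
      (AlgHom.snd ℂ (A) (SuperSym P)) (fun _ => rfl) hx
    obtain ⟨haF, e⟩ := Φ.grLift_eq hb (w) W hFW hcomm ha'
    refine e.trans ?_
    congr 1
    rw [AlgFiltration.symbol_eq_iff]
    refine (hS _ _ (sub_mem (hPW k ha') hax)).2 ?_
    exact sub_self _
  have hinj : Function.Injective φ := by
    rw [injective_iff_map_eq_zero]
    intro x hx
    have hx' : x ∈ ⨆ k, wordSpan (SuperSym.X P b) (w) k := by
      rw [iSup_wordSpan (SuperSym.adjoin_X b)]
      trivial
    obtain ⟨f, hfm, rfl⟩ := (Submodule.mem_iSup_iff_exists_finsupp _ _).1 hx'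
    have hrep : ∀ k, ∃ a : A, ∃ ha : a ∈ Φ.F k,
        φ (f k) = DirectSum.lof ℂ ℤ Φ.Piece k
          (Φ.symbol k ⟨a, ha⟩) ∧ (a, θ (f k)) ∈ S k := by
      intro k
      obtain ⟨⟨a, x'⟩, ha, e⟩ := exists_map_mem_wordSpan (f := fun i => (W i, (SuperSym.X P b) i)) (f' := (SuperSym.X P b))
        (AlgHom.snd ℂ (A) (SuperSym P)) (fun _ => rfl) (hfm k)
      obtain rfl : x' = f k := e
      obtain ⟨haF, e⟩ := Φ.grLift_eq hb (w) W hFW hcomm ha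
      exact ⟨a, haF, e, hPW k ha⟩
    choose a ha hφ hs using hrep
    have h0 : ∀ k, f k = 0 := by
      intro k
      by_cases hk : k ∈ f.support
      · have h1 : Φ.symbol k ⟨a k, ha k⟩ = 0 := by
          have := congrArg (DirectSum.component ℂ ℤ Φ.Piece k) hx
          rw [Finsupp.sum, map_sum, map_sum, map_zero, Finset.sum_eq_single k] at this
          · rw [hφ, DirectSum.component.lof_self] at this
            exact this
          · intro j _ hj
            rw [hφ, DirectSum.component.of, dif_neg hj]
          · exact fun hk' => absurd hk hk'
        rw [← map_zero (Φ.symbol k), AlgFiltration.symbol_eq_iff] at h1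
        have h2 := (hS _ _ (hs k)).1 (by simpa using h1)
        exact SuperSym.injective_of_longWords hb hθ h2
      · simpa using hk
    rw [Finsupp.sum]
    exact Finset.sum_eq_zero fun k _ => h0 k
  have hθsurj : ∀ (p : ZMod 2) (k : ℤ) (z : SuperSym P),
      z ∈ wordSpan (SuperSym.X P b) (fun i => (par i, w i)) (p, k) →
      ∃ x ∈ wordSpan (SuperSym.X P b) (fun i => (par i, w i)) (p, k), θ x = z := by
    intro p k z hz
    refine SuperSym.exists_map_eq_of_longWords (AddMonoidHom.snd (ZMod 2) ℤ) (fun i => ?_) hθ hz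
    exact hw i
  have hweight : ∀ (p : ZMod 2) (k : ℤ), wordSpan (SuperSym.X P b) (fun i => (par i, w i)) (p, k) ≤
      wordSpan (SuperSym.X P b) (w) k := fun p k _ => mem_wordSpan_snd
  have hsurj : Function.Surjective φ := by
    have : ⊤ ≤ LinearMap.range φ.toLinearMap := by
      rintro x -
      induction x using DirectSum.induction_on with
      | zero => exact zero_mem _
      | add x y hx hy => exact add_mem hx hy
      | of k x =>
        obtain ⟨⟨a, ha⟩, rfl⟩ := Φ.symbol_surjective k x
        obtain ⟨z, hz, haz⟩ := htot _ _ ha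
        have : ⨆ p, wordSpan (SuperSym.X P b) (fun i => (par i, w i)) (p, k) ≤
            (wordSpan (SuperSym.X P b) (w) k).map θ.toLinearMap := by
          refine iSup_le fun p z hz => ?_
          obtain ⟨x, hx, e⟩ := hθsurj p k z hz
          exact ⟨x, hweight p k hx, e⟩
        obtain ⟨x, hx, rfl⟩ := this hz
        exact ⟨x, hsymbol ha hx haz⟩
    exact LinearMap.range_eq_top.1 (top_le_iff.1 this)
  refine ⟨AlgEquiv.ofBijective φ ⟨hinj, hsurj⟩, fun p k => ?_⟩
  apply le_antisymm
  · rintro _ ⟨x, hx, rfl⟩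
    obtain ⟨⟨a, x'⟩, ha, rfl⟩ := exists_map_mem_wordSpan (f := fun i => (W i, (SuperSym.X P b) i)) (f' := (SuperSym.X P b))
      (AlgHom.snd ℂ (A) (SuperSym P)) (fun _ => rfl) hx
    obtain ⟨haF, e⟩ := Φ.grLift_eq hb (w) W hFW hcomm
      (mem_wordSpan_snd ha)
    have hap : a ∈ Q p := by
      refine hpar p ?_
      exact map_mem_wordSpan (f := fun i => (W i, (SuperSym.X P b) i)) (f' := W)
        (AlgHom.fst ℂ (A) (SuperSym P)) (fun _ => rfl)
        (mem_wordSpan_fst ha)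
    exact ⟨⟨a, haF⟩, hap, e.symm⟩
  · rintro _ ⟨⟨a, ha⟩, hap, rfl⟩
    obtain ⟨z, hz, haz⟩ := hptot _ _ _ ha hap
    obtain ⟨x, hx, rfl⟩ := hθsurj p k z hz
    exact ⟨x, hx, hsymbol ha (hweight p k hx) haz⟩

/-! ### The associated graded of the W-algebra -/

namespace IsAnnihilatorBasis

open IsAssocGraded IsWhittakerDatum IsSlice

variable {g I K : Type} [AddCommGroup g] [Module ℂ g] [LieSuperalgebra g] [Fintype I]
  {b : Module.Basis I ℂ g} {par : I → ZMod 2} {deg : I → ℤ} {mul : g →ₗ[ℂ] g →ₗ[ℂ] g}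
  {χ : g →ₗ[ℂ] ℂ} {gr : ℤ → Submodule ℂ g} {pV : g →ₗ[ℂ] annihilator χ} {c : I → g}
  {bV : Module.Basis K ℂ (annihilator χ)} {parV : K → ZMod 2} {degV : K → ℤ}

local notation "𝐒" => SuperSym (LieSuperalgebra.part (g := g))
local notation "𝐱" => SuperSym.X (LieSuperalgebra.part (g := g)) b
local notation "𝐯" => SuperSym.X (annihilatorPart χ) bV

theorem wordSpan_le_parity (h : IsWhittakerDatum b par deg mul χ gr) {W : K → FiniteW χ gr ⊥}
    (hW : ∀ k, W k ∈ FiniteW.parity χ gr ⊥ (parV k)) (p : ZMod 2) :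
    wordSpan W parV p ≤ FiniteW.parity χ gr ⊥ p := by
  refine wordSpan_le ?_
  rintro l rfl
  induction l with
  | nil => exact (mem_parity_iff h).2 ⟨1, one_mem_wordSpan, rfl⟩
  | cons i l ih =>
    obtain ⟨y, hy, e⟩ := (mem_parity_iff h).1 (hW i)
    obtain ⟨y', hy', e'⟩ := (mem_parity_iff h).1 ih
    exact (mem_parity_iff h).2 ⟨y * y', mul_mem_wordSpan hy hy', (FiniteW.eval_mul e.symm e'.symm).symm⟩

/-- No parity is assumed here, so the symbol is only a sum of bihomogeneous pieces. This suffices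
for surjectivity onto the graded algebra. -/
theorem exists_symbol_of_mem_kazhdan (h : IsAnnihilatorBasis b par deg mul χ gr pV c bV parV degV)
    {k : ℤ} {w : FiniteW χ gr ⊥} (hw : w ∈ (kazhdan χ gr ⊥).F k) :
    ∃ z ∈ ⨆ p, wordSpan 𝐯 (fun i => (parV i, degV i + 2)) (p, k), (w, z) ∈ h.symbols k := by
  obtain ⟨y, hy, e⟩ := (mem_kazhdan_iff h.toIsWhittakerDatum).1 hw
  obtain ⟨u, hu, hsub⟩ := mem_wordFil_succ hy
  obtain ⟨t, hq⟩ := exists_pair_left hu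
  refine ⟨h.restr t, ?_, h.mem_symbols.2 ⟨u, t, y - u, hq, hsub, ?_, rfl⟩⟩
  · have : wordSpan 𝐱 (fun i => deg i + 2) k ≤ (⨆ p, wordSpan 𝐯
        (fun i => (parV i, degV i + 2)) (p, k)).comap h.restr.toLinearMap := by
      refine wordSpan_le ?_
      rintro l rfl
      refine Submodule.mem_iSup_of_mem (l.map par).sum (h.restr_mem ?_)
      have := word_mem (f := 𝐱) (w := fun i => (par i, deg i + 2)) l
      convert this using 2
      clear this hy hu hq hsub hw
      induction l with
      | nil => rfl
      | cons i l ih => simp [← ih]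
    exact this (pairs_snd_mem hq)
  · rw [← e]
    congr 1
    abel

/-- The criterion through which both cases of the theorem pass: it is enough to exhibit, for each
basis vector of g^χ, a Whittaker vector of its bidegree whose symbol restricts to that vector up to
longer words. -/
theorem bidegree_map_eq (h : IsAnnihilatorBasis b par deg mul χ gr pV c bV parV degV)
    (y : K → Env g) (t : K → 𝐒)
    (hyt : ∀ k, (y k, t k) ∈
      pairs g b (fun i => (par i, deg i + 2)) (parV k, degV k + 2))
    (hinv : ∀ k i, deg i < 0 → (shifted b χ i).1 * y k ∈ whittakerIdeal χ gr ⊥)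
    (hlin : ∀ k f, SuperSym.dual (annihilatorPart χ) f (h.restr (t k)) =
      TrivSqZeroExt.inr (f (bV k))) :
    ∃ φ : SymAnn χ ≃ₐ[ℂ] GrW χ gr ⊥, ∀ (p : ZMod 2) (k : ℤ),
      (SymAnn.bidegree χ gr p k).map φ.toLinearMap = GrW.bidegree χ gr ⊥ p k := by
  have hW : ∀ k, ∃ w, FiniteW.eval χ gr ⊥ w = whittakerProj χ gr ⊥ (y k) := by
    intro k
    refine FiniteW.exists_eval_eq fun a ha => ?_
    let N : Submodule ℂ g := ((whittakerIdeal χ gr ⊥).restrictScalars ℂ).comap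
      (LinearMap.mulRight ℂ (y k) ∘ₗ (Env.ι g - (Algebra.linearMap ℂ (Env g)) ∘ₗ χ))
    have hN : mSub gr ⊥ ≤ N := h.mSub_le fun i hi => hinv k i hi
    exact hN ha
  choose W hW using hW
  have hsym : ∀ k, (W k, h.restr (t k)) ∈ h.symbols (degV k + 2) := fun k =>
    h.mem_symbols.2 ⟨y k, t k, 0,
      mem_wordSpan_snd (hyt k), zero_mem _,
      by rw [add_zero, hW], rfl⟩
  have hpar : ∀ k, W k ∈ FiniteW.parity χ gr ⊥ (parV k) := fun k =>
    (mem_parity_iff h.toIsWhittakerDatum).2 ⟨y k, pairs_fst_mem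
      (mem_wordSpan_fst (hyt k)), (hW k).symm⟩
  obtain ⟨φ, hφ⟩ := (kazhdan χ gr ⊥).exists_algEquiv h.hom_par (fun i => degV i + 2)
    (fun i => by have := h.deg_nonneg i; omega) (FiniteW.parity χ gr ⊥) h.symbols
    (fun _ _ => h.mem_kazhdan_of_mem_symbols) (fun _ _ => h.mem_kazhdan_sub_one_iff)
    h.one_mem_symbols (fun _ _ _ hq _ hq' => h.mul_mem_symbols hq hq')
    (fun _ _ => h.exists_symbol_of_mem_kazhdan) (fun _ _ _ => h.exists_symbol)
    W (wordSpan_le_parity h.toIsWhittakerDatum hpar) (fun k => h.restr (t k)) hsym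
    (fun k => h.restr_mem (pairs_snd_mem (hyt k))) hlin
  refine ⟨φ, fun p k => ?_⟩
  rw [h.bidegree_eq]
  exact hφ p k

end IsAnnihilatorBasis


/-! ### The associative product of the queer superalgebra -/

namespace Queer

variable {n : ℕ}

/-- The product of block matrices. -/
noncomputable def mul (n : ℕ) : Queer n →ₗ[ℂ] Queer n →ₗ[ℂ] Queer n :=
  LinearMap.mk₂ ℂ (fun x y => (x.1 * y.1 + x.2 * y.2, x.1 * y.2 + x.2 * y.1))
    (by intros; ext : 1 <;> simp <;> noncomm_ring)
    (by intros; ext : 1 <;> simp [smul_add])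
    (by intros; ext : 1 <;> simp <;> noncomm_ring)
    (by intros; ext : 1 <;> simp [smul_add])

theorem mul_apply (x y : Queer n) :
    mul n x y = (x.1 * y.1 + x.2 * y.2, x.1 * y.2 + x.2 * y.1) := rfl

theorem mul_assoc (x y z : Queer n) : mul n (mul n x y) z = mul n x (mul n y z) := by
  simp only [mul_apply]
  ext : 1 <;> noncomm_ring

theorem bracket_eq {i j : ZMod 2} {x y : Queer n} (hx : x ∈ part n i) (hy : y ∈ part n j) :
    LieSuperalgebra.bracket x y = mul n x y - superSign i j • mul n y x := by
  change Queer.bracket n x y = _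
  obtain ⟨a, b⟩ := x
  obtain ⟨c, d⟩ := y
  rcases parity_cases i with rfl | rfl <;> rcases parity_cases j with rfl | rfl <;>
    simp only [mem_part_zero, mem_part_one] at hx hy <;> subst hx <;> subst hy <;>
    simp [Queer.bracket, mul_apply]

end Queer

theorem LieSuperalgebra.iSupIndep_part {g : Type} [AddCommGroup g] [Module ℂ g]
    [LieSuperalgebra g] : iSupIndep (LieSuperalgebra.part (g := g)) := by
  intro i
  have h := (LieSuperalgebra.isCompl (g := g)).disjoint
  rcases parity_cases i with rfl | rfl
  · refine h.mono_right (iSup_le fun j => iSup_le fun hj => ?_)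
    rcases parity_cases j with rfl | rfl
    · exact absurd rfl hj
    · exact le_rfl
  · refine h.symm.mono_right (iSup_le fun j => iSup_le fun hj => ?_)
    rcases parity_cases j with rfl | rfl
    · exact le_rfl
    · exact absurd rfl hj

theorem iSupIndep.submoduleOf {V J : Type} [AddCommGroup V] [Module ℂ V] {P : J → Submodule ℂ V}
    (h : iSupIndep P) (N : Submodule ℂ V) : iSupIndep fun j => (P j).submoduleOf N := by
  intro j
  rw [Submodule.disjoint_def]
  intro x hx hx'
  have : (x : V) ∈ ⨆ i, ⨆ _ : i ≠ j, P i := by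
    have hle : ⨆ i, ⨆ _ : i ≠ j, (P i).submoduleOf N ≤
        (⨆ i, ⨆ _ : i ≠ j, P i).submoduleOf N :=
      iSup_le fun i => iSup_le fun hi x hx =>
        Submodule.mem_iSup_of_mem i (Submodule.mem_iSup_of_mem hi hx)
    exact hle hx'
  exact Subtype.ext (Submodule.disjoint_def.1 (h j) x hx this)

theorem IsHomogeneousBasis.finrank_eq {M V I : Type} [AddCommGroup V] [Module ℂ V]
    {P : M → Submodule ℂ V} {b : Module.Basis I ℂ V} {w : I → M} (hb : IsHomogeneousBasis P b w)
    (m : M) [Fintype {i // w i = m}] :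
    Module.finrank ℂ (P m) = Fintype.card {i // w i = m} := by
  have h := finrank_span_eq_card (R := ℂ) (b := fun i : {i // w i = m} => b i)
    (b.linearIndependent.comp _ Subtype.val_injective)
  have e : Set.range (fun i : {i // w i = m} => b i) = b '' {i | w i = m} := by
    ext x
    constructor
    · rintro ⟨⟨i, hi⟩, rfl⟩
      exact ⟨i, hi, rfl⟩
    · rintro ⟨i, hi, rfl⟩
      exact ⟨⟨i, hi⟩, rfl⟩
  rwa [e, ← hb m] at h

/-! ### Sergeev elements -/

/-- The sign `(-1)^p`. -/
noncomputable def paritySign (p : ZMod 2) : ℂ := superSign p p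

@[simp] theorem paritySign_zero : paritySign 0 = 1 := by simp [paritySign]

@[simp] theorem paritySign_mul_self (p : ZMod 2) : paritySign p * paritySign p = 1 :=
  superSign_mul_self p p

theorem paritySign_add (p q : ZMod 2) : paritySign (p + q) = paritySign p * paritySign q := by
  rcases parity_cases p with rfl | rfl <;> rcases parity_cases q with rfl | rfl <;>
    simp [paritySign, CharTwo.add_self_eq_zero]

section Sergeev

variable {J A : Type} [Fintype J] [DecidableEq J] [Ring A] [Algebra ℂ A]

/-- Sergeev's elements: the entries of the signed powers of a matrix of even and odd elements. -/
noncomputable def sergeev (x : ZMod 2 → J → J → A) : ℕ → ZMod 2 → J → J → A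
  | 0, p, i, j => if p = 0 ∧ i = j then 1 else 0
  | m + 1, p, i, j => ∑ r, ∑ a, (paritySign r) ^ m • (x r i a * sergeev x m (p + r) a j)

theorem sergeev_zero (x : ZMod 2 → J → J → A) (p : ZMod 2) (i j : J) :
    sergeev x 0 p i j = if p = 0 ∧ i = j then 1 else 0 := rfl

theorem sergeev_succ (x : ZMod 2 → J → J → A) (m : ℕ) (p : ZMod 2) (i j : J) :
    sergeev x (m + 1) p i j =
      ∑ r, ∑ a, (paritySign r) ^ m • (x r i a * sergeev x m (p + r) a j) := rfl

theorem map_sergeev {B : Type} [Ring B] [Algebra ℂ B] (f : A →ₐ[ℂ] B) (x : ZMod 2 → J → J → A)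
    (m : ℕ) (p : ZMod 2) (i j : J) :
    f (sergeev x m p i j) = sergeev (fun p i j => f (x p i j)) m p i j := by
  induction m generalizing p i j with
  | zero =>
    simp only [sergeev_zero]
    split_ifs <;> simp
  | succ m ih => simp [sergeev_succ, ih]

/-- The commutation relations of Sergeev's elements. -/
theorem mul_sergeev (x : ZMod 2 → J → J → A)
    (hx : ∀ q i j r k l, x q i j * x r k l = superSign q r • (x r k l * x q i j) +
      ((if j = k then x (q + r) i l else 0) -
        superSign q r • if i = l then x (q + r) k j else 0)) (m : ℕ)
    (p q : ZMod 2) (i j k l : J) :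
    x q i j * sergeev x m p k l = superSign q p • (sergeev x m p k l * x q i j) +
      ((paritySign q) ^ (m + 1) • (if j = k then sergeev x m (p + q) i l else 0) -
        superSign q p • if i = l then sergeev x m (p + q) k j else 0) := by
  induction m generalizing p k with
  | zero =>
    have hA : x q i j * sergeev x 0 p k l = superSign q p • (sergeev x 0 p k l * x q i j) := by
      rw [sergeev_zero]
      split_ifs with h
      · simp [h.1]
      · simp
    have hB : ((paritySign q) ^ (0 + 1) • (if j = k then sergeev x 0 (p + q) i l else 0) -
        superSign q p • if i = l then sergeev x 0 (p + q) k j else 0) = 0 := by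
      simp only [sergeev_zero]
      by_cases hpq : p = q
      · subst hpq
        by_cases h1 : j = k
        · subst h1
          simp [paritySign, CharTwo.add_self_eq_zero]
        · simp [h1, Ne.symm h1]
      · have : p + q ≠ 0 := by rwa [Ne, CharTwo.add_eq_zero]
        simp [this]
    rw [hA, hB, add_zero]
  | succ m ih =>
    have e1 : ∀ r a, x q i j * ((paritySign r) ^ m • (x r k a * sergeev x m (p + r) a l)) =
        superSign q p • ((paritySign r) ^ m • (x r k a * sergeev x m (p + r) a l) * x q i j) +
        (((paritySign r) ^ m * superSign q r * (paritySign q) ^ (m + 1)) •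
            (if j = a then x r k a * sergeev x m (p + q + r) i l else 0) -
          superSign q p • ((paritySign r) ^ m •
            (if i = l then x r k a * sergeev x m (p + q + r) a j else 0)) +
          ((paritySign r) ^ m • (if j = k then x (q + r) i a * sergeev x m (p + r) a l else 0) -
          ((paritySign r) ^ m * superSign q r) •
            (if i = a then x (q + r) k j * sergeev x m (p + r) a l else 0))) := by
      intro r a
      have s1 : superSign q r * superSign q (p + r) = superSign q p := by
        rw [superSign_add_right, mul_left_comm, superSign_mul_self, mul_one]
      rw [mul_smul_comm, ← mul_assoc, hx, add_mul, sub_mul, smul_mul_assoc, mul_assoc, ih,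
        add_right_comm p r q]
      simp only [mul_add, mul_sub, mul_smul_comm, smul_mul_assoc, smul_add, smul_sub, smul_smul,
        mul_ite, ite_mul, mul_zero, zero_mul, mul_assoc, s1]
      rw [mul_comm (superSign q p)]
      abel
    -- The two unwanted middle sums cancel after the substitution r ↦ q + r. The signs (-1)^{rm} in
    -- the definition of the powers are chosen for this.
    have e2 : ∑ r, ∑ a, ((paritySign r) ^ m * superSign q r * (paritySign q) ^ (m + 1)) •
          (if j = a then x r k a * sergeev x m (p + q + r) i l else 0) =
        ∑ r, ∑ a, ((paritySign r) ^ m * superSign q r) •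
          (if i = a then x (q + r) k j * sergeev x m (p + r) a l else 0) := by
      simp only [smul_ite, smul_zero, Finset.sum_ite_eq, Finset.mem_univ, if_true]
      refine Fintype.sum_equiv (Equiv.addLeft q) _ _ fun r => ?_
      have h1 : q + (q + r) = r := by rw [← add_assoc, CharTwo.add_self_eq_zero, zero_add]
      rw [Equiv.coe_addLeft, h1, ← add_assoc, paritySign_add, superSign_add_right, mul_pow]
      congr 1
      change _ = _ * (paritySign q * _)
      ring
    have e3 : ∑ r, ∑ a, (paritySign r) ^ m •
          (if j = k then x (q + r) i a * sergeev x m (p + r) a l else 0) =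
        (paritySign q) ^ (m + 2) • if j = k then sergeev x (m + 1) (p + q) i l else 0 := by
      have h2 : (paritySign q) ^ (m + 2) = (paritySign q) ^ m := by
        rw [pow_add, pow_two, paritySign_mul_self, mul_one]
      rw [h2]
      split_ifs
      · rw [sergeev_succ, Finset.smul_sum]
        refine Fintype.sum_equiv (Equiv.addLeft q) _ _ fun r => ?_
        rw [Finset.smul_sum]
        refine Finset.sum_congr rfl fun a _ => ?_
        have h1 : p + q + (q + r) = p + r := by
          rw [add_assoc, ← add_assoc q, CharTwo.add_self_eq_zero, zero_add]
        rw [Equiv.coe_addLeft, h1, smul_smul, paritySign_add, mul_pow, ← mul_assoc, ← mul_pow,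
          paritySign_mul_self, one_pow, one_mul]
      · simp
    have e4 : ∑ r, ∑ a, superSign q p • ((paritySign r) ^ m •
          (if i = l then x r k a * sergeev x m (p + q + r) a j else 0)) =
        superSign q p • if i = l then sergeev x (m + 1) (p + q) k j else 0 := by
      split_ifs
      · simp only [sergeev_succ, Finset.smul_sum]
      · simp
    have e5 : x q i j * sergeev x (m + 1) p k l = ∑ r, ∑ a,
        x q i j * ((paritySign r) ^ m • (x r k a * sergeev x m (p + r) a l)) := by
      simp only [sergeev_succ, Finset.mul_sum]
    have e6 : superSign q p • (sergeev x (m + 1) p k l * x q i j) = ∑ r, ∑ a,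
        superSign q p • ((paritySign r) ^ m • (x r k a * sergeev x m (p + r) a l) * x q i j) := by
      simp only [sergeev_succ, Finset.sum_mul, Finset.smul_sum]
    rw [e5, e6, ← e3, ← e4]
    simp only [e1, Finset.sum_add_distrib, Finset.sum_sub_distrib]
    rw [e2]
    abel

end Sergeev


/-! ### Weights and linear parts of Sergeev's elements -/

section Sergeev

variable {N : ℕ}

/-- The index parts of the letter weights telescope along a path from i to j, and each of the m
letters contributes the Kazhdan shift 2. -/
theorem sergeev_mem_wordSpan {A : Type} [Ring A] [Algebra ℂ A]
    (f : ZMod 2 × Fin (N + 1) × Fin (N + 1) → A) (m : ℕ) (p : ZMod 2) (i j : Fin (N + 1)) :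
    sergeev (fun p i j => f (p, i, j)) m p i j ∈
      wordSpan f (fun q => (q.1, 2 * ((q.2.2 : ℤ) - (q.2.1 : ℤ)) + 2))
        (p, 2 * ((j : ℤ) - (i : ℤ)) + 2 * m) := by
  induction m generalizing p i with
  | zero =>
    rw [sergeev_zero]
    split_ifs with h
    · obtain ⟨rfl, rfl⟩ := h
      have : ((0 : ZMod 2), 2 * ((i : ℤ) - (i : ℤ)) + 2 * ((0 : ℕ) : ℤ)) = 0 := by simp
      rw [this]
      exact one_mem_wordSpan
    · exact zero_mem _
  | succ m ih =>
    rw [sergeev_succ]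
    refine Submodule.sum_mem _ fun r _ => Submodule.sum_mem _ fun a _ => Submodule.smul_mem _ _ ?_
    have := mul_mem_wordSpan (letter_mem_wordSpan (f := f)
      (w := fun q => (q.1, 2 * ((q.2.2 : ℤ) - (q.2.1 : ℤ)) + 2)) (r, i, a)) (ih (p + r) a)
    convert this using 2
    ext
    · change p = r + (p + r)
      rw [add_left_comm, CharTwo.add_self_eq_zero, add_zero]
    · change _ = 2 * ((a : ℤ) - (i : ℤ)) + 2 + (2 * ((j : ℤ) - (a : ℤ)) + 2 * (m : ℤ))
      push_cast
      ring

/-- The linear parts of Sergeev's elements. -/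
theorem sergeev_dualNumber (x : ZMod 2 → Fin (N + 1) → Fin (N + 1) → DualNumber ℂ)
    (φ : ZMod 2 → Fin (N + 1) → ℂ)
    (h : ∀ p i j, i ≠ 0 → x p i j = if p = 0 ∧ (i : ℕ) = j + 1 then 1 else 0)
    (h0 : ∀ p j, x p 0 j = TrivSqZeroExt.inr (φ p j)) (p : ZMod 2) (k : Fin (N + 1)) :
    sergeev x (N + 1 + k) p (Fin.last N) 0 =
      TrivSqZeroExt.inr ((paritySign p) ^ (k : ℕ) * φ p k) := by
  -- Below the first row the matrix has just a one to the left of the diagonal, so a power has the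
  -- same entries one row up and one exponent lower.
  have hstep : ∀ m p (i j l : Fin (N + 1)), (i : ℕ) = j + 1 →
      sergeev x (m + 1) p i l = sergeev x m p j l := by
    intro m p i j l hij
    have hi : i ≠ 0 := by
      rintro rfl
      simp at hij
    rw [sergeev_succ, Finset.sum_eq_single 0, Finset.sum_eq_single j]
    · simp [h _ _ _ hi, hij]
    · intro a _ ha
      have : ¬ (i : ℕ) = a + 1 := fun hia => ha (Fin.ext (by omega))
      simp [h _ _ _ hi, this]
    · simp
    · intro r _ hr
      refine Finset.sum_eq_zero fun a _ => ?_
      simp [h _ _ _ hi, hr]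
    · simp
  have hdown : ∀ d m p (i l : Fin (N + 1)), (i : ℕ) = d →
      sergeev x (m + d) p i l = sergeev x m p 0 l := by
    intro d
    induction d with
    | zero =>
      intro m p i l hi
      obtain rfl : i = 0 := Fin.ext hi
      rw [add_zero]
    | succ d ih =>
      intro m p i l hi
      rw [← add_assoc, hstep _ _ i ⟨d, by omega⟩ _ hi]
      exact ih _ _ _ _ rfl
  -- Modulo ε the first row is zero as well, and the powers are those of a shift.
  have hfst : ∀ m p (i : Fin (N + 1)), (sergeev x m p i 0).fst =
      if p = 0 ∧ (i : ℕ) = m then 1 else 0 := by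
    intro m
    induction m with
    | zero =>
      intro p i
      rw [sergeev_zero]
      simp only [Fin.ext_iff, Fin.val_zero]
      split_ifs <;> simp
    | succ m ih =>
      intro p i
      by_cases hi : i = 0
      · subst hi
        have : ((0 : Fin (N + 1)) : ℕ) ≠ m + 1 := by simp
        rw [if_neg (fun h => this h.2), sergeev_succ, TrivSqZeroExt.fst_sum]
        refine Finset.sum_eq_zero fun r _ => ?_
        rw [TrivSqZeroExt.fst_sum]
        refine Finset.sum_eq_zero fun a _ => ?_
        simp [h0]
      · have hi' : (i : ℕ) ≠ 0 := fun h => hi (Fin.ext h)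
        rw [hstep m p i ⟨i - 1, by omega⟩ 0 (by simp; omega), ih]
        have : (i : ℕ) - 1 = m ↔ (i : ℕ) = m + 1 := by omega
        simp [this]
  -- N factors climb from the last row to row 0, one factor takes the entry φ ε of the first row,
  -- and the remaining k factors enter only through their constant terms, which force column k and
  -- the parity p.
  rw [show N + 1 + (k : ℕ) = (k + 1) + N by ring, hdown N _ _ _ _ (Fin.val_last N), sergeev_succ,
    Finset.sum_eq_single p, Finset.sum_eq_single k]
  · ext
    · simp [h0]
    · simp [h0, hfst, CharTwo.add_self_eq_zero]
  · intro a _ ha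
    have : ¬ (a : ℕ) = k := fun h => ha (Fin.ext h)
    ext
    · simp [h0]
    · simp [h0, hfst, this]
  · simp
  · intro r _ hr
    refine Finset.sum_eq_zero fun a _ => ?_
    have : p + r ≠ 0 := by
      rw [Ne, CharTwo.add_eq_zero]
      exact fun h => hr h.symm
    ext
    · simp [h0]
    · simp [h0, hfst, this]
  · simp

end Sergeev

/-! ### Principal gradings of the queer superalgebra -/

/-- A basis of matrix units `e_ij`, `f_ij` of `Q(N + 1)` that is homogeneous of degree `2 (j - i)` and
such that `χ` takes the value `1` on `e_ij`, `i = j + 1`, and vanishes on the other vectors. -/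
structure IsPrincipalBasis {N : ℕ} (b : Module.Basis (ZMod 2 × Fin (N + 1) × Fin (N + 1)) ℂ
    (Queer (N + 1))) (χ : Queer (N + 1) →ₗ[ℂ] ℂ) (gr : ℤ → Submodule ℂ (Queer (N + 1))) :
    Prop where
  good : IsGoodGrading χ gr
  part_mem : ∀ p i j, b (p, i, j) ∈ LieSuperalgebra.part (g := Queer (N + 1)) p
  mul_eq : ∀ p i j q k l, Queer.mul _ (b (p, i, j)) (b (q, k, l)) =
    if j = k then b (p + q, i, l) else 0
  gr_mem : ∀ p (i j : Fin (N + 1)), b (p, i, j) ∈ gr (2 * ((j : ℤ) - (i : ℤ)))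
  apply_eq : ∀ p (i j : Fin (N + 1)), χ (b (p, i, j)) = if p = 0 ∧ (i : ℕ) = j + 1 then 1 else 0

namespace IsPrincipalBasis

variable {N : ℕ} {b : Module.Basis (ZMod 2 × Fin (N + 1) × Fin (N + 1)) ℂ (Queer (N + 1))}
  {χ : Queer (N + 1) →ₗ[ℂ] ℂ} {gr : ℤ → Submodule ℂ (Queer (N + 1))}

theorem isWhittakerDatum (h : IsPrincipalBasis b χ gr) :
    IsWhittakerDatum b (fun q => q.1) (fun q => 2 * ((q.2.2 : ℤ) - (q.2.1 : ℤ)))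
      (Queer.mul (N + 1)) χ gr where
  hom := IsHomogeneousBasis.of_mem LieSuperalgebra.iSupIndep_part fun _ => h.part_mem _ _ _
  assoc _ _ _ := Queer.mul_assoc _ _ _
  mul_mem := by
    rintro ⟨p, i, j⟩ ⟨q, k, l⟩
    rw [h.mul_eq]
    split_ifs with hjk
    · subst hjk
      refine Submodule.subset_span ⟨(p + q, i, l), ?_, rfl⟩
      simp only [Set.mem_ofPred_eq, Prod.mk.injEq, true_and]
      ring
    · exact zero_mem _
  bracket_eq := fun ⟨p, i, j⟩ ⟨q, k, l⟩ =>
    Queer.bracket_eq (h.part_mem p i j) (h.part_mem q k l)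
  gr_hom := IsHomogeneousBasis.of_mem h.good.isInternal.submodule_iSupIndep fun _ => h.gr_mem _ _ _
  deg_ne _ := by omega
  apply_par := by
    rintro ⟨p, i, j⟩ hp
    rw [h.apply_eq, if_neg fun h => hp h.1]
  apply_deg := by
    rintro ⟨p, i, j⟩ hp
    rw [h.apply_eq, if_neg fun h => hp ?_]
    have := h.2
    simp only
    omega

theorem bracket_eq (h : IsPrincipalBasis b χ gr) (p q : ZMod 2) (i j k l : Fin (N + 1)) :
    LieSuperalgebra.bracket (b (p, i, j)) (b (q, k, l)) =
      (if j = k then b (p + q, i, l) else 0) -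
        superSign p q • if i = l then b (p + q, k, j) else 0 := by
  rw [Queer.bracket_eq (h.part_mem p i j) (h.part_mem q k l), h.mul_eq, h.mul_eq, add_comm q p]
  simp only [eq_comm (a := l)]

theorem apply_bracket (h : IsPrincipalBasis b χ gr) (p q : ZMod 2) (i j k l : Fin (N + 1)) :
    χ (LieSuperalgebra.bracket (b (p, i, j)) (b (q, k, l))) = if q = p then
      ((if j = k ∧ (i : ℕ) = l + 1 then 1 else 0) -
        paritySign p * if i = l ∧ (k : ℕ) = j + 1 then 1 else 0) else 0 := by
  rw [h.bracket_eq]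
  by_cases hpq : q = p
  · subst hpq
    rw [if_pos rfl, map_sub, map_smul, CharTwo.add_self_eq_zero, smul_eq_mul, paritySign]
    congr 1
    · by_cases hjk : j = k <;> simp [hjk, h.apply_eq]
    · by_cases hil : i = l <;> simp [hil, h.apply_eq]
  · have : p + q ≠ 0 := by
      rw [Ne, CharTwo.add_eq_zero]
      exact fun h => hpq h.symm
    rw [if_neg hpq, map_sub, map_smul]
    have h1 : χ (if j = k then b (p + q, i, l) else 0) = 0 := by
      split_ifs <;> simp [h.apply_eq, this]
    have h2 : χ (if i = l then b (p + q, k, j) else 0) = 0 := by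
      split_ifs <;> simp [h.apply_eq, this]
    rw [h1, h2, smul_zero, sub_zero]

variable (b) in
/-- The basis vectors with natural numbers as indices, zero outside of the range. -/
noncomputable def unit (p : ZMod 2) (i j : ℕ) : Queer (N + 1) :=
  if h : i < N + 1 ∧ j < N + 1 then b (p, ⟨i, h.1⟩, ⟨j, h.2⟩) else 0

theorem unit_fin (p : ZMod 2) (i j : Fin (N + 1)) : unit b p i j = b (p, i, j) := by
  rw [unit, dif_pos ⟨i.2, j.2⟩]

theorem unit_eq_zero (p : ZMod 2) {i j : ℕ} (h : N + 1 ≤ j) : unit b p i j = 0 := by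
  rw [unit, dif_neg]
  omega

variable (b) in
/-- The alternating partial sums of the diagonals. -/
noncomputable def diag (p : ZMod 2) (d i : ℕ) : Queer (N + 1) :=
  ∑ a ∈ Finset.Ico i (N + 1), (paritySign p) ^ (a + i) • unit b p a (a + d)

/-- The exponent `a + i` stands for the distance a - i, which has the same parity. -/
theorem diag_eq (p : ZMod 2) (d : ℕ) {i : ℕ} (hi : i < N + 1) :
    diag b p d i = unit b p i (i + d) + paritySign p • diag b p d (i + 1) := by
  have hs : ∀ k, (paritySign p) ^ (k + k) = 1 := fun k => by
    rw [pow_add, ← mul_pow, paritySign_mul_self, one_pow]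
  rw [diag, Finset.sum_eq_sum_Ico_succ_bot hi, hs, one_smul, diag, Finset.smul_sum]
  congr 1
  refine Finset.sum_congr rfl fun a _ => ?_
  rw [smul_smul, ← add_assoc, pow_succ, mul_comm (paritySign p), _root_.mul_assoc,
    paritySign_mul_self, mul_one]

theorem diag_eq_zero (p : ZMod 2) {d i : ℕ} (h : N + 1 ≤ i + d) : diag b p d i = 0 := by
  refine Finset.sum_eq_zero fun a ha => ?_
  rw [Finset.mem_Ico] at ha
  rw [unit_eq_zero p (by omega), smul_zero]

theorem unit_mem_part (h : IsPrincipalBasis b χ gr) (p : ZMod 2) (i j : ℕ) :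
    unit b p i j ∈ LieSuperalgebra.part (g := Queer (N + 1)) p := by
  unfold unit
  split_ifs
  · exact h.part_mem _ _ _
  · exact zero_mem _

theorem diag_mem_part (h : IsPrincipalBasis b χ gr) (p : ZMod 2) (d i : ℕ) :
    diag b p d i ∈ LieSuperalgebra.part (g := Queer (N + 1)) p :=
  Submodule.sum_mem _ fun _ _ => Submodule.smul_mem _ _ (h.unit_mem_part _ _ _)

theorem diag_mem_gr (h : IsPrincipalBasis b χ gr) (p : ZMod 2) (d i : ℕ) :
    diag b p d i ∈ gr (2 * d) := by
  refine Submodule.sum_mem _ fun a _ => Submodule.smul_mem _ _ ?_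
  unfold unit
  split_ifs with hab
  · have := h.gr_mem p ⟨a, hab.1⟩ ⟨a + d, hab.2⟩
    convert this using 2
    simp
  · exact zero_mem _

/-- Pairing a diagonal with a matrix unit in row l + d + 1 and column l meets two entries, a = l and
a = l + 1, and their contributions cancel. The alternating sign for odd p offsets the plus sign in
the odd bracket. -/
theorem diag_mem_annihilator (h : IsPrincipalBasis b χ gr) (p : ZMod 2) (d : ℕ) :
    diag b p d 0 ∈ annihilator χ := by
  intro y
  have : χ ∘ₗ LieSuperalgebra.bracket (diag b p d 0) = 0 := by
    refine b.ext ?_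
    rintro ⟨q, r, l⟩
    -- Each term is written as a difference supported at a = l + 1 and a = l with a common value,
    -- which makes the sum collapse.
    have e : ∀ a ∈ Finset.Ico 0 (N + 1), (paritySign p) ^ (a + 0) *
        χ (LieSuperalgebra.bracket (unit b p a (a + d)) (b (q, r, l))) =
        (if a = l + 1 then (if q = p ∧ (r : ℕ) = l + d + 1 then (paritySign p) ^ ((l : ℕ) + 1) else 0)
          else 0) -
        if a = l then (if q = p ∧ (r : ℕ) = l + d + 1 then (paritySign p) ^ ((l : ℕ) + 1) else 0)
          else 0 := by
      intro a ha
      rw [Finset.mem_Ico] at ha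
      by_cases hd : a + d < N + 1
      · rw [unit, dif_pos ⟨ha.2, hd⟩, h.apply_bracket]
        by_cases hq : q = p
        · simp only [hq, if_true, Fin.ext_iff, true_and, add_zero]
          by_cases h1 : a = l + 1
          · have h2 : ¬ a = (l : ℕ) := by omega
            have h3 : (a + d = r ∧ a = (l : ℕ) + 1) ↔ (r : ℕ) = l + d + 1 := by omega
            have h4 : ¬ (a = (l : ℕ) ∧ (r : ℕ) = a + d + 1) := fun h => h2 h.1
            simp only [h3, if_neg h2, if_neg h4, if_pos h1, mul_zero, sub_zero, mul_ite, mul_one]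
            rw [h1]
          · have h3 : ¬ (a + d = r ∧ a = (l : ℕ) + 1) := fun h => h1 h.2
            by_cases h2 : a = (l : ℕ)
            · have h4 : (a = (l : ℕ) ∧ (r : ℕ) = a + d + 1) ↔ (r : ℕ) = l + d + 1 := by omega
              simp only [h4, if_neg h3, if_neg h1, if_pos h2, mul_ite, mul_one, mul_zero, zero_sub,
                mul_neg]
              rw [h2, pow_succ]
            · simp [h1, h2]
        · simp [hq]
      · have hr := r.2
        have h1 : a = (l : ℕ) + 1 → ¬ (r : ℕ) = l + d + 1 := by omega
        have h2 : a = (l : ℕ) → ¬ (r : ℕ) = l + d + 1 := by omega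
        rw [unit_eq_zero p (by omega)]
        simp only [map_zero, LinearMap.zero_apply, mul_zero]
        by_cases h3 : a = (l : ℕ) + 1
        · have h4 : ¬ a = (l : ℕ) := by omega
          simp [h4, h1 h3]
        · by_cases h4 : a = (l : ℕ)
          · simp [h3, h2 h4]
          · simp [h3, h4]
    simp only [LinearMap.comp_apply, diag, map_sum, map_smul, LinearMap.sum_apply,
      LinearMap.smul_apply, smul_eq_mul, LinearMap.zero_apply]
    rw [Finset.sum_congr rfl e, Finset.sum_sub_distrib, Finset.sum_ite_eq', Finset.sum_ite_eq']
    have hl := l.2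
    have hr := r.2
    by_cases h1 : q = p ∧ (r : ℕ) = l + d + 1
    · rw [if_pos (Finset.mem_Ico.2 ⟨Nat.zero_le _, by omega⟩),
        if_pos (Finset.mem_Ico.2 ⟨Nat.zero_le _, by omega⟩), sub_self]
    · simp [h1]
  exact LinearMap.congr_fun this y

end IsPrincipalBasis


/-! ### The slice, the basis of g^χ and the Sergeev generators -/

namespace IsPrincipalBasis

variable {N : ℕ} {b : Module.Basis (ZMod 2 × Fin (N + 1) × Fin (N + 1)) ℂ (Queer (N + 1))}
  {χ : Queer (N + 1) →ₗ[ℂ] ℂ} {gr : ℤ → Submodule ℂ (Queer (N + 1))}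

/-- The diagonals as elements of `g^χ`. -/
noncomputable def vec (h : IsPrincipalBasis b χ gr) (q : ZMod 2 × Fin (N + 1)) : annihilator χ :=
  ⟨diag b q.1 q.2 0, h.diag_mem_annihilator q.1 q.2⟩

/-- The projection onto `g^χ` given by the first rows. -/
noncomputable def proj (h : IsPrincipalBasis b χ gr) : Queer (N + 1) →ₗ[ℂ] annihilator χ :=
  b.constr ℂ fun q => if q.2.1 = 0 then h.vec (q.1, q.2.2) else 0

theorem proj_basis (h : IsPrincipalBasis b χ gr) (p : ZMod 2) (i j : Fin (N + 1)) :
    h.proj (b (p, i, j)) = if i = 0 then h.vec (p, j) else 0 :=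
  b.constr_basis _ _ _

variable (b) in
/-- The complement of `g^χ` dual to the strictly lower triangular vectors. -/
noncomputable def slice (q : ZMod 2 × Fin (N + 1) × Fin (N + 1)) : Queer (N + 1) :=
  if q.2.2 < q.2.1 then diag b q.1 ((q.2.1 : ℕ) - q.2.2 - 1) (q.2.2 + 1) else 0

/-- The functional χ([e_ij, ·]) sees only the units (j, i - 1) and (j + 1, i), whose slice vectors
are the partial diagonals starting in rows i and i + 1. Their signed difference is e_ij by
`diag_eq`; for i = 0 the first of them is instead the full diagonal, which lies in g^χ. -/
theorem basis_eq (h : IsPrincipalBasis b χ gr) (p : ZMod 2) {i j : Fin (N + 1)} (hij : i ≤ j) :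
    b (p, i, j) = (h.proj (b (p, i, j)) : Queer (N + 1)) +
      ∑ q, χ (LieSuperalgebra.bracket (b (p, i, j)) (b q)) • slice b q := by
  have hij' : (i : ℕ) ≤ j := hij
  have hj := j.2
  have h1 : ∑ r, ∑ l : Fin (N + 1), (if j = r ∧ (i : ℕ) = l + 1 then (1 : ℂ) else 0) • slice b (p, r, l) =
      if i = 0 then 0 else diag b p (j - i) i := by
    rw [Finset.sum_eq_single j]
    · split_ifs with hi
      · refine Finset.sum_eq_zero fun l _ => ?_
        rw [if_neg, zero_smul]
        simp [hi]
      · have hi' : (i : ℕ) ≠ 0 := fun h => hi (Fin.ext h)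
        rw [Finset.sum_eq_single ⟨i - 1, by omega⟩]
        · rw [if_pos ⟨rfl, by simp; omega⟩, one_smul, slice, if_pos (by rw [Fin.lt_def]; simp; omega)]
          simp only
          congr 1 <;> omega
        · intro l _ hl
          rw [if_neg, zero_smul]
          rintro ⟨-, hil⟩
          exact hl (Fin.ext (by simp; omega))
        · simp
    · intro r _ hr
      simp [Ne.symm hr]
    · simp
  have h2 : ∑ r : Fin (N + 1), ∑ l, (if i = l ∧ (r : ℕ) = j + 1 then (1 : ℂ) else 0) • slice b (p, r, l) =
      diag b p (j - i) (i + 1) := by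
    rw [Finset.sum_comm, Finset.sum_eq_single i]
    · by_cases hN : (j : ℕ) = N
      · rw [diag_eq_zero p (by omega)]
        refine Finset.sum_eq_zero fun r _ => ?_
        rw [if_neg, zero_smul]
        have := r.2
        omega
      · rw [Finset.sum_eq_single ⟨j + 1, by omega⟩]
        · rw [if_pos ⟨rfl, rfl⟩, one_smul, slice, if_pos (by rw [Fin.lt_def]; simp; omega)]
          simp only
          congr 1
          omega
        · intro l _ hl
          rw [if_neg, zero_smul]
          rintro ⟨-, hil⟩
          exact hl (Fin.ext hil)
        · simp
    · intro r _ hr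
      simp [Ne.symm hr]
    · simp
  have h3 : ∑ q, χ (LieSuperalgebra.bracket (b (p, i, j)) (b q)) • slice b q =
      (if i = 0 then 0 else diag b p (j - i) i) - paritySign p • diag b p (j - i) (i + 1) := by
    rw [Fintype.sum_prod_type, Finset.sum_eq_single p, Fintype.sum_prod_type, ← h1, ← h2,
      Finset.smul_sum, ← Finset.sum_sub_distrib]
    · refine Finset.sum_congr rfl fun r _ => ?_
      rw [Finset.smul_sum, ← Finset.sum_sub_distrib]
      refine Finset.sum_congr rfl fun l _ => ?_
      rw [h.apply_bracket, if_pos rfl, sub_smul, mul_smul]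
    · intro q _ hq
      rw [Fintype.sum_prod_type]
      refine Finset.sum_eq_zero fun r _ => Finset.sum_eq_zero fun l _ => ?_
      rw [h.apply_bracket, if_neg hq, zero_smul]
    · simp
  have h4 := diag_eq (b := b) p ((j : ℕ) - i) i.2
  rw [Nat.add_sub_cancel' hij', unit_fin] at h4
  rw [h3, h.proj_basis]
  split_ifs with hi
  · subst hi
    rw [vec]
    simp only [Fin.val_zero, Nat.sub_zero] at h4 ⊢
    rw [h4]
    abel
  · rw [h4]
    simp

/-- Goodness places g^χ in nonnegative degrees, where the decomposition `basis_eq` holds, and χ([v,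
·]) = 0 removes its slice terms. In particular g^χ is spanned by the diagonals. -/
theorem proj_apply (h : IsPrincipalBasis b χ gr) (v : annihilator χ) : h.proj v = v := by
  apply Subtype.ext
  let F : Queer (N + 1) →ₗ[ℂ] Queer (N + 1) := (annihilator χ).subtype ∘ₗ h.proj +
    ∑ q, (LinearMap.toSpanSingleton ℂ (Queer (N + 1)) (slice b q)) ∘ₗ χ ∘ₗ
      (LieSuperalgebra.bracket (g := Queer (N + 1))).flip (b q)
  have hF : ∀ x, F x = h.proj x + ∑ q, χ (LieSuperalgebra.bracket x (b q)) • slice b q := by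
    intro x
    simp [F]
  have hle : ⨆ j : ℤ, ⨆ _ : 0 ≤ j, gr j ≤ LinearMap.ker (F - LinearMap.id) := by
    refine iSup_le fun d => iSup_le fun hd => h.isWhittakerDatum.gr_hom.induction ?_
    rintro ⟨p, i, j⟩ hq
    simp only at hq
    rw [LinearMap.mem_ker, LinearMap.sub_apply, hF, ← h.basis_eq p (by rw [Fin.le_def]; omega)]
    simp
  have := hle (h.good.annihilator_le v.2)
  rw [LinearMap.mem_ker, LinearMap.sub_apply, hF, sub_eq_zero] at this
  have hv : ∀ y, χ (LieSuperalgebra.bracket (v : Queer (N + 1)) y) = 0 := v.2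
  simp only [hv, zero_smul, Finset.sum_const_zero, add_zero] at this
  exact this

theorem isSlice (h : IsPrincipalBasis b χ gr) :
    IsSlice b (fun q => q.1) (fun q => 2 * ((q.2.2 : ℤ) - (q.2.1 : ℤ))) χ h.proj (slice b) where
  proj_neg := by
    rintro ⟨p, i, j⟩ hq
    rw [h.proj_basis, if_neg]
    rintro rfl
    simp at hq
    omega
  proj_id := h.proj_apply
  proj_mem := by
    rintro ⟨p, i, j⟩
    rw [h.proj_basis]
    split_ifs
    · exact h.diag_mem_part _ _ _
    · exact zero_mem _
  slice_mem := by
    rintro ⟨p, i, j⟩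
    unfold slice
    split_ifs
    · exact h.diag_mem_part _ _ _
    · exact zero_mem _
  slice_eq := by
    rintro ⟨p, i, j⟩ hq
    rw [slice, if_neg]
    simp only [Fin.lt_def] at hq ⊢
    omega
  decomp := by
    rintro ⟨p, i, j⟩ hq
    refine h.basis_eq p ?_
    rw [Fin.le_def]
    simp only at hq
    omega

/-- The first row entries of the diagonals form an identity matrix, which gives their independence.
-/
theorem coord_diag (p q : ZMod 2) (k l : Fin (N + 1)) :
    b.coord (p, 0, k) (diag b q l 0) = if (p, k) = (q, l) then 1 else 0 := by
  have h0 : b.coord (p, 0, k) (diag b q l 1) = 0 := by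
    rw [diag, map_sum]
    refine Finset.sum_eq_zero fun a ha => ?_
    rw [Finset.mem_Ico] at ha
    rw [map_smul, unit]
    split_ifs with hd
    · have : (q, (⟨a, hd.1⟩ : Fin (N + 1)), (⟨a + l, hd.2⟩ : Fin (N + 1))) ≠ (p, 0, k) := by
        simp only [ne_eq, Prod.mk.injEq, Fin.ext_iff, Fin.val_zero]
        omega
      rw [Module.Basis.coord_apply, Module.Basis.repr_self, Finsupp.single_eq_of_ne' this, smul_zero]
    · simp
  have h1 := unit_fin (b := b) q 0 l
  rw [Fin.val_zero] at h1
  rw [diag_eq q l (Nat.succ_pos N), zero_add, zero_add, h1, map_add, map_smul, h0, smul_zero,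
    add_zero, Module.Basis.coord_apply, Module.Basis.repr_self, Finsupp.single_apply]
  simp only [Prod.mk.injEq, true_and, eq_comm]

/-- The basis of `g^χ` given by the diagonals. -/
noncomputable def annBasis (h : IsPrincipalBasis b χ gr) :
    Module.Basis (ZMod 2 × Fin (N + 1)) ℂ (annihilator χ) :=
  Module.Basis.mk (v := h.vec)
    (LinearIndependent.of_pairwise_dual_eq_zero_one _
      (fun q => b.coord (q.1, 0, q.2) ∘ₗ (annihilator χ).subtype)
      (fun q r hqr => (coord_diag _ _ _ _).trans (if_neg hqr))
      (fun q => (coord_diag _ _ _ _).trans (if_pos rfl)))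
    (by
      rintro v -
      rw [← h.proj_apply v]
      have : LinearMap.range h.proj ≤ Submodule.span ℂ (Set.range h.vec) := by
        rw [LinearMap.range_eq_map, ← b.span_eq, Submodule.map_span_le]
        rintro _ ⟨⟨p, i, j⟩, rfl⟩
        rw [h.proj_basis]
        split_ifs
        · exact Submodule.subset_span ⟨_, rfl⟩
        · exact zero_mem _
      exact this ⟨_, rfl⟩)

theorem annBasis_apply (h : IsPrincipalBasis b χ gr) (q : ZMod 2 × Fin (N + 1)) :
    h.annBasis q = h.vec q :=
  Module.Basis.mk_apply _ _ _

theorem isAnnihilatorBasis (h : IsPrincipalBasis b χ gr) :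
    IsAnnihilatorBasis b (fun q => q.1) (fun q => 2 * ((q.2.2 : ℤ) - (q.2.1 : ℤ)))
      (Queer.mul (N + 1)) χ gr h.proj (slice b) h.annBasis (fun q => q.1)
      (fun q => 2 * (q.2 : ℤ)) where
  toIsWhittakerDatum := h.isWhittakerDatum
  toIsSlice := h.isSlice
  hom_par := by
    refine IsHomogeneousBasis.of_mem (LieSuperalgebra.iSupIndep_part.submoduleOf _) fun q => ?_
    rw [annBasis_apply]
    exact h.diag_mem_part _ _ _
  hom_deg := by
    refine IsHomogeneousBasis.of_mem
      (h.good.isInternal.submodule_iSupIndep.submoduleOf _) fun q => ?_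
    rw [annBasis_apply]
    exact h.diag_mem_gr _ _ _
  proj_deg := by
    rintro ⟨p, i, j⟩
    rw [h.proj_basis]
    split_ifs with hi
    · subst hi
      rw [Fin.val_zero, Nat.cast_zero, sub_zero]
      exact h.diag_mem_gr p j 0
    · exact zero_mem _
  deg_nonneg _ := by positivity

variable (b) in
/-- Sergeev's generators of the finite W-algebra, together with their symbols. -/
noncomputable def generator (q : ZMod 2 × Fin (N + 1)) :
    Env (Queer (N + 1)) × SuperSym (LieSuperalgebra.part (g := Queer (N + 1))) :=
  (paritySign q.1) ^ (q.2 : ℕ) •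
    sergeev (fun p i j => (Env.X b (p, i, j), SuperSym.X LieSuperalgebra.part b (p, i, j)))
      (N + 1 + q.2) q.1 (Fin.last N) 0

/-- The corner position contributes -2N and the N + 1 + k letters contribute 2(N + 1 + k), leaving
2k + 2, the Kazhdan degree of the k-th diagonal. -/
theorem generator_mem (q : ZMod 2 × Fin (N + 1)) :
    generator b q ∈ IsAssocGraded.pairs (Queer (N + 1)) b
      (fun q => (q.1, 2 * ((q.2.2 : ℤ) - (q.2.1 : ℤ)) + 2)) (q.1, 2 * (q.2 : ℤ) + 2) := by
  refine Submodule.smul_mem _ _ ?_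
  have := sergeev_mem_wordSpan
    (fun i => (Env.X b i, SuperSym.X (LieSuperalgebra.part (g := Queer (N + 1))) b i))
    (N + 1 + q.2) q.1 (Fin.last N) 0
  convert this using 2
  ext
  · rfl
  · simp
    ring

theorem generator_fst (q : ZMod 2 × Fin (N + 1)) :
    (generator b q).1 = (paritySign q.1) ^ (q.2 : ℕ) •
      sergeev (fun p i j => Env.X b (p, i, j)) (N + 1 + q.2) q.1 (Fin.last N) 0 := by
  rw [generator, Prod.smul_fst]
  exact congrArg _ (map_sergeev (AlgHom.fst ℂ (Env (Queer (N + 1)))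
    (SuperSym (LieSuperalgebra.part (g := Queer (N + 1))))) _ _ _ _ _)

theorem generator_snd (q : ZMod 2 × Fin (N + 1)) :
    (generator b q).2 = (paritySign q.1) ^ (q.2 : ℕ) •
      sergeev (fun p i j => SuperSym.X LieSuperalgebra.part b (p, i, j)) (N + 1 + q.2) q.1
        (Fin.last N) 0 := by
  rw [generator, Prod.smul_snd]
  exact congrArg _ (map_sergeev (AlgHom.snd ℂ (Env (Queer (N + 1)))
    (SuperSym (LieSuperalgebra.part (g := Queer (N + 1))))) _ _ _ _ _)

/-- A strictly lower triangular unit has row index ≠ 0 and column index ≠ N, so both correction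
terms in `mul_sergeev` vanish for the corner entry. The factor a - χ(a) can therefore be moved to
the right, into the left ideal. -/
theorem shifted_mul_generator_mem (h : IsPrincipalBasis b χ gr) (k : ZMod 2 × Fin (N + 1))
    (i : ZMod 2 × Fin (N + 1) × Fin (N + 1)) (hi : 2 * ((i.2.2 : ℤ) - (i.2.1 : ℤ)) < 0) :
    (IsWhittakerDatum.shifted b χ i).1 * (generator b k).1 ∈ whittakerIdeal χ gr ⊥ := by
  obtain ⟨q, i, j⟩ := i
  simp only at hi
  have hj : j ≠ Fin.last N := by
    rintro rfl
    have := i.2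
    simp at hi
    omega
  have hi0 : i ≠ 0 := by
    rintro rfl
    simp at hi
    omega
  have hcomm := mul_sergeev (fun p i j => Env.X b (p, i, j)) (fun q i j r k l => by
    simp only [Env.X]
    rw [Env.ι_mul_ι (h.part_mem q i j) (h.part_mem r k l), h.bracket_eq, map_sub, map_smul]
    congr 2
    · split_ifs <;> simp
    · split_ifs <;> simp) (N + 1 + k.2) k.1 q i j (Fin.last N) 0
  rw [if_neg hj, if_neg hi0, smul_zero, smul_zero, sub_zero, add_zero] at hcomm
  have hχ : χ (b (q, i, j)) * superSign q k.1 = χ (b (q, i, j)) := by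
    rw [h.apply_eq]
    split_ifs with hq
    · simp [hq.1]
    · simp
  have e : (IsWhittakerDatum.shifted b χ (q, i, j)).1 * (generator b k).1 =
      superSign q k.1 • ((generator b k).1 * (IsWhittakerDatum.shifted b χ (q, i, j)).1) := by
    rw [IsWhittakerDatum.shifted, generator_fst, sub_mul, mul_sub, mul_smul_comm, hcomm,
      ← Algebra.smul_def, ← Algebra.commutes, ← Algebra.smul_def, smul_mul_assoc, smul_sub,
      smul_comm (superSign q k.1), smul_smul (superSign q k.1), mul_comm (superSign q k.1), hχ]
  rw [e]
  refine Submodule.smul_of_tower_mem _ _ (Submodule.smul_mem _ _ (Submodule.subset_span ?_))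
  exact ⟨b (q, i, j), Submodule.mem_sup_left (Submodule.mem_iSup_of_mem _
    (Submodule.mem_iSup_of_mem (by omega) (h.gr_mem q i j))), rfl⟩

/-- Restriction sends the generic matrix to ones below the diagonal plus the basis of g^χ in the
first row, the shape treated in `sergeev_dualNumber`. -/
theorem dual_restr_generator (h : IsPrincipalBasis b χ gr) (k : ZMod 2 × Fin (N + 1))
    (f : annihilator χ →ₗ[ℂ] ℂ) :
    SuperSym.dual (annihilatorPart χ) f (h.isAnnihilatorBasis.restr (generator b k).2) =
      TrivSqZeroExt.inr (f (h.annBasis k)) := by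
  let F := (SuperSym.dual (annihilatorPart χ) f).comp h.isAnnihilatorBasis.restr
  have hF : ∀ p i j, F (SuperSym.X LieSuperalgebra.part b (p, i, j)) =
      χ (b (p, i, j)) • 1 + TrivSqZeroExt.inr (f (h.proj (b (p, i, j)))) := by
    intro p i j
    rw [AlgHom.comp_apply, IsAnnihilatorBasis.restr_X, map_add, map_smul, map_one,
      SuperSym.dual_ι]
  change F (generator b k).2 = _
  -- The sign in the definition of `generator` cancels the sign produced here, so that the linear
  -- part is exactly the basis vector.
  rw [generator_snd, map_smul, map_sergeev, sergeev_dualNumber _ (fun p j => f (h.vec (p, j)))]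
  · rw [← TrivSqZeroExt.inr_smul, smul_eq_mul, ← _root_.mul_assoc, ← mul_pow, paritySign_mul_self, one_pow,
      one_mul, annBasis_apply]
  · intro p i j hi
    rw [hF, h.proj_basis, if_neg hi, h.apply_eq]
    simp
  · intro p j
    rw [hF, h.proj_basis, if_pos rfl, h.apply_eq]
    simp

theorem exists_algEquiv (h : IsPrincipalBasis b χ gr) :
    ∃ φ : SymAnn χ ≃ₐ[ℂ] GrW χ gr ⊥, ∀ (p : ZMod 2) (k : ℤ),
      (SymAnn.bidegree χ gr p k).map φ.toLinearMap = GrW.bidegree χ gr ⊥ p k :=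
  h.isAnnihilatorBasis.bidegree_map_eq (fun k => (generator b k).1) (fun k => (generator b k).2)
    generator_mem h.shifted_mul_generator_mem h.dual_restr_generator

theorem finrank_annihilator_inf_part (h : IsPrincipalBasis b χ gr) (p : ZMod 2) :
    Module.finrank ℂ ↥(annihilator χ ⊓ LieSuperalgebra.part p) = N + 1 := by
  have h1 := h.isAnnihilatorBasis.hom_par.finrank_eq p
  rw [annihilatorPart, Submodule.submoduleOf] at h1
  rw [← Submodule.map_comap_subtype, Submodule.finrank_map_subtype_eq, h1]
  have e : {q : ZMod 2 × Fin (N + 1) // q.1 = p} ≃ Fin (N + 1) :=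
    { toFun := fun q => q.1.2
      invFun := fun k => ⟨(p, k), rfl⟩
      left_inv := by
        rintro ⟨⟨q, k⟩, rfl⟩
        rfl
      right_inv := fun _ => rfl }
  rw [Fintype.card_congr e, Fintype.card_fin]

theorem gr_neg_one_eq_bot (h : IsPrincipalBasis b χ gr) : gr (-1) = ⊥ := by
  rw [h.isWhittakerDatum.gr_hom (-1), Submodule.span_eq_bot]
  rintro _ ⟨⟨p, i, j⟩, hq, rfl⟩
  simp only [Set.mem_ofPred_eq] at hq
  omega

end IsPrincipalBasis


/-! ### Commutants of nilpotent endomorphisms -/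

section Commutant

variable {V : Type} [AddCommGroup V] [Module ℂ V]

/-- The endomorphisms commuting with `f`. -/
def commutant (f : V →ₗ[ℂ] V) : Submodule ℂ (V →ₗ[ℂ] V) where
  carrier := {a | ∀ v, f (a v) = a (f v)}
  add_mem' := by
    intro a b ha hb v
    simp [ha v, hb v]
  zero_mem' := by
    intro v
    simp
  smul_mem' := by
    intro c a ha v
    simp [ha v]

instance (f : V →ₗ[ℂ] V) : Module.Free ℂ (commutant f) := inferInstance

instance [FiniteDimensional ℂ V] (f : V →ₗ[ℂ] V) : FiniteDimensional ℂ (commutant f) :=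
  inferInstance

/-- An endomorphism B of the range commuting with f extends to V: on a complement of the range the
value must be an f-preimage of B(f v), supplied by a section s of f. The extension may be altered by
any map from V modulo the range to the kernel, and both of these spaces have the dimension of the
kernel. -/
theorem finrank_commutant_restrict_add_le [FiniteDimensional ℂ V] (f : V →ₗ[ℂ] V)
    (hf : ∀ x ∈ LinearMap.range f, f x ∈ LinearMap.range f) :
    Module.finrank ℂ (commutant (f.restrict hf)) +
      Module.finrank ℂ (LinearMap.ker f) * Module.finrank ℂ (LinearMap.ker f) ≤
      Module.finrank ℂ (commutant f) := by
  obtain ⟨s, hs⟩ := f.rangeRestrict.exists_rightInverse_of_surjective f.range_rangeRestrict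
  obtain ⟨π, hπ⟩ := (LinearMap.range f).subtype.exists_leftInverse_of_injective
    (Submodule.ker_subtype _)
  have hs' : ∀ x, f (s x) = x := fun x => congrArg Subtype.val (LinearMap.congr_fun hs x)
  have hπ' : ∀ x : LinearMap.range f, π x = x := fun x => LinearMap.congr_fun hπ x
  let E : (LinearMap.range f →ₗ[ℂ] LinearMap.range f) × (V ⧸ LinearMap.range f →ₗ[ℂ] LinearMap.ker f) →ₗ[ℂ]
      V →ₗ[ℂ] V :=
    { toFun := fun q => (LinearMap.range f).subtype ∘ₗ q.1 ∘ₗ π +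
        s ∘ₗ q.1 ∘ₗ (f.rangeRestrict - f.rangeRestrict ∘ₗ (LinearMap.range f).subtype ∘ₗ π) +
        (LinearMap.ker f).subtype ∘ₗ q.2 ∘ₗ (LinearMap.range f).mkQ
      map_add' := by
        intro q r
        ext v
        simp
        abel
      map_smul' := by
        intro c q
        ext v
        simp [smul_sub] }
  have hE : ∀ q v, E q v = q.1 (π v) + s (q.1 (f.rangeRestrict v - f.rangeRestrict (π v))) +
      q.2 ((LinearMap.range f).mkQ v) := fun q v => rfl
  have hEr : ∀ q, ∀ x : LinearMap.range f, E q x = q.1 x := by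
    intro q x
    rw [hE, hπ', sub_self, map_zero, map_zero, add_zero, Submodule.mkQ_apply,
      (Submodule.Quotient.mk_eq_zero _).2 x.2, map_zero, ZeroMemClass.coe_zero, add_zero]
  have hEi : Function.Injective E := by
    rw [← LinearMap.ker_eq_bot, LinearMap.ker_eq_bot']
    rintro ⟨B, T⟩ h
    have hB : B = 0 := by
      ext x
      rw [← hEr (B, T) x, h]
      rfl
    subst hB
    congr 1
    ext v
    have := LinearMap.congr_fun h v
    simpa [hE] using this
  have hEc : ∀ q : commutant (f.restrict hf) × (V ⧸ LinearMap.range f →ₗ[ℂ] LinearMap.ker f),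
      E (q.1, q.2) ∈ commutant f := by
    rintro ⟨⟨B, hB⟩, T⟩
    have hB' : ∀ x : LinearMap.range f, f (B x) = B (f.rangeRestrict x) := fun x =>
      congrArg Subtype.val (hB x)
    intro v
    have e : f v = (f.rangeRestrict v : V) := rfl
    rw [e, hEr, hE, map_add, map_add, hs', hB']
    have hk : f (T ((LinearMap.range f).mkQ v) : V) = 0 := (T ((LinearMap.range f).mkQ v)).2
    simp only
    rw [hk, add_zero, ← Submodule.coe_add, ← map_add, add_sub_cancel]
  let G : commutant (f.restrict hf) × (V ⧸ LinearMap.range f →ₗ[ℂ] LinearMap.ker f) →ₗ[ℂ]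
      commutant f :=
    (E ∘ₗ LinearMap.prodMap (commutant (f.restrict hf)).subtype LinearMap.id).codRestrict _ hEc
  have hG : Function.Injective G := by
    intro q r hqr
    have := hEi (congrArg Subtype.val hqr : E (q.1, q.2) = E (r.1, r.2))
    have h1 : (q.1 : LinearMap.range f →ₗ[ℂ] LinearMap.range f) = r.1 := congrArg (fun x => x.1) this
    have h2 : q.2 = r.2 := congrArg (fun x => x.2) this
    exact Prod.ext (Subtype.ext h1) h2
  have := LinearMap.finrank_le_finrank_of_injective hG
  rw [Module.finrank_prod, Module.finrank_linearMap] at this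
  have h1 := Submodule.finrank_quotient_add_finrank (LinearMap.range f)
  have h2 := LinearMap.finrank_range_add_finrank_ker f
  rwa [show Module.finrank ℂ (V ⧸ LinearMap.range f) = Module.finrank ℂ (LinearMap.ker f) by omega]
    at this

/-- Induction on the dimension n. If the kernel has dimension r ≥ 1, the centraliser has dimension
at least (n - r) + r², which is at least n, with equality only for r = 1. -/
theorem finrank_le_finrank_commutant [FiniteDimensional ℂ V] {f : Module.End ℂ V}
    (hf : IsNilpotent f) : Module.finrank ℂ V ≤ Module.finrank ℂ (commutant f) ∧
      (Module.finrank ℂ (commutant f) ≤ Module.finrank ℂ V →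
        Module.finrank ℂ (LinearMap.ker f) ≤ 1) := by
  induction hn : Module.finrank ℂ V using Nat.strong_induction_on generalizing V with
  | _ n ih =>
    have h2 := LinearMap.finrank_range_add_finrank_ker f
    by_cases hr : Module.finrank ℂ (LinearMap.ker f) = 0
    · have hinj : Function.Injective f := by
        rw [← LinearMap.ker_eq_bot]
        exact Submodule.finrank_eq_zero.1 hr
      obtain ⟨k, hk⟩ := hf
      have : Function.Injective (f ^ k) := by
        rw [Module.End.coe_pow]
        exact hinj.iterate k
      have hs : Subsingleton V := by
        refine ⟨fun x y => this ?_⟩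
        rw [hk]
        rfl
      have : Module.finrank ℂ V = 0 := Module.finrank_zero_of_subsingleton
      omega
    · have hfr : ∀ x ∈ LinearMap.range f, f x ∈ LinearMap.range f := fun x _ => ⟨x, rfl⟩
      have hle := finrank_commutant_restrict_add_le f hfr
      have h3 := (ih _ (by omega) (f := f.restrict hfr) (Module.End.isNilpotent.restrict hfr hf) rfl).1
      constructor
      · nlinarith [Nat.pos_of_ne_zero hr]
      · intro h
        nlinarith [Nat.pos_of_ne_zero hr]

/-- f maps ker f^{k+1} to ker f^k with kernel inside ker f, so each step adds at most one dimension.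
-/
theorem finrank_ker_pow_le [FiniteDimensional ℂ V] {f : Module.End ℂ V}
    (hf : Module.finrank ℂ (LinearMap.ker f) ≤ 1) (k : ℕ) :
    Module.finrank ℂ (LinearMap.ker (f ^ k)) ≤ k := by
  induction k with
  | zero => simp [Module.End.one_eq_id]
  | succ k ih =>
    have hm : ∀ x ∈ LinearMap.ker (f ^ (k + 1)), f x ∈ LinearMap.ker (f ^ k) := by
      intro x hx
      rwa [LinearMap.mem_ker, ← Module.End.mul_apply, ← pow_succ]
    have h1 := LinearMap.finrank_range_add_finrank_ker (f.restrict hm)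
    have h2 := Submodule.finrank_le (LinearMap.range (f.restrict hm))
    have h3 : Module.finrank ℂ (LinearMap.ker (f.restrict hm)) ≤
        Module.finrank ℂ (LinearMap.ker f) := by
      refine LinearMap.finrank_le_finrank_of_injective (f := (Submodule.subtype _ ∘ₗ
        Submodule.subtype _ : LinearMap.ker (f.restrict hm) →ₗ[ℂ] V).codRestrict _ fun x => ?_) ?_
      · exact congrArg Subtype.val x.2
      · intro x y hxy
        have : ((x : LinearMap.ker (f ^ (k + 1))) : V) = (y : LinearMap.ker (f ^ (k + 1))) :=
          congrArg (fun z : LinearMap.ker f => (z : V)) hxy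
        exact Subtype.ext (Subtype.ext this)
    omega

theorem pow_ne_zero_of_finrank_commutant_le [FiniteDimensional ℂ V] {f : Module.End ℂ V}
    (hf : IsNilpotent f) (h : Module.finrank ℂ (commutant f) ≤ Module.finrank ℂ V) {k : ℕ}
    (hk : k < Module.finrank ℂ V) : f ^ k ≠ 0 := by
  intro h0
  have := finrank_ker_pow_le ((finrank_le_finrank_commutant hf).2 h) k
  rw [h0, LinearMap.ker_zero, finrank_top] at this
  omega

end Commutant


/-! ### Regular nilpotent functionals -/

namespace Queer

open Matrix

variable {n : ℕ}

/-- The even functional `(A, B) ↦ tr(M A)`. -/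
noncomputable def traceFunctional (M : Matrix (Fin n) (Fin n) ℂ) : Queer n →ₗ[ℂ] ℂ :=
  Matrix.traceLinearMap (Fin n) ℂ ℂ ∘ₗ LinearMap.mulLeft ℂ M ∘ₗ LinearMap.fst ℂ _ _

@[simp] theorem traceFunctional_apply (M : Matrix (Fin n) (Fin n) ℂ) (x : Queer n) :
    traceFunctional M x = (M * x.1).trace := rfl

theorem isEvenFunctional_traceFunctional (M : Matrix (Fin n) (Fin n) ℂ) :
    IsEvenFunctional (traceFunctional M) := by
  intro x hx
  rw [traceFunctional_apply, (mem_part_one x).1 hx, mul_zero, trace_zero]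

theorem exists_eq_traceFunctional {χ : Queer n →ₗ[ℂ] ℂ} (hχ : IsEvenFunctional χ) :
    ∃ M, χ = traceFunctional M := by
  refine ⟨Matrix.of fun i j => χ (single j i 1, 0), LinearMap.prod_ext ?_ ?_⟩
  · refine Matrix.ext_linearMap _ fun i j => LinearMap.ext_ring ?_
    simp [trace_mul_single]
  · ext1 B
    rw [LinearMap.comp_apply, LinearMap.comp_apply, hχ _ ((mem_part_one _).2 rfl)]
    simp

theorem traceFunctional_conj (M : Matrix (Fin n) (Fin n) ℂ) (u : GL (Fin n) ℂ) (x : Queer n) :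
    traceFunctional M ((u⁻¹).val * x.1 * u.val, (u⁻¹).val * x.2 * u.val) =
      traceFunctional (u.val * M * (u⁻¹).val) x := by
  rw [traceFunctional_apply, traceFunctional_apply, ← Matrix.mul_assoc, ← Matrix.mul_assoc, trace_mul_comm]
  simp only [Matrix.mul_assoc]

/-- The characteristic determinant is continuous in the functional and constant on orbits, hence
equal at M and at 0. Cayley-Hamilton then gives the power. -/
theorem pow_eq_zero_of_isNilpotentFunctional {M : Matrix (Fin n) (Fin n) ℂ}
    (h : IsNilpotentFunctional (traceFunctional M)) : M ^ n = 0 := by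
  let m : (Queer n → ℂ) → Matrix (Fin n) (Fin n) ℂ := fun f => Matrix.of fun i j =>
    f (single j i 1, 0)
  have hm : Continuous m := continuous_pi fun i => continuous_pi fun j => continuous_apply _
  have hdet : ∀ z : ℂ, (scalar (Fin n) z).det = (scalar (Fin n) z - M).det := by
    intro z
    have hcl : IsClosed {f | (scalar (Fin n) z - m f).det = (scalar (Fin n) z - M).det} :=
      isClosed_eq (Continuous.matrix_det (continuous_const.sub hm)) continuous_const
    have : (0 : Queer n → ℂ) ∈
        {f | (scalar (Fin n) z - m f).det = (scalar (Fin n) z - M).det} := by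
      refine hcl.closure_subset_iff.2 ?_ h
      rintro _ ⟨u, rfl⟩
      have e : m (fun x : Queer n => traceFunctional M
          ((u⁻¹).val * x.1 * u.val, (u⁻¹).val * x.2 * u.val)) = u.val * M * (u⁻¹).val := by
        refine Matrix.ext fun i j => ?_
        refine (traceFunctional_conj M u (single j i 1, 0)).trans ?_
        rw [traceFunctional_apply, trace_mul_single]
        simp
      have hu : u.val * (u⁻¹).val = 1 := Units.mul_inv u
      have e2 : scalar (Fin n) z - u.val * M * (u⁻¹).val =
          u.val * (scalar (Fin n) z - M) * (u⁻¹).val := by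
        have : u.val * scalar (Fin n) z = scalar (Fin n) z * u.val :=
          ((scalar_commute z (fun _ => mul_comm _ _) u.val).eq).symm
        rw [mul_sub, sub_mul, this, Matrix.mul_assoc (scalar (Fin n) z), hu, mul_one]
      refine Set.mem_ofPred_eq ▸ ?_
      beta_reduce
      rw [e, e2, det_units_conj]
    have h0 : m 0 = 0 := rfl
    have h1 : (scalar (Fin n) z - m 0).det = _ := this
    rwa [h0, sub_zero] at h1
  have hchar : M.charpoly = Polynomial.X ^ n := by
    refine Polynomial.funext fun z => ?_
    rw [eval_charpoly, ← hdet]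
    simp
  have := aeval_self_charpoly M
  rwa [hchar, map_pow, Polynomial.aeval_X] at this

theorem mem_annihilator_traceFunctional {M A : Matrix (Fin n) (Fin n) ℂ} :
    ((A, 0) : Queer n) ∈ annihilator (traceFunctional M) ↔ M * A = A * M := by
  have hb : ∀ y : Queer n, traceFunctional M (LieSuperalgebra.bracket ((A, 0) : Queer n) y) =
      ((M * A - A * M) * y.1).trace := by
    intro y
    change traceFunctional M (Queer.bracket n (A, 0) y) = _
    simp only [traceFunctional_apply, Queer.bracket, LinearMap.mk₂_apply, zero_mul, mul_zero,
      add_zero, mul_sub, sub_mul, trace_sub]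
    rw [← Matrix.mul_assoc, ← Matrix.mul_assoc, trace_mul_cycle M y.1 A]
  constructor
  · intro h
    rw [← sub_eq_zero, ext_iff_trace_mul_right]
    intro x
    rw [zero_mul, trace_zero, ← h (x, 0), hb]
  · intro h y
    rw [hb, h, sub_self, zero_mul, trace_zero]

theorem finrank_annihilator_traceFunctional (M : Matrix (Fin n) (Fin n) ℂ) :
    Module.finrank ℂ ↥(annihilator (traceFunctional M) ⊓ LieSuperalgebra.part 0) =
      Module.finrank ℂ (commutant (Matrix.toLin' M)) := by
  refine LinearEquiv.finrank_eq ?_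
  have h : (commutant (Matrix.toLin' M)).map (LinearMap.inl ℂ (Matrix (Fin n) (Fin n) ℂ)
      (Matrix (Fin n) (Fin n) ℂ) ∘ₗ (LinearMap.toMatrix' : _ ≃ₗ[ℂ] Matrix (Fin n) (Fin n) ℂ).toLinearMap) =
      annihilator (traceFunctional M) ⊓ LieSuperalgebra.part 0 := by
    ext x
    obtain ⟨A, B⟩ := x
    constructor
    · rintro ⟨a, ha, hx⟩
      obtain ⟨rfl, rfl⟩ := Prod.ext_iff.1 hx
      refine ⟨mem_annihilator_traceFunctional.2 ?_, (mem_part_zero _).2 rfl⟩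
      apply Matrix.toLin'.injective
      rw [toLin'_mul, toLin'_mul]
      refine LinearMap.ext fun v => ?_
      simpa using ha v
    · rintro ⟨h1, h2⟩
      obtain rfl : B = 0 := (mem_part_zero _).1 h2
      refine ⟨toLin' A, fun v => ?_, by simp⟩
      have := mem_annihilator_traceFunctional.1 h1
      rw [← toLin'_mul_apply, this, toLin'_mul_apply]
  rw [← h]
  exact (Submodule.equivMapOfInjective _ (fun a a' haa =>
    LinearMap.toMatrix'.injective (LinearMap.inl_injective haa)) _).symm

/-- The nilpotent Jordan block. -/
def jordanBlock (n : ℕ) : Matrix (Fin n) (Fin n) ℂ :=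
  Matrix.of fun i j => if (i : ℕ) = j + 1 then 1 else 0

/-- Conjugation by diag(t^i) multiplies the Jordan block by t, and t tends to 0. -/
theorem isNilpotentFunctional_jordanBlock (n : ℕ) :
    IsNilpotentFunctional (traceFunctional (jordanBlock n)) := by
  have hmem : ∀ t : ℂ, t ≠ 0 → (fun x => t * traceFunctional (jordanBlock n) x) ∈
      Set.range fun u : GL (Fin n) ℂ => fun x : Queer n =>
        traceFunctional (jordanBlock n) ((u⁻¹).val * x.1 * u.val, (u⁻¹).val * x.2 * u.val) := by
    intro t ht
    have h1 : diagonal (fun i : Fin n => t ^ (i : ℕ)) * diagonal (fun i : Fin n => (t ^ (i : ℕ))⁻¹) = 1 := by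
      rw [diagonal_mul_diagonal, ← diagonal_one]
      congr 1
      ext i
      exact mul_inv_cancel₀ (pow_ne_zero _ ht)
    have h2 : diagonal (fun i : Fin n => (t ^ (i : ℕ))⁻¹) * diagonal (fun i : Fin n => t ^ (i : ℕ)) = 1 := by
      rw [diagonal_mul_diagonal, ← diagonal_one]
      congr 1
      ext i
      exact inv_mul_cancel₀ (pow_ne_zero _ ht)
    refine ⟨⟨_, _, h1, h2⟩, ?_⟩
    funext x
    refine (traceFunctional_conj _ _ _).trans ?_
    have : diagonal (fun i : Fin n => t ^ (i : ℕ)) * jordanBlock n *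
        diagonal (fun i : Fin n => (t ^ (i : ℕ))⁻¹) = t • jordanBlock n := by
      ext i j
      rw [mul_diagonal, diagonal_mul, Matrix.smul_apply, jordanBlock, of_apply]
      split_ifs with hij
      · rw [hij, pow_succ]
        field_simp
        simp
      · simp
    change ((diagonal (fun i : Fin n => t ^ (i : ℕ)) * jordanBlock n *
        diagonal (fun i : Fin n => (t ^ (i : ℕ))⁻¹)) * x.1).trace = _
    rw [this, smul_mul_assoc, trace_smul]
    rfl
  have hlim : Filter.Tendsto (fun t : ℂ => fun x => t * traceFunctional (jordanBlock n) x)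
      (nhdsWithin 0 {0}ᶜ) (nhds 0) := by
    refine tendsto_pi_nhds.2 fun x => ?_
    have : Filter.Tendsto (fun t : ℂ => t * traceFunctional (jordanBlock n) x) (nhds 0)
        (nhds (0 * traceFunctional (jordanBlock n) x)) :=
      (continuous_id.mul continuous_const).tendsto 0
    rw [zero_mul] at this
    exact this.mono_left nhdsWithin_le_nhds
  refine mem_closure_of_tendsto hlim ?_
  filter_upwards [self_mem_nhdsWithin] with t ht using hmem t ht

/-- A commuting endomorphism is determined by its value on the cyclic vector e_0. -/
theorem finrank_commutant_jordanBlock_le (n : ℕ) :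
    Module.finrank ℂ (commutant (Matrix.toLin' (jordanBlock n))) ≤ n := by
  rcases n with _ | n
  · rw [Nat.le_zero]
    have : Subsingleton (commutant (Matrix.toLin' (jordanBlock 0))) :=
      ⟨fun x y => Subtype.ext (LinearMap.ext fun v => Subsingleton.elim _ _)⟩
    exact Module.finrank_zero_of_subsingleton
  · let F : commutant (Matrix.toLin' (jordanBlock (n + 1))) →ₗ[ℂ] (Fin (n + 1) → ℂ) :=
      LinearMap.applyₗ (Pi.single 0 1) ∘ₗ Submodule.subtype _
    have h : ∀ a ∈ commutant (Matrix.toLin' (jordanBlock (n + 1))), a (Pi.single 0 1) = 0 →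
        a = 0 := by
      intro a ha h0
      have hs : ∀ k (hk : k < n + 1), a (Pi.single ⟨k, hk⟩ 1) = 0 := by
        intro k
        induction k with
        | zero => exact fun _ => h0
        | succ k ih =>
          intro hk
          have e : (Pi.single ⟨k + 1, hk⟩ 1 : Fin (n + 1) → ℂ) =
              toLin' (jordanBlock (n + 1)) (Pi.single ⟨k, by omega⟩ 1) := by
            ext i
            rw [toLin'_apply, mulVec_single_one, col_apply, jordanBlock, of_apply, Pi.single_apply]
            simp [Fin.ext_iff]
          rw [e, ← ha, ih (by omega), map_zero]
      exact LinearMap.pi_ext' fun i => LinearMap.ext_ring (hs i i.2)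
    have hF : Function.Injective F := by
      rintro ⟨a, ha⟩ ⟨a', ha'⟩ haa
      refine Subtype.ext (sub_eq_zero.1 (h (a - a') (sub_mem ha ha') ?_))
      rw [LinearMap.sub_apply, sub_eq_zero]
      exact haa
    simpa using LinearMap.finrank_le_finrank_of_injective hF

/-- Minimality against the Jordan block bounds the centraliser of M by n, so ker M has dimension at
most one and no power below the n-th vanishes. -/
theorem IsRegularNilpotent.exists_matrix {χ : Queer n →ₗ[ℂ] ℂ} (hχ : IsRegularNilpotent χ) :
    ∃ M : Matrix (Fin n) (Fin n) ℂ, χ = traceFunctional M ∧ M ^ n = 0 ∧ ∀ k < n, M ^ k ≠ 0 := by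
  obtain ⟨M, rfl⟩ := exists_eq_traceFunctional hχ.1
  have hM := pow_eq_zero_of_isNilpotentFunctional hχ.2.1
  refine ⟨M, rfl, hM, fun k hk h0 => ?_⟩
  have h1 := hχ.2.2 _ (isEvenFunctional_traceFunctional _) (isNilpotentFunctional_jordanBlock n)
  rw [finrank_annihilator_traceFunctional, finrank_annihilator_traceFunctional] at h1
  have hnil : IsNilpotent (toLin' M : Module.End ℂ (Fin n → ℂ)) := by
    refine ⟨n, ?_⟩
    rw [← toLin'_pow, hM, map_zero]
  refine pow_ne_zero_of_finrank_commutant_le hnil (k := k) ?_ ?_ ?_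
  · rw [Module.finrank_fin_fun]
    exact h1.trans (finrank_commutant_jordanBlock_le n)
  · rwa [Module.finrank_fin_fun]
  · rw [← toLin'_pow, h0, map_zero]

end Queer


/-! ### The derivation of a grading -/

section Grading

variable {g : Type} [AddCommGroup g] [Module ℂ g] [LieSuperalgebra g]
  {χ : g →ₗ[ℂ] ℂ} {gr : ℤ → Submodule ℂ g}

theorem IsGoodGrading.eq_of_forall_mem (hgr : IsGoodGrading χ gr) {W : Type} [AddCommGroup W]
    [Module ℂ W] {F G : g →ₗ[ℂ] W} (h : ∀ j, ∀ x ∈ gr j, F x = G x) : F = G := by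
  have hle : ⨆ j, gr j ≤ LinearMap.eqLocus F G := iSup_le h
  rw [hgr.isInternal.submodule_iSup_eq_top] at hle
  exact LinearMap.ext fun x => hle trivial

/-- The operator multiplying `gr j` by j is a derivation because the bracket is graded. Its
eigenspaces recover the grading, since the integers remain distinct in ℂ. -/
theorem IsGoodGrading.exists_derivation (hgr : IsGoodGrading χ gr) : ∃ D : g →ₗ[ℂ] g,
    (∀ j x, x ∈ gr j ↔ D x = (j : ℂ) • x) ∧ ∀ x y, D (LieSuperalgebra.bracket x y) =
      LieSuperalgebra.bracket (D x) y + LieSuperalgebra.bracket x (D y) := by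
  let e := LinearEquiv.ofBijective (DirectSum.coeLinearMap gr) hgr.isInternal
  let D : g →ₗ[ℂ] g :=
    (DirectSum.toModule ℂ ℤ g fun j => (j : ℂ) • (gr j).subtype) ∘ₗ e.symm.toLinearMap
  have hD : ∀ j, ∀ x ∈ gr j, D x = (j : ℂ) • x := by
    intro j x hx
    have : e.symm x = DirectSum.lof ℂ ℤ (fun j => gr j) j ⟨x, hx⟩ := by
      rw [LinearEquiv.symm_apply_eq]
      exact (DirectSum.coeLinearMap_lof gr j ⟨x, hx⟩).symm
    change DirectSum.toModule ℂ ℤ g _ (e.symm x) = _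
    rw [this, DirectSum.toModule_lof]
    rfl
  have hind : iSupIndep fun j : ℤ => Module.End.eigenspace D (j : ℂ) :=
    (Module.End.eigenspaces_iSupIndep D).comp Int.cast_injective
  refine ⟨D, fun j x => ⟨hD j x, fun hx => ?_⟩, ?_⟩
  · have hx' : x ∈ gr j ⊔ ⨆ k, ⨆ _ : k ≠ j, gr k := by
      have hle : ⨆ k, gr k ≤ gr j ⊔ ⨆ k, ⨆ _ : k ≠ j, gr k := by
        refine iSup_le fun k => ?_
        by_cases hk : k = j
        · subst hk
          exact le_sup_left
        · exact le_sup_of_le_right (le_iSup_of_le k (le_iSup_of_le hk le_rfl))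
      rw [hgr.isInternal.submodule_iSup_eq_top] at hle
      exact hle trivial
    obtain ⟨y, hy, z, hz, rfl⟩ := Submodule.mem_sup.1 hx'
    have hz1 : z ∈ Module.End.eigenspace D (j : ℂ) := by
      rw [Module.End.mem_eigenspace_iff]
      rw [map_add, hD j y hy, smul_add] at hx
      exact add_left_cancel hx
    have hz2 : z ∈ ⨆ k, ⨆ _ : k ≠ j, Module.End.eigenspace D ((k : ℤ) : ℂ) := by
      have hle : ⨆ k, ⨆ _ : k ≠ j, gr k ≤
          ⨆ k, ⨆ _ : k ≠ j, Module.End.eigenspace D ((k : ℤ) : ℂ) :=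
        iSup_mono fun k => iSup_mono fun _ w hw => Module.End.mem_eigenspace_iff.2 (hD k w hw)
      exact hle hz
    rw [Submodule.disjoint_def.1 (hind j) z hz1 hz2, add_zero]
    exact hy
  · have hF : LieSuperalgebra.bracket.compr₂ D =
        LieSuperalgebra.bracket ∘ₗ D + LieSuperalgebra.bracket.compl₂ D := by
      refine hgr.eq_of_forall_mem fun i x hx => hgr.eq_of_forall_mem fun j y hy => ?_
      simp only [LinearMap.compr₂_apply, LinearMap.add_apply, LinearMap.comp_apply,
        LinearMap.compl₂_apply]
      rw [hD i x hx, hD j y hy, hD _ _ (hgr.bracket_mem i j x y hx hy), map_smul, map_smul,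
        LinearMap.smul_apply, ← add_smul]
      push_cast
      rfl
    intro x y
    exact LinearMap.congr_fun (LinearMap.congr_fun hF x) y

end Grading

namespace Queer

open Matrix

variable {n : ℕ} {χ : Queer n →ₗ[ℂ] ℂ} {gr : ℤ → Submodule ℂ (Queer n)}

/-- A grading of `Q(n)`, `n ≥ 2`, comes from a grading of the algebra of matrices. -/
theorem exists_matrix_derivation [Nontrivial (Fin n)] (hgr : IsGoodGrading χ gr) :
    ∃ D : Matrix (Fin n) (Fin n) ℂ →ₗ[ℂ] Matrix (Fin n) (Fin n) ℂ,
      (∀ A B, D (A * B) = D A * B + A * D B) ∧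
      (∀ j, ∀ x ∈ gr j, D x.1 = (j : ℂ) • x.1) ∧
      ∀ (j : ℤ) (A : Matrix (Fin n) (Fin n) ℂ), D A = (j : ℂ) • A →
        ((A, 0) : Queer n) ∈ gr j ∧ ((0, A) : Queer n) ∈ gr j := by
  obtain ⟨D, hD, hder⟩ := hgr.exists_derivation
  -- The graded pieces are super subspaces, so D commutes with the projection onto the even part and
  -- splits into D₀ and D₁.
  have hP : ∀ x : Queer n, D (x.1, 0) = ((D x).1, 0) := by
    intro x
    have : D ∘ₗ LinearMap.inl ℂ _ _ ∘ₗ LinearMap.fst ℂ (Matrix (Fin n) (Fin n) ℂ) _ =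
        LinearMap.inl ℂ _ _ ∘ₗ LinearMap.fst ℂ _ _ ∘ₗ D := by
      refine hgr.eq_of_forall_mem fun j x hx => ?_
      have hx' := hx
      rw [hgr.isSuper j] at hx'
      obtain ⟨u, ⟨hu, hu0⟩, v, ⟨hv, hv1⟩, rfl⟩ := Submodule.mem_sup.1 hx'
      have hu2 : u.2 = 0 := (mem_part_zero u).1 hu0
      have hv2 : v.1 = 0 := (mem_part_one v).1 hv1
      have e : ((u + v).1, 0) = u := Prod.ext (by simp [hv2]) hu2.symm
      change D ((u + v).1, 0) = ((D (u + v)).1, 0)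
      rw [e, (hD j _).1 hx, (hD j u).1 hu]
      exact Prod.ext (by simp [hv2]) (by simp [hu2])
    exact LinearMap.congr_fun this x
  let D₀ : Matrix (Fin n) (Fin n) ℂ →ₗ[ℂ] Matrix (Fin n) (Fin n) ℂ :=
    LinearMap.fst ℂ _ _ ∘ₗ D ∘ₗ LinearMap.inl ℂ _ _
  let D₁ : Matrix (Fin n) (Fin n) ℂ →ₗ[ℂ] Matrix (Fin n) (Fin n) ℂ :=
    LinearMap.snd ℂ _ _ ∘ₗ D ∘ₗ LinearMap.inr ℂ _ _
  have h0 : ∀ A, D (A, 0) = (D₀ A, 0) := fun A => hP (A, 0)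
  have h1 : ∀ B, D (0, B) = (0, D₁ B) := by
    intro B
    refine Prod.ext ?_ rfl
    have := congrArg Prod.fst (hP (0, B))
    have hz : (((0, B) : Queer n).1, 0) = (0 : Queer n) := rfl
    rw [hz, map_zero] at this
    exact this.symm
  have E1 : ∀ A C, D₀ (A * C) - D₀ (C * A) = D₀ A * C - C * D₀ A + (A * D₀ C - D₀ C * A) := by
    intro A C
    have := congrArg Prod.fst (hder (A, 0) (C, 0))
    rw [h0, h0] at this
    change (D (Queer.bracket n _ _)).1 = (Queer.bracket n _ _ + Queer.bracket n _ _).1 at this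
    simpa [Queer.bracket, h0] using this
  have E2 : ∀ A B, D₁ (A * B) - D₁ (B * A) = D₀ A * B - B * D₀ A + (A * D₁ B - D₁ B * A) := by
    intro A B
    have := congrArg Prod.snd (hder (A, 0) (0, B))
    rw [h0, h1] at this
    change (D (Queer.bracket n _ _)).2 = (Queer.bracket n _ _ + Queer.bracket n _ _).2 at this
    simpa [Queer.bracket, h1] using this
  have E3 : ∀ B C, D₀ (B * C) + D₀ (C * B) = D₁ B * C + C * D₁ B + (B * D₁ C + D₁ C * B) := by
    intro B C
    have := congrArg Prod.fst (hder (0, B) (0, C))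
    rw [h1, h1] at this
    change (D (Queer.bracket n _ _)).1 = (Queer.bracket n _ _ + Queer.bracket n _ _).1 at this
    simpa [Queer.bracket, h0] using this
  have hinj : ∀ X Y : Matrix (Fin n) (Fin n) ℂ, X + X = Y + Y → X = Y := by
    intro X Y h
    rw [← two_smul ℂ, ← two_smul ℂ] at h
    exact smul_right_injective _ (two_ne_zero (α := ℂ)) h
  -- The Leibniz rule on odd elements allows D₁ to differ from D₀ by the central matrix δ = D₁(1),
  -- and D₀ to fail the associative Leibniz rule by δ(AB + BA). The remaining task is to show δ = 0.
  obtain ⟨δ, hδ⟩ : ∃ δ, δ = D₁ 1 := ⟨_, rfl⟩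
  have hc : ∀ A, A * δ = δ * A := by
    intro A
    have := E2 A 1
    simp only [mul_one, one_mul, sub_self, zero_add, ← hδ] at this
    exact sub_eq_zero.1 this.symm
  have hc' : ∀ A B, A * (δ * B) = δ * (A * B) := by
    intro A B
    rw [← Matrix.mul_assoc, hc, Matrix.mul_assoc]
  have h01 : ∀ B, D₁ B = D₀ B - δ * B := by
    intro B
    have := E3 B 1
    simp only [mul_one, one_mul, ← hδ, hc] at this
    rw [eq_sub_iff_add_eq]
    refine hinj _ _ ?_
    rw [this]
    abel
  have hmul : ∀ A B, D₀ (A * B) = D₀ A * B + A * D₀ B - δ * (A * B + B * A) := by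
    intro A B
    have e1 := E1 A B
    have e3 := E3 A B
    simp only [h01, mul_sub, sub_mul, hc', Matrix.mul_assoc] at e3
    refine hinj _ _ ?_
    have : D₀ (A * B) + D₀ (A * B) = (D₀ (A * B) - D₀ (B * A)) + (D₀ (A * B) + D₀ (B * A)) := by abel
    rw [this, e1, e3, mul_add]
    abel
  -- Computing D₀ of a triple product with both bracketings constrains δ.
  have hassoc : ∀ A B C, δ * (B * (A * C)) + δ * (C * (A * B)) =
      δ * (A * (C * B)) + δ * (B * (C * A)) := by
    intro A B C
    have e : D₀ (A * B * C) = D₀ (A * (B * C)) := by rw [Matrix.mul_assoc]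
    rw [hmul, hmul, hmul A, hmul B C] at e
    simp only [mul_add, add_mul, mul_sub, sub_mul, hc', Matrix.mul_assoc] at e
    rw [← sub_eq_zero] at e
    rw [← sub_eq_zero, ← neg_eq_zero, ← e]
    abel
  -- With two distinct indices the constraint on e_ij, e_ii, e_jj reads δ e_ij = 0, so column i of δ
  -- vanishes. For n = 1 this fails, which is why that case is separate.
  have hδ0 : δ = 0 := by
    ext k i
    obtain ⟨j, hj⟩ := exists_ne i
    have := hassoc (single i j 1) (single i i 1) (single j j 1)
    have hk := congrFun (congrFun this k) j
    simpa [hj, hj.symm] using hk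
  have hD01 : ∀ B, D₁ B = D₀ B := by
    intro B
    rw [h01, hδ0, zero_mul, sub_zero]
  refine ⟨D₀, fun A B => ?_, fun j x hx => ?_, fun j A hA => ?_⟩
  · rw [hmul, hδ0, zero_mul, sub_zero]
  · have := hP x
    rw [h0, (hD j x).1 hx] at this
    exact congrArg Prod.fst this
  · constructor
    · rw [hD, h0, hA]
      exact Prod.ext rfl (smul_zero _).symm
    · rw [hD, h1, hD01, hA]
      exact Prod.ext (smul_zero _).symm rfl

/-- Derivations of matrix algebras are inner. -/
theorem exists_inner_derivation [NeZero n]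
    (D : Matrix (Fin n) (Fin n) ℂ →ₗ[ℂ] Matrix (Fin n) (Fin n) ℂ)
    (hD : ∀ A B, D (A * B) = D A * B + A * D B) :
    ∃ h : Matrix (Fin n) (Fin n) ℂ, ∀ A, D A = h * A - A * h := by
  let e : Fin n → ℂ := Pi.single 0 1
  have he : e ⬝ᵥ e = 1 := by simp [e]
  -- With eᵀe = 1, put h w = D(w eᵀ) e. The Leibniz rule for A (w eᵀ) gives h A w = D(A) w + A h w.
  let F : (Fin n → ℂ) →ₗ[ℂ] (Fin n → ℂ) :=
    { toFun := fun w => D (vecMulVec w e) *ᵥ e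
      map_add' := fun v w => by rw [add_vecMulVec, map_add, add_mulVec]
      map_smul' := fun c w => by
        rw [smul_vecMulVec, map_smul, smul_mulVec, RingHom.id_apply] }
  have hF : ∀ w, LinearMap.toMatrix' F *ᵥ w = D (vecMulVec w e) *ᵥ e := fun w => by
    rw [LinearMap.toMatrix'_mulVec]
    rfl
  refine ⟨LinearMap.toMatrix' F, fun A => ?_⟩
  apply Matrix.toLin'.injective
  refine LinearMap.ext fun w => ?_
  rw [toLin'_apply, toLin'_apply, sub_mulVec, ← mulVec_mulVec, ← mulVec_mulVec, hF, hF,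
    ← mul_vecMulVec, hD, add_mulVec, ← mulVec_mulVec, ← mulVec_mulVec, vecMulVec_mulVec, he]
  simp

end Queer


/-! ### Frames of common shift and eigenvectors -/

namespace Queer

open Matrix

variable {N : ℕ} {M h : Matrix (Fin (N + 1)) (Fin (N + 1)) ℂ}

/-- A basis of eigenvectors of `h`, with dual basis `r`, on which the nilpotent matrix `M` acts as a
shift. -/
structure IsFrame (M h : Matrix (Fin (N + 1)) (Fin (N + 1)) ℂ)
    (v r : Fin (N + 1) → Fin (N + 1) → ℂ) : Prop where
  dual : ∀ j k, r j ⬝ᵥ v k = if j = k then 1 else 0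
  ext : ∀ X Y : Matrix (Fin (N + 1)) (Fin (N + 1)) ℂ, (∀ k, X *ᵥ v k = Y *ᵥ v k) → X = Y
  eigen : ∃ c : ℂ, ∀ k : Fin (N + 1), h *ᵥ v k = (c - 2 * k) • v k
  shift : ∀ i j : Fin (N + 1), r j ⬝ᵥ (M *ᵥ v i) = if (i : ℕ) = j + 1 then 1 else 0

/-- The vectors M^k w are eigenvectors of h with eigenvalues increasing by 2, hence independent.
They are numbered backwards, v_i = M^{N-i} w, so that M sends v_i to v_{i-1} and the trace
functional is one on the units with i = j + 1. -/
theorem exists_isFrame (hM : M ^ (N + 1) = 0) (hMh : h * M - M * h = (2 : ℂ) • M)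
    {w : Fin (N + 1) → ℂ} (hw : M ^ N *ᵥ w ≠ 0) {c : ℂ} (hc : h *ᵥ w = c • w) :
    ∃ v r, IsFrame M h v r := by
  have hpow : ∀ k : ℕ, h *ᵥ (M ^ k *ᵥ w) = (c + 2 * k) • (M ^ k *ᵥ w) := by
    intro k
    induction k with
    | zero => simp [hc]
    | succ k ih =>
      have : h * M = M * h + (2 : ℂ) • M := by
        rw [← hMh]
        abel
      rw [pow_succ', ← mulVec_mulVec, mulVec_mulVec _ h, this, add_mulVec, ← mulVec_mulVec, ih,
        mulVec_smul, smul_mulVec, ← add_smul]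
      push_cast
      ring_nf
  let v : Fin (N + 1) → Fin (N + 1) → ℂ := fun i => M ^ (N - i) *ᵥ w
  have hv0 : ∀ i, v i ≠ 0 := by
    intro i h0
    apply hw
    have : M ^ N = M ^ (i : ℕ) * M ^ (N - i) := by
      rw [← pow_add, Nat.add_sub_cancel' (by omega)]
    rw [this, ← mulVec_mulVec]
    change M ^ (i : ℕ) *ᵥ v i = 0
    rw [h0, mulVec_zero]
  have heig : ∀ k : Fin (N + 1), h *ᵥ v k = (c + 2 * N - 2 * k) • v k := by
    intro k
    have : k ≤ N := by omega
    change h *ᵥ (M ^ (N - k) *ᵥ w) = _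
    rw [hpow]
    push_cast [this]
    ring_nf
    rfl
  have hli : LinearIndependent ℂ v := by
    refine Module.End.eigenvectors_linearIndependent' (toLin' h)
      (fun k : Fin (N + 1) => c + 2 * N - 2 * (k : ℂ)) (fun i j hij => ?_) v fun k => ?_
    · have : (i : ℂ) = j := by linear_combination (-1 / 2 : ℂ) * hij
      exact Fin.ext (by exact_mod_cast this)
    · exact Module.End.hasEigenvector_iff.2 ⟨Module.End.mem_eigenspace_iff.2 (by
        rw [toLin'_apply]
        exact heig k), hv0 k⟩
  let B := basisOfLinearIndependentOfCardEqFinrank hli (by simp)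
  have hB : ∀ k, B k = v k := fun k => by
    rw [coe_basisOfLinearIndependentOfCardEqFinrank]
  let r : Fin (N + 1) → Fin (N + 1) → ℂ := fun j i => B.coord j (Pi.single i 1)
  have hr : ∀ j u, r j ⬝ᵥ u = B.coord j u := by
    intro j u
    have : B.coord j u = B.coord j (∑ i, u i • Pi.single i 1) := by
      congr 1
      exact pi_eq_sum_univ' u
    rw [this, map_sum]
    refine Finset.sum_congr rfl fun i _ => ?_
    rw [map_smul, smul_eq_mul, mul_comm]
  have hdual : ∀ j k, r j ⬝ᵥ v k = if j = k then 1 else 0 := by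
    intro j k
    rw [hr, ← hB, Module.Basis.coord_apply, Module.Basis.repr_self, Finsupp.single_apply]
    simp only [eq_comm]
  refine ⟨v, r, hdual, fun X Y hXY => ?_, ⟨_, heig⟩, fun i j => ?_⟩
  · apply Matrix.toLin'.injective
    refine B.ext fun k => ?_
    rw [hB, toLin'_apply, toLin'_apply, hXY]
  · have hMv : M *ᵥ v i = M ^ (N - i + 1) *ᵥ w := by
      rw [pow_succ', ← mulVec_mulVec]
    by_cases hi : (i : ℕ) = 0
    · rw [hMv, hi, Nat.sub_zero, hM, zero_mulVec, dotProduct_zero, if_neg (by omega)]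
    · have : M *ᵥ v i = v ⟨i - 1, by omega⟩ := by
        rw [hMv]
        change _ = M ^ (N - ((i : ℕ) - 1)) *ᵥ w
        congr 2
        omega
      rw [this, hdual]
      congr 1
      rw [Fin.ext_iff, eq_iff_iff]
      simp only
      omega

/-- The matrix units of a frame. -/
noncomputable def frameUnit (v r : Fin (N + 1) → Fin (N + 1) → ℂ)
    (q : ZMod 2 × Fin (N + 1) × Fin (N + 1)) : Queer (N + 1) :=
  if q.1 = 0 then (vecMulVec (v q.2.1) (r q.2.2), 0) else (0, vecMulVec (v q.2.1) (r q.2.2))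

namespace IsFrame

variable {v r : Fin (N + 1) → Fin (N + 1) → ℂ}

theorem linearIndependent (hF : IsFrame M h v r) : LinearIndependent ℂ (frameUnit v r) := by
  let f : ZMod 2 × Fin (N + 1) × Fin (N + 1) → Queer (N + 1) →ₗ[ℂ] ℂ := fun q =>
    Matrix.traceLinearMap (Fin (N + 1)) ℂ ℂ ∘ₗ
      LinearMap.mulLeft ℂ (vecMulVec (v q.2.2) (r q.2.1)) ∘ₗ
        if q.1 = 0 then LinearMap.fst ℂ _ _ else LinearMap.snd ℂ _ _
  have hf : ∀ q q', f q (frameUnit v r q') = if q = q' then 1 else 0 := by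
    rintro ⟨p, i, j⟩ ⟨p', i', j'⟩
    have ht : (vecMulVec (v j) (r i) * vecMulVec (v i') (r j')).trace =
        if i = i' ∧ j = j' then 1 else 0 := by
      rw [vecMulVec_mul_vecMulVec, trace_vecMulVec, hF.dual]
      by_cases hi : i = i'
      · simp [hi, dotProduct_comm (v j), hF.dual, eq_comm]
      · simp [hi]
    change (vecMulVec (v j) (r i) *
      (if p = 0 then LinearMap.fst ℂ _ _ else LinearMap.snd ℂ _ _ :
        Queer (N + 1) →ₗ[ℂ] Matrix (Fin (N + 1)) (Fin (N + 1)) ℂ) (frameUnit v r (p', i', j'))).trace = _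
    rcases parity_cases p with rfl | rfl <;> rcases parity_cases p' with rfl | rfl <;>
      simp [frameUnit, ht]
  exact LinearIndependent.of_pairwise_dual_eq_zero_one _ f
    (fun q q' hq => (hf q q').trans (if_neg hq)) fun q => (hf q q).trans (if_pos rfl)

/-- The basis of matrix units of a frame. -/
noncomputable def basis (hF : IsFrame M h v r) :
    Module.Basis (ZMod 2 × Fin (N + 1) × Fin (N + 1)) ℂ (Queer (N + 1)) :=
  basisOfLinearIndependentOfCardEqFinrank hF.linearIndependent (by
    simp [Module.finrank_matrix, ZMod.card]
    ring)

theorem basis_apply (hF : IsFrame M h v r) (q : ZMod 2 × Fin (N + 1) × Fin (N + 1)) :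
    hF.basis q = frameUnit v r q := by
  rw [basis, coe_basisOfLinearIndependentOfCardEqFinrank]

theorem isPrincipalBasis (hF : IsFrame M h v r) {gr : ℤ → Submodule ℂ (Queer (N + 1))}
    (hgr : IsGoodGrading (traceFunctional M) gr)
    (hh : ∀ (j : ℤ) (A : Matrix (Fin (N + 1)) (Fin (N + 1)) ℂ), h * A - A * h = (j : ℂ) • A →
        ((A, 0) : Queer (N + 1)) ∈ gr j ∧ ((0, A) : Queer (N + 1)) ∈ gr j) :
    IsPrincipalBasis hF.basis (traceFunctional M) gr where
  good := hgr
  part_mem p i j := by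
    rw [basis_apply]
    rcases parity_cases p with rfl | rfl
    · exact (mem_part_zero _).2 rfl
    · exact (mem_part_one _).2 rfl
  mul_eq p i j q k l := by
    have ht : vecMulVec (v i) (r j) * vecMulVec (v k) (r l) =
        if j = k then vecMulVec (v i) (r l) else 0 := by
      rw [vecMulVec_mul_vecMulVec, hF.dual]
      split_ifs <;> simp
    have h2 : (1 : ZMod 2) + 1 = 0 := rfl
    rw [basis_apply, basis_apply, basis_apply, mul_apply]
    rcases parity_cases p with rfl | rfl <;> rcases parity_cases q with rfl | rfl <;>
      simp only [frameUnit, ht, h2, zero_add, add_zero, if_true, one_ne_zero, if_false, mul_zero,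
        zero_mul] <;>
      split_ifs <;> rfl
  gr_mem p i j := by
    obtain ⟨c, hc⟩ := hF.eigen
    have e : h * vecMulVec (v i) (r j) - vecMulVec (v i) (r j) * h =
        ((2 * ((j : ℤ) - (i : ℤ)) : ℤ) : ℂ) • vecMulVec (v i) (r j) := by
      refine hF.ext _ _ fun k => ?_
      rw [sub_mulVec, ← mulVec_mulVec, ← mulVec_mulVec, hc, mulVec_smul, smul_mulVec,
        vecMulVec_mulVec, hF.dual]
      split_ifs with hjk
      · subst hjk
        simp only [MulOpposite.op_one, one_smul, hc, ← sub_smul]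
        push_cast
        ring_nf
      · simp
    rw [basis_apply]
    rcases parity_cases p with rfl | rfl
    · exact (hh _ _ e).1
    · exact (hh _ _ e).2
  apply_eq p i j := by
    rw [basis_apply]
    rcases parity_cases p with rfl | rfl
    · change (M * vecMulVec (v i) (r j)).trace = _
      rw [mul_vecMulVec, trace_vecMulVec, dotProduct_comm, hF.shift]
      simp
    · simp [frameUnit]

end IsFrame

/-- The grading derivation is ad h with [h, M] = 2M. What remains is an eigenvector of h not killed
by M^N, found among the homogeneous matrices applied to one fixed eigenvector of h. -/
theorem exists_isPrincipalBasis {N : ℕ} (hN : 1 ≤ N) {χ : Queer (N + 1) →ₗ[ℂ] ℂ}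
    (hχ : IsRegularNilpotent χ) {gr : ℤ → Submodule ℂ (Queer (N + 1))}
    (hgr : IsGoodGrading χ gr) : ∃ b, IsPrincipalBasis b χ gr := by
  obtain ⟨M, rfl, hM, hM0⟩ := hχ.exists_matrix
  have hnt : Nontrivial (Fin (N + 1)) := Fin.nontrivial_iff_two_le.2 (by omega)
  obtain ⟨D, hD, hDgr, hgrD⟩ := exists_matrix_derivation hgr
  obtain ⟨h, hh⟩ := exists_inner_derivation D hD
  have htr : ∀ A, (D A).trace = 0 := by
    intro A
    rw [hh, trace_sub, trace_mul_comm, sub_self]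
  -- An inner derivation has trace zero on M x, so tr(D(M) x) = -j tr(M x) for x of degree j, and
  -- tr(M x) vanishes unless j = -2.
  have hDM : D M = (2 : ℂ) • M := by
    rw [ext_iff_trace_mul_right]
    have : traceFunctional (D M) = (2 : ℂ) • traceFunctional M := by
      refine hgr.eq_of_forall_mem fun j x hx => ?_
      have h1 := htr (M * x.1)
      rw [hD, trace_add, hDgr j x hx, mul_smul_comm, trace_smul] at h1
      rw [LinearMap.smul_apply, traceFunctional_apply, eq_neg_of_add_eq_zero_left h1,
        traceFunctional_apply]
      by_cases hj : j = -2
      · subst hj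
        simp
      · have := hgr.apply_eq_zero j hj x hx
        rw [traceFunctional_apply] at this
        simp [this]
    intro A
    have := LinearMap.congr_fun this (A, 0)
    rwa [LinearMap.smul_apply, traceFunctional_apply, traceFunctional_apply, ← trace_smul,
      ← smul_mul_assoc] at this
  obtain ⟨μ, hμ⟩ := Module.End.exists_eigenvalue (toLin' h)
  obtain ⟨c, hc⟩ := hμ.exists_hasEigenvector
  have hc1 : h *ᵥ c = μ • c := by
    have := hc.apply_eq_smul
    rwa [toLin'_apply] at this
  -- Matrices applied to a nonzero vector give all vectors, and homogeneous elements span. If none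
  -- worked, M^N would be zero.
  have hex : ∃ j, ∃ x ∈ gr j, M ^ N *ᵥ (x.1 *ᵥ c) ≠ 0 := by
    by_contra! hcon
    have : toLin' (M ^ N) ∘ₗ (Matrix.mulVecBilin ℂ ℂ).flip c ∘ₗ
        LinearMap.fst ℂ (Matrix (Fin (N + 1)) (Fin (N + 1)) ℂ) (Matrix (Fin (N + 1)) (Fin (N + 1)) ℂ) = 0 :=
      hgr.eq_of_forall_mem fun j x hx => hcon j x hx
    refine hM0 N (Nat.lt_succ_self N) ?_
    apply Matrix.toLin'.injective
    refine LinearMap.ext fun w => ?_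
    obtain ⟨i, hi⟩ := Function.ne_iff.1 hc.2
    have h1 : M ^ N *ᵥ (vecMulVec w (Pi.single i (c i)⁻¹) *ᵥ c) = 0 :=
      LinearMap.congr_fun this (vecMulVec w (Pi.single i (c i)⁻¹), 0)
    rw [vecMulVec_mulVec, single_dotProduct, inv_mul_cancel₀ hi, MulOpposite.op_one, one_smul] at h1
    rw [toLin'_apply, h1, map_zero, LinearMap.zero_apply]
  obtain ⟨j, x, hx, hne⟩ := hex
  have heig : h *ᵥ (x.1 *ᵥ c) = ((j : ℂ) + μ) • (x.1 *ᵥ c) := by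
    have h1 := hDgr j x hx
    rw [hh, sub_eq_iff_eq_add] at h1
    rw [mulVec_mulVec, h1, add_mulVec, smul_mulVec, ← mulVec_mulVec, hc1, mulVec_smul, add_smul]
  obtain ⟨v, r, hF⟩ := exists_isFrame hM (by rw [← hh, hDM]) hne heig
  exact ⟨_, hF.isPrincipalBasis hgr fun j A hA => hgrD j A (by rw [hh, hA])⟩

end Queer


/-! ### The zero functional -/

theorem annihilator_zero {g : Type} [AddCommGroup g] [Module ℂ g] [LieSuperalgebra g] :
    annihilator (0 : g →ₗ[ℂ] ℂ) = ⊤ :=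
  eq_top_iff.2 fun _ _ _ => rfl

/-- With no negative degrees m is zero and g^χ is all of g. The basis vectors themselves serve as
Whittaker generators, so this is Poincaré-Birkhoff-Witt. -/
theorem IsAssocGraded.exists_algEquiv_zero {g I : Type} [AddCommGroup g] [Module ℂ g]
    [LieSuperalgebra g] [Fintype I] {b : Module.Basis I ℂ g} {par : I → ZMod 2} {deg : I → ℤ}
    {mul : g →ₗ[ℂ] g →ₗ[ℂ] g} {gr : ℤ → Submodule ℂ g} (h : IsAssocGraded b par deg mul)
    (hgr : IsHomogeneousBasis gr b deg) (h0 : ∀ i, 0 ≤ deg i) :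
    ∃ φ : SymAnn (0 : g →ₗ[ℂ] ℂ) ≃ₐ[ℂ] GrW (0 : g →ₗ[ℂ] ℂ) gr ⊥, ∀ (p : ZMod 2) (k : ℤ),
      (SymAnn.bidegree 0 gr p k).map φ.toLinearMap = GrW.bidegree 0 gr ⊥ p k := by
  let e : g ≃ₗ[ℂ] annihilator (0 : g →ₗ[ℂ] ℂ) := (LinearEquiv.ofTop _ annihilator_zero).symm
  have he : ∀ x, (e x : g) = x := fun _ => rfl
  have hneg : ∀ i, ¬ deg i < 0 := fun i => not_lt.2 (h0 i)
  have hA : IsAnnihilatorBasis b par deg mul (0 : g →ₗ[ℂ] ℂ) gr e.toLinearMap (fun _ => 0)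
      (b.map e) par deg :=
    { toIsAssocGraded := h
      gr_hom := hgr
      deg_ne := fun i => by
        have := h0 i
        omega
      apply_par := fun _ _ => rfl
      apply_deg := fun _ _ => rfl
      proj_neg := fun i hi => absurd hi (hneg i)
      proj_id := fun _ => rfl
      proj_mem := fun i => h.hom.mem i
      slice_mem := fun _ => zero_mem _
      slice_eq := fun _ _ => rfl
      decomp := fun j _ => by simp [he]
      hom_par := by
        refine IsHomogeneousBasis.of_mem (LieSuperalgebra.iSupIndep_part.submoduleOf _) fun i => ?_
        rw [Module.Basis.map_apply]
        exact h.hom.mem i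
      hom_deg := by
        intro m
        have hm := hgr m
        ext x
        change (x : g) ∈ gr m ↔ _
        rw [hm]
        have : b.map e '' {i | deg i = m} = e '' (b '' {i | deg i = m}) := by
          rw [Set.image_image]
          exact Set.image_congr fun i _ => b.map_apply e i
        rw [this, ← LinearEquiv.coe_coe, ← Submodule.map_span]
        exact ⟨fun hx => ⟨x, hx, rfl⟩, by rintro ⟨y, hy, rfl⟩; exact hy⟩
      proj_deg := fun i => hgr.mem i
      deg_nonneg := h0 }
  refine hA.bidegree_map_eq (fun i => Env.X b i)
    (fun i => SuperSym.X (LieSuperalgebra.part (g := g)) b i)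
    (fun i => letter_mem_wordSpan (f := fun i => (Env.X b i,
      SuperSym.X (LieSuperalgebra.part (g := g)) b i)) (w := fun i => (par i, deg i + 2)) i)
    (fun _ i hi => absurd hi (hneg i)) fun i f => ?_
  rw [hA.restr_X, LinearMap.zero_apply, zero_smul, zero_add, SuperSym.dual_ι, Module.Basis.map_apply]
  rfl

/-! ### Gradings of Q(1) -/

namespace Queer

variable {gr : ℤ → Submodule ℂ (Queer 1)}

/-- The basis of `Q(1)`. -/
noncomputable def basisOne : Module.Basis (ZMod 2) ℂ (Queer 1) :=
  basisOfLinearIndependentOfCardEqFinrank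
    (b := fun p => if p = 0 then ((1, 0) : Queer 1) else (0, 1))
    (LinearIndependent.of_pairwise_dual_eq_zero_one _
      (fun p => Matrix.traceLinearMap (Fin 1) ℂ ℂ ∘ₗ
        (if p = 0 then LinearMap.fst ℂ _ _ else LinearMap.snd ℂ _ _ :
          Queer 1 →ₗ[ℂ] Matrix (Fin 1) (Fin 1) ℂ))
      (fun p q hpq => by
        rcases parity_cases p with rfl | rfl <;> rcases parity_cases q with rfl | rfl <;>
          simp at hpq ⊢)
      (fun p => by rcases parity_cases p with rfl | rfl <;> simp))
    (by simp [Module.finrank_matrix, ZMod.card])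

theorem basisOne_apply (p : ZMod 2) :
    basisOne p = if p = 0 then ((1, 0) : Queer 1) else (0, 1) := by
  rw [basisOne, coe_basisOfLinearIndependentOfCardEqFinrank]

/-- The product `(a, b) (c, d) = (b d, 0)`. -/
noncomputable def mulOne : Queer 1 →ₗ[ℂ] Queer 1 →ₗ[ℂ] Queer 1 :=
  (((LinearMap.mul ℂ (Matrix (Fin 1) (Fin 1) ℂ)).compl₁₂ (LinearMap.snd ℂ _ _)
    (LinearMap.snd ℂ _ _)).compr₂ (LinearMap.inl ℂ _ _))

theorem mulOne_apply (x y : Queer 1) : mulOne x y = (x.2 * y.2, 0) := rfl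

/-- If the odd vector f has degree d, then e = [f, f]/2 has degree 2d, and goodness forces d ≥ 0
because g^χ is everything. The matrix product, with unit e, is graded only for d = 0, so `mulOne`
keeps only f · f = e, which has the same supercommutators. -/
theorem exists_isAssocGraded_one (hgr : IsGoodGrading (0 : Queer 1 →ₗ[ℂ] ℂ) gr) :
    ∃ deg : ZMod 2 → ℤ, IsAssocGraded basisOne (fun p => p) deg mulOne ∧
      IsHomogeneousBasis gr basisOne deg ∧ ∀ i, 0 ≤ deg i := by
  have hex : ∃ j, ∃ x ∈ gr j, x.2 ≠ 0 := by
    by_contra! hcon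
    have : LinearMap.snd ℂ (Matrix (Fin 1) (Fin 1) ℂ) (Matrix (Fin 1) (Fin 1) ℂ) = 0 :=
      hgr.eq_of_forall_mem hcon
    have h1 : (1 : Matrix (Fin 1) (Fin 1) ℂ) = 0 := LinearMap.congr_fun this (0, 1)
    exact one_ne_zero h1
  obtain ⟨d, x, hx, hx2⟩ := hex
  have hf : ((0, 1) : Queer 1) ∈ gr d := by
    rw [hgr.isSuper d] at hx
    obtain ⟨u, ⟨-, hu⟩, v, ⟨hv, hv1⟩, rfl⟩ := Submodule.mem_sup.1 hx
    have hu2 : u.2 = 0 := (mem_part_zero u).1 hu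
    have hv2 : v.1 = 0 := (mem_part_one v).1 hv1
    have hv0 : v.2 0 0 ≠ 0 := by
      intro h0
      apply hx2
      ext i j
      obtain rfl := Subsingleton.elim i 0
      obtain rfl := Subsingleton.elim j 0
      simp [hu2, h0]
    have : ((0, 1) : Queer 1) = (v.2 0 0)⁻¹ • v := by
      refine Prod.ext (by simp [hv2]) ?_
      ext i j
      obtain rfl := Subsingleton.elim i 0
      obtain rfl := Subsingleton.elim j 0
      simp [hv0]
    rw [this]
    exact Submodule.smul_mem _ _ hv
  have he : ((1, 0) : Queer 1) ∈ gr (2 * d) := by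
    have h1 := hgr.bracket_mem d d _ _ hf hf
    have h2 : LieSuperalgebra.bracket ((0, 1) : Queer 1) (0, 1) = (2 : ℂ) • ((1, 0) : Queer 1) := by
      change Queer.bracket 1 _ _ = _
      simp [Queer.bracket, two_smul]
    rw [h2, ← two_mul] at h1
    simpa using Submodule.smul_mem _ (2 : ℂ)⁻¹ h1
  have hd : 0 ≤ d := by
    by_contra hd
    have h1 : ((0, 1) : Queer 1) ∈ ⨆ j : ℤ, ⨆ _ : 0 ≤ j, gr j :=
      hgr.annihilator_le (by rw [annihilator_zero]; trivial)
    have hle : ⨆ j : ℤ, ⨆ _ : 0 ≤ j, gr j ≤ ⨆ j, ⨆ _ : j ≠ d, gr j :=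
      iSup_mono fun j => iSup_le fun hj => le_iSup_of_le (by omega) le_rfl
    have h2 := Submodule.disjoint_def.1 (hgr.isInternal.submodule_iSupIndep d) _ hf (hle h1)
    exact one_ne_zero (congrArg Prod.snd h2)
  refine ⟨fun p => if p = 0 then 2 * d else d, ?_, ?_, ?_⟩
  · refine
      { hom := IsHomogeneousBasis.of_mem LieSuperalgebra.iSupIndep_part fun p => ?_
        assoc := fun _ _ _ => by simp [mulOne_apply]
        mul_mem := fun p q => ?_
        bracket_eq := fun p q => ?_ }
    · rw [basisOne_apply]
      rcases parity_cases p with rfl | rfl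
      · exact (mem_part_zero _).2 rfl
      · exact (mem_part_one _).2 rfl
    · rcases parity_cases p with rfl | rfl <;> rcases parity_cases q with rfl | rfl
      · simp [mulOne_apply, basisOne_apply, ← Prod.zero_eq_mk]
      · simp [mulOne_apply, basisOne_apply, ← Prod.zero_eq_mk]
      · simp [mulOne_apply, basisOne_apply, ← Prod.zero_eq_mk]
      · refine Submodule.subset_span ⟨0, ?_, ?_⟩
        · rw [Set.mem_ofPred_eq]
          simp [CharTwo.add_self_eq_zero, two_mul]
        · simp [mulOne_apply, basisOne_apply]
    · change Queer.bracket 1 _ _ = _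
      rcases parity_cases p with rfl | rfl <;> rcases parity_cases q with rfl | rfl <;>
        simp [mulOne_apply, basisOne_apply, Queer.bracket, superSign]
  · refine IsHomogeneousBasis.of_mem hgr.isInternal.submodule_iSupIndep fun p => ?_
    rw [basisOne_apply]
    rcases parity_cases p with rfl | rfl
    · exact he
    · exact hf
  · intro p
    beta_reduce
    split_ifs <;> omega

end Queer


/-! ### Assembly of the main theorem -/

theorem IsMaxIsotropic.eq_bot {g : Type} [AddCommGroup g] [Module ℂ g] [LieSuperalgebra g]
    {χ : g →ₗ[ℂ] ℂ} {gr : ℤ → Submodule ℂ g} {l : Submodule ℂ g} (hl : IsMaxIsotropic χ gr l)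
    (h : gr (-1) = ⊥) : l = ⊥ :=
  le_bot_iff.1 (h ▸ hl.1.le)

theorem IsHomogeneousBasis.eq_bot {M V I : Type} [AddCommGroup V] [Module ℂ V]
    {P : M → Submodule ℂ V} {b : Module.Basis I ℂ V} {w : I → M} (hb : IsHomogeneousBasis P b w)
    {m : M} (h : ∀ i, w i ≠ m) : P m = ⊥ :=
  le_bot_iff.1 (hb.induction fun i hi => absurd hi (h i))

theorem even_finrank_of_eq_bot {V : Type} [AddCommGroup V] [Module ℂ V] {P Q : Submodule ℂ V}
    (h : P = ⊥) : Even (Module.finrank ℂ ↥(P ⊓ Q)) := by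
  rw [h, bot_inf_eq, finrank_bot]
  exact Even.zero

namespace Queer

theorem IsRegularNilpotent.eq_zero {n : ℕ} {χ : Queer n →ₗ[ℂ] ℂ} (hχ : IsRegularNilpotent χ)
    (hn : n ≤ 1) : χ = 0 := by
  obtain ⟨M, rfl, hM, -⟩ := hχ.exists_matrix
  have : M = 0 := by
    interval_cases n
    · exact Subsingleton.elim _ _
    · rwa [pow_one] at hM
  subst this
  ext1 <;> ext1 <;> simp

end Queer

theorem mainTheorem5 (n : ℕ) (χ : Queer n →ₗ[ℂ] ℂ) (hχ : Queer.IsRegularNilpotent χ)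
    (gr : ℤ → Submodule ℂ (Queer n)) (hgr : IsGoodGrading χ gr)
    (l : Submodule ℂ (Queer n)) (hl : IsMaxIsotropic χ gr l) :
    Module.finrank ℂ ↥(annihilator χ ⊓ LieSuperalgebra.part 0) = n ∧
    Module.finrank ℂ ↥(annihilator χ ⊓ LieSuperalgebra.part 1) = n ∧
    Even (Module.finrank ℂ ↥(gr (-1) ⊓ LieSuperalgebra.part 1)) ∧
    ∃ φ : SymAnn χ ≃ₐ[ℂ] GrW χ gr l,
      ∀ (p : ZMod 2) (k : ℤ),
        (SymAnn.bidegree χ gr p k).map φ.toLinearMap = GrW.bidegree χ gr l p k := by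
  -- For n ≤ 1 the functional is zero and the grading need not be principal. In all cases g_{-1} =
  -- 0, so l = 0 and the parity condition on its odd part is trivial.
  rcases n with _ | _ | N
  · obtain rfl := hχ.eq_zero (Nat.zero_le 1)
    let b : Module.Basis Empty ℂ (Queer 0) := Module.Basis.empty _
    have hA : IsAssocGraded b (fun _ => 0) (fun _ => 0) (0 : Queer 0 →ₗ[ℂ] Queer 0 →ₗ[ℂ] Queer 0) :=
      { hom := IsHomogeneousBasis.of_mem LieSuperalgebra.iSupIndep_part fun i => i.elim
        assoc := fun i => i.elim
        mul_mem := fun i => i.elim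
        bracket_eq := fun i => i.elim }
    have hb : IsHomogeneousBasis gr b (fun _ => 0) :=
      IsHomogeneousBasis.of_mem hgr.isInternal.submodule_iSupIndep fun i => i.elim
    have hbot : gr (-1) = ⊥ := hb.eq_bot fun i => i.elim
    obtain rfl := hl.eq_bot hbot
    exact ⟨Module.finrank_zero_of_subsingleton, Module.finrank_zero_of_subsingleton,
      even_finrank_of_eq_bot hbot, hA.exists_algEquiv_zero hb fun i => i.elim⟩
  · obtain rfl := hχ.eq_zero le_rfl
    obtain ⟨deg, hA, hb, h0⟩ := Queer.exists_isAssocGraded_one hgr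
    have hbot : gr (-1) = ⊥ := hb.eq_bot fun i hi => by
      have := h0 i
      omega
    obtain rfl := hl.eq_bot hbot
    have hrank : ∀ p : ZMod 2, Module.finrank ℂ
        ↥(annihilator (0 : Queer 1 →ₗ[ℂ] ℂ) ⊓ LieSuperalgebra.part p) = 1 := by
      intro p
      rw [annihilator_zero, top_inf_eq, hA.hom.finrank_eq p, Fintype.card_unique]
    exact ⟨hrank 0, hrank 1, even_finrank_of_eq_bot hbot, hA.exists_algEquiv_zero hb h0⟩
  · obtain ⟨b, hb⟩ := Queer.exists_isPrincipalBasis (N := N + 1) (by omega) hχ hgr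
    have hbot := hb.gr_neg_one_eq_bot
    have hlb : l = ⊥ := hl.eq_bot hbot
    subst hlb
    exact ⟨hb.finrank_annihilator_inf_part 0, hb.finrank_annihilator_inf_part 1,
      even_finrank_of_eq_bot hbot, hb.exists_algEquiv⟩
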